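/- Setting. A generalised Lorentzian Lie algebra $(\mathfrak g,H,\mathcal G_g)$ consists of a finite-dimensional real Lie algebra $\mathfrak g$ of dimension $n$, a metric $g$ on $\mathfrak g$ of signature $(n-1,1)$ and a closed form $H\in\Lambda^3\mathfrak g^*$. On $E=\mathfrak g\oplus\mathfrak g^*$ one has the pairing $\langle X+\xi,Y+\eta\rangle=\frac12(\eta(X)+\xi(Y))$, the $H$-twisted Dorfman bracket $[X+\xi,Y+\eta]_H=[X,Y]+\mathcal L_X\eta-Y\lrcorner d\xi+H(X,Y,\cdot)$ and the generalised metric $\mathcal G_g(X+\xi)=g^{-1}\xi+gX$ with $\pm1$-eigenspaces $E_\pm$. A generalised Levi-Civita connection is a linear map $D:E\to\mathrm{End}(E)$, $a\mapsto D_a$, that satisfies $\langle D_ab,c\rangle+\langle b,D_ac\rangle=0$ and $D_a\mathcal G_g=\mathcal G_gD_a$ and whose torsion $D_ab-D_ba-[a,b]_H+(Da)^*b$ vanishes, where $Da$ is the map $c\mapsto D_ca$; its divergence is $\delta_D(a)=\mathrm{tr}(Da)$. With $R(a,b)c=D_aD_bc-D_bD_ac-D_{[a,b]_H}c$, its generalised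 Ricci curvatures are $\mathcal{RC}^+(v,u)=\mathrm{tr}(E_+\ni a\mapsto R(a,v)u)$ and $\mathcal{RC}^-(u,v)=\mathrm{tr}(E_-\ni a\mapsto R(a,u)v)$ for $u\in E_+$, $v\in E_-$. $(\mathfrak g,H,\mathcal G_g,\delta)$ is generalised Einstein if $\mathcal{RC}^+=0$ and $\mathcal{RC}^-=0$ for a generalised Levi-Civita connection with divergence $\delta$. Put $L_1(\alpha,\beta)=\begin{pmatrix}\alpha&-\beta\\ \beta&\alpha\end{pmatrix}$. A symmetric endomorphism of a Lorentzian vector space is of second type if it equals $\mathrm{diag}(L_1(\alpha,\beta),b_1,\dots,b_m)$ with $\beta>0$ in some orthonormal basis whose first vector is timelike (equivalently, if it has a non-real eigenvalue). Theorem. Let $(\mathfrak g,H,\mathcal G_g)$ be a generalised Lorentzian Lie algebra of dimension $n$ with $H\neq0$, and let $\mathfrak n\subset\mathfrak g$ be a non-degenerate Abelian ideal of codimension one. Let $X\in\mathfrak n^\perp$ with $g(X,X)\in\{1,-1\}$, put $f=\mathrm{ad}_X|_{\mathfrak n}$, and assume that the $g$-symmetric part $f^S$ of $f$ is not of second type.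 Then $(\mathfrak g,H,\mathcal G_g,\delta=0)$ is generalised Einstein if and only if there are - an orthonormal basis $(e_1,\dots,e_{n-1})$ of $\mathfrak n$ with $g(e_1,e_1)=-1$ and $g(e_i,e_i)=1$ for $i\ge2$ (in particular $n\geq 4$), - $k\in\{0,\dots,\lfloor\frac{n-4}2\rfloor\}$, real numbers $c_1\ge\dots\ge c_k>0$ and $u\in\mathbb R^{n-4}$, - with $U_1=\mathrm{span}(e_4,\dots,e_{3+2k})$ and $U_2=\mathrm{span}(e_{4+2k},\dots,e_{n-1})$: $b\in\mathbb R$, $\beta,\nu\in U_2^*$, $\tau_1\in\Lambda^2U_1^*$ and $\tau_2\in\Lambda^2U_2^*$, at least one of $b,\beta,\nu,\tau_1,\tau_2$ being non-zero, such that $\tau_1$ is of type $(1,1)$ with respect to $J=\mathrm{diag}(L_1(0,1),\dots,L_1(0,1))$ on $U_1$, i.e. $\tau_1(JY,JZ)=\tau_1(Y,Z)$ for all $Y,Z\in U_1$; $\tau_1(Y,Z)=0$ whenever $Y\in\mathrm{span}(e_{2+2i},e_{3+2i})$ and $Z\in\mathrm{span}(e_{2+2j},e_{3+2j})$ with $c_i\neq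 c_j$; $$H=(e^1+e^3)\wedge\bigl(-e^2\wedge(\nu+b\,X^\flat)+\beta\wedge X^\flat+\tau_1+\tau_2\bigr);$$ and, in the basis $(e_1,\dots,e_{n-1})$, $$f=\begin{pmatrix}0&-\frac{1+\tilde\rho}{\sqrt2}&0&u^t\\ \frac{1-\tilde\rho}{\sqrt2}&0&\frac{1-\tilde\rho}{\sqrt2}&0\\ 0&\frac{1+\tilde\rho}{\sqrt2}&0&-u^t\\ u&0&u&\mathrm{diag}(L_1(0,c_1),\dots,L_1(0,c_k),0,\dots,0)\end{pmatrix},\qquad \tilde\rho=\tfrac12\bigl(b^2+\|\beta\|^2+\|\nu\|^2+\|\tau_1\|^2+\|\tau_2\|^2\bigr).$$ Here $e^1,e^2,e^3$ are dual to the orthonormal basis $(e_1,\dots,e_{n-1},X)$ of $\mathfrak g$, $X^\flat=g(X,\cdot)$, forms on $U_i$ are extended by zero on $U_i^\perp$, and the norm on two-forms is the one for which the $e^i\wedge e^j$ with $i<j$ are orthonormal. -/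

import Mathlib

open Module

noncomputable section

namespace GenLie

/-! ### Pseudo-Riemannian metrics on vector spaces -/

/-- A pseudo-Riemannian metric on a real vector space. -/
structure PseudoMetric (V : Type*) [AddCommGroup V] [Module ℝ V] where
  form : LinearMap.BilinForm ℝ V
  symm : form.IsSymm
  nondegenerate : form.Nondegenerate

namespace PseudoMetric

variable {V : Type*} [AddCommGroup V] [Module ℝ V]

/-- Signature `(n - 1, 1)`, where `n` is the dimension. -/
def IsLorentzian (g : PseudoMetric V) : Prop :=
  sigPos (LinearMap.BilinMap.toQuadraticMap g.form) + 1 = finrank ℝ V ∧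
    sigNeg (LinearMap.BilinMap.toQuadraticMap g.form) = 1

/-- `e` is an orthonormal family with `g (e i₀) (e i₀) = -1` and `g (e i) (e i) = 1` for `i ≠ i₀`. -/
def IsLorentzFrame (g : PseudoMetric V) {ι : Type*} [DecidableEq ι] (i₀ : ι) (e : ι → V) : Prop :=
  ∀ i j, g.form (e i) (e j) = if i = j then (if i = i₀ then -1 else 1) else 0

/-- The metric induced on a non-degenerate subspace. -/
def restrict (g : PseudoMetric V) (W : Submodule ℝ V)
    (hW : (g.form.restrict W).Nondegenerate) : PseudoMetric W where
  form := g.form.restrict W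
  symm := ⟨fun x y => g.symm.eq (x : V) (y : V)⟩
  nondegenerate := hW

variable [FiniteDimensional ℝ V]

/-- The isomorphism `V → V*`, `v ↦ v♭ = g(v, ·)`. -/
def flat (g : PseudoMetric V) : V ≃ₗ[ℝ] Dual ℝ V :=
  g.form.toDual g.nondegenerate

/-- The adjoint `f^*` of an endomorphism: `g (f^* x) y = g x (f y)`. -/
def adjoint (g : PseudoMetric V) (f : End ℝ V) : End ℝ V :=
  g.form.leftAdjointOfNondegenerate g.nondegenerate f

/-- The symmetric part `f^S = (f + f^*) / 2` of an endomorphism. -/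
def symmPart (g : PseudoMetric V) (f : End ℝ V) : End ℝ V :=
  (1 / 2 : ℝ) • (f + g.adjoint f)

/-- The one-form `e^i = g(e_i, e_i) g(e_i, ·)`. For an orthonormal family it is the dual covector
of `e_i` vanishing on the orthogonal complement of `e_i`, see `coframe_apply`. -/
def coframe (g : PseudoMetric V) {ι : Type*} (e : ι → V) (i : ι) : Dual ℝ V :=
  g.form (e i) (e i) • g.flat (e i)

theorem coframe_apply (g : PseudoMetric V) {ι : Type*} [DecidableEq ι] (i₀ : ι) (e : ι → V)
    (h : g.IsLorentzFrame i₀ e) (i j : ι) : g.coframe e i (e j) = if i = j then 1 else 0 := by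
  have h1 : g.flat (e i) (e j) = g.form (e i) (e j) := rfl
  simp only [coframe, LinearMap.smul_apply, h1, h i j, h i i, smul_eq_mul]
  split_ifs <;> simp

end PseudoMetric

/-! ### Symmetric endomorphisms of second type -/

/-- The matrix `L₁(α, β)`. -/
def L₁ (α β : ℝ) : Matrix (Fin 2) (Fin 2) ℝ := !![α, -β; β, α]

/-- A symmetric endomorphism `S` of a Lorentzian vector space is of second type if, in some
orthonormal basis whose first vector is timelike, it equals `diag(L₁(α, β), b₁, …, b_m)` with
`β > 0`. -/
def IsSecondType {V : Type*} [AddCommGroup V] [Module ℝ V] (g : PseudoMetric V)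
    (S : End ℝ V) : Prop :=
  ∃ (m : ℕ) (e : Basis (Fin 2 ⊕ Fin m) ℝ V) (α β : ℝ) (b : Fin m → ℝ),
    g.IsLorentzFrame (Sum.inl 0) e ∧ 0 < β ∧
      LinearMap.toMatrix e e S = Matrix.fromBlocks (L₁ α β) 0 0 (Matrix.diagonal b)

/-! ### Exterior forms -/

section Forms

variable {V : Type*} [AddCommGroup V] [Module ℝ V]

/-- The one-form `H(x, y, ·)`, bilinear in `x` and `y`. -/
def contract (H : V [⋀^Fin 3]→ₗ[ℝ] ℝ) : V →ₗ[ℝ] V →ₗ[ℝ] Dual ℝ V :=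
  LinearMap.mk₂ ℝ
    (fun x y =>
      { toFun := fun z => ((H.curryLeft x).curryLeft y).curryLeft z ![]
        map_add' := fun a b => by simp only [map_add, AlternatingMap.add_apply]
        map_smul' := fun c a => by
          simp only [map_smul, AlternatingMap.smul_apply, RingHom.id_apply] })
    (fun x x' y => by ext z; simp [AlternatingMap.curryLeft_add])
    (fun c x y => by ext z; simp [AlternatingMap.curryLeft_smul])
    (fun x y y' => by ext z; simp [AlternatingMap.curryLeft_add])
    (fun c x y => by ext z; simp [AlternatingMap.curryLeft_smul])

theorem contract_apply (H : V [⋀^Fin 3]→ₗ[ℝ] ℝ) (x y z : V) :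
    contract H x y z = H ![x, y, z] := rfl

/-- The wedge product `α ∧ β` of two one-forms. -/
def wedge₁₁ (α β : Dual ℝ V) : LinearMap.BilinForm ℝ V :=
  α.smulRight β - β.smulRight α

theorem wedge₁₁_apply (α β : Dual ℝ V) (x y : V) :
    wedge₁₁ α β x y = α x * β y - β x * α y := rfl

/-- The wedge product `θ ∧ ω` of a one-form and a two-form. -/
def wedge₁₂ (θ : Dual ℝ V) (ω : LinearMap.BilinForm ℝ V) (x y z : V) : ℝ :=
  θ x * ω y z - θ y * ω x z + θ z * ω x y

/-- `β` belongs to `U^*`, regarded as the space of one-forms on `V` that vanish on the orthogonal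
complement of `U`. -/
def IsOneFormOn (g : PseudoMetric V) (U : Submodule ℝ V) (β : Dual ℝ V) : Prop :=
  ∀ x, (∀ y ∈ U, g.form x y = 0) → β x = 0

/-- `τ` belongs to `Λ² U^*`, regarded as the space of two-forms on `V` that vanish when one of the
arguments is orthogonal to `U`. -/
def IsTwoFormOn (g : PseudoMetric V) (U : Submodule ℝ V) (τ : LinearMap.BilinForm ℝ V) : Prop :=
  τ.IsAlt ∧ ∀ x, (∀ y ∈ U, g.form x y = 0) → ∀ z, τ x z = 0

/-- The squared norm `∑ β(e_i)²` of a one-form in the orthonormal basis `e` of a Euclidean space. -/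
def normSq₁ {ι : Type*} [Fintype ι] (e : ι → V) (β : Dual ℝ V) : ℝ :=
  ∑ i, β (e i) ^ 2

/-- The squared norm of a two-form in the orthonormal basis `e` of a Euclidean space, normalised
such that the forms `e^i ∧ e^j`, `i < j`, are orthonormal. -/
def normSq₂ {ι : Type*} [Fintype ι] (e : ι → V) (τ : LinearMap.BilinForm ℝ V) : ℝ :=
  (1 / 2) * ∑ i, ∑ j, τ (e i) (e j) ^ 2

end Forms

/-! ### Generalised geometry on `E = 𝔤 ⊕ 𝔤*` -/

section Generalised

variable {𝔤 : Type*} [LieRing 𝔤] [LieAlgebra ℝ 𝔤]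

/-- The three-form `H` on `𝔤` is closed: its Chevalley-Eilenberg differential vanishes. -/
def IsClosedThreeForm (H : 𝔤 [⋀^Fin 3]→ₗ[ℝ] ℝ) : Prop :=
  ∀ w x y z : 𝔤,
    -H ![⁅w, x⁆, y, z] + H ![⁅w, y⁆, x, z] - H ![⁅w, z⁆, x, y]
      - H ![⁅x, y⁆, w, z] + H ![⁅x, z⁆, w, y] - H ![⁅y, z⁆, w, x] = 0

variable (𝔤) in
/-- The space `E(𝔤) = 𝔤 ⊕ 𝔤*`. -/
abbrev GenSpace : Type _ := 𝔤 × Dual ℝ 𝔤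

/-- The pairing `⟨X + ξ, Y + η⟩ = (η(X) + ξ(Y)) / 2`. -/
def pairing (a b : GenSpace 𝔤) : ℝ := (1 / 2) * (b.2 a.1 + a.2 b.1)

/-- The Lie derivative `(ℒ_X η)(Z) = -η([X, Z])` on left-invariant one-forms; it also equals
`X ⌟ dη`. -/
def lieDeriv : 𝔤 →ₗ[ℝ] Dual ℝ 𝔤 →ₗ[ℝ] Dual ℝ 𝔤 :=
  LinearMap.mk₂ ℝ (fun X η => -(η ∘ₗ (LieAlgebra.ad ℝ 𝔤 X : 𝔤 →ₗ[ℝ] 𝔤)))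
    (fun X X' η => by ext Z; simp [add_comm])
    (fun c X η => by ext Z; simp)
    (fun X η η' => by ext Z; simp [add_comm])
    (fun c X η => by ext Z; simp)

theorem lieDeriv_apply (X Z : 𝔤) (η : Dual ℝ 𝔤) : lieDeriv X η Z = -η ⁅X, Z⁆ := by
  simp [lieDeriv]

/-- The `H`-twisted Dorfman bracket
`[X + ξ, Y + η]_H = [X, Y] + ℒ_X η - Y ⌟ dξ + H(X, Y, ·)`. -/
def dorfman (H : 𝔤 [⋀^Fin 3]→ₗ[ℝ] ℝ) : GenSpace 𝔤 →ₗ[ℝ] GenSpace 𝔤 →ₗ[ℝ] GenSpace 𝔤 :=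
  LinearMap.mk₂ ℝ
    (fun a b => (⁅a.1, b.1⁆, lieDeriv a.1 b.2 - lieDeriv b.1 a.2 + contract H a.1 b.1))
    (fun a a' b => by
      ext <;> (simp; try ring))
    (fun c a b => by
      ext <;> (simp; try ring))
    (fun a b b' => by
      ext <;> (simp; try ring))
    (fun c a b => by
      ext <;> (simp; try ring))

variable [FiniteDimensional ℝ 𝔤]

/-- The generalised metric `𝒢_g (X + ξ) = g⁻¹ ξ + g X`. -/
def genMetric (g : PseudoMetric 𝔤) : End ℝ (GenSpace 𝔤) :=
  LinearMap.prod ((g.flat.symm : Dual ℝ 𝔤 →ₗ[ℝ] 𝔤) ∘ₗ LinearMap.snd ℝ 𝔤 (Dual ℝ 𝔤))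
    ((g.flat : 𝔤 →ₗ[ℝ] Dual ℝ 𝔤) ∘ₗ LinearMap.fst ℝ 𝔤 (Dual ℝ 𝔤))

/-- The `+1`-eigenspace `E₊` of `𝒢_g`. -/
def Epos (g : PseudoMetric 𝔤) : Submodule ℝ (GenSpace 𝔤) := End.eigenspace (genMetric g) 1

/-- The `-1`-eigenspace `E₋` of `𝒢_g`. -/
def Eneg (g : PseudoMetric 𝔤) : Submodule ℝ (GenSpace 𝔤) := End.eigenspace (genMetric g) (-1)

/-- A (left-invariant) generalised Levi-Civita connection `D` of `𝒢_g`, where `D a b` stands for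
`D_a b`: it is compatible with the pairing and with `𝒢_g`, and its torsion
`T(a, b) = D_a b - D_b a - [a, b]_H + (D a)^* b` vanishes. Here `(D a)^*` is the adjoint
of `c ↦ D_c a` with respect to the non-degenerate pairing. -/
structure GenLeviCivita (g : PseudoMetric 𝔤) (H : 𝔤 [⋀^Fin 3]→ₗ[ℝ] ℝ) where
  D : GenSpace 𝔤 →ₗ[ℝ] GenSpace 𝔤 →ₗ[ℝ] GenSpace 𝔤
  pairing_compat : ∀ a b c, pairing (D a b) c + pairing b (D a c) = 0
  torsion_free : ∀ a b c, pairing (D a b - D b a - dorfman H a b) c + pairing b (D c a) = 0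
  metric : ∀ a b, D a (genMetric g b) = genMetric g (D a b)

namespace GenLeviCivita

variable {g : PseudoMetric 𝔤} {H : 𝔤 [⋀^Fin 3]→ₗ[ℝ] ℝ} (D : GenLeviCivita g H)

/-- The divergence operator `δ_D(a) = tr(c ↦ D_c a)`. -/
def divergence : Dual ℝ (GenSpace 𝔤) :=
  LinearMap.trace ℝ (GenSpace 𝔤) ∘ₗ D.D.flip

/-- The map `a ↦ R(a, b) c = D_a D_b c - D_b D_a c - D_{[a, b]} c`. -/
def curvature (b c : GenSpace 𝔤) : End ℝ (GenSpace 𝔤) :=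
  D.D.flip (D.D b c) - D.D b ∘ₗ D.D.flip c - D.D.flip c ∘ₗ (dorfman H).flip b

theorem curvature_apply (a b c : GenSpace 𝔤) :
    D.curvature b c a = D.D a (D.D b c) - D.D b (D.D a c) - D.D (dorfman H a b) c := rfl

theorem curvature_mem (μ : ℝ) (a b c : GenSpace 𝔤) (hc : c ∈ End.eigenspace (genMetric g) μ) :
    D.curvature b c a ∈ End.eigenspace (genMetric g) μ := by
  rw [End.mem_eigenspace_iff] at hc ⊢
  simp only [curvature_apply, map_sub, ← D.metric, hc, map_smul, smul_sub]

/-- `𝓡𝓒⁺(v, u) = tr(E₊ ∋ a ↦ R(a, v) u ∈ E₊)` for `v ∈ E₋`, `u ∈ E₊`. -/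
def ricciPos (v : Eneg g) (u : Epos g) : ℝ :=
  LinearMap.trace ℝ (Epos g)
    (((D.curvature (v : GenSpace 𝔤) (u : GenSpace 𝔤)) ∘ₗ (Epos g).subtype).codRestrict (Epos g)
      (fun a => D.curvature_mem 1 a v u u.2))

/-- `𝓡𝓒⁻(u, v) = tr(E₋ ∋ a ↦ R(a, u) v ∈ E₋)` for `u ∈ E₊`, `v ∈ E₋`. -/
def ricciNeg (u : Epos g) (v : Eneg g) : ℝ :=
  LinearMap.trace ℝ (Eneg g)
    (((D.curvature (u : GenSpace 𝔤) (v : GenSpace 𝔤)) ∘ₗ (Eneg g).subtype).codRestrict (Eneg g)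
      (fun a => D.curvature_mem (-1) a u v v.2))

end GenLeviCivita

/-- `(𝔤, H, 𝒢_g, δ)` is generalised Einstein: the generalised Ricci curvature
`𝓡𝓒⁺ - 𝓡𝓒⁻ ∈ E₋^* ⊗ E₊^* ⊕ E₊^* ⊗ E₋^*` of a generalised Levi-Civita connection with divergence
`δ` vanishes, that is, both of its components vanish. -/
def IsGeneralisedEinstein (g : PseudoMetric 𝔤) (H : 𝔤 [⋀^Fin 3]→ₗ[ℝ] ℝ)
    (δ : Dual ℝ (GenSpace 𝔤)) : Prop :=
  ∃ D : GenLeviCivita g H, D.divergence = δ ∧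
    (∀ v u, D.ricciPos v u = 0) ∧ (∀ u v, D.ricciNeg u v = 0)

end Generalised

/-! ### The normal form -/

section NormalForm

/-- The indices of a basis `(e₁, …, e_{n-1})` of `𝔫`: three indices for `e₁, e₂, e₃`; the indices
`(0, i)` and `(1, i)`, `i < k`, for the two vectors of the `i`-th pair of `U₁`; and `l` indices for
`U₂`. Thus `n - 4 = 2 * k + l`. -/
abbrev Idx (k l : ℕ) : Type := Fin 3 ⊕ ((Fin 2 × Fin k) ⊕ Fin l)

/-- The matrix of `f`, in blocks for `span(e₁, e₂, e₃) ⊕ (U₁ ⊕ U₂)`. -/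
def normalForm (k l : ℕ) (c : Fin k → ℝ) (u : (Fin 2 × Fin k) ⊕ Fin l → ℝ) (ρ : ℝ) :
    Matrix (Idx k l) (Idx k l) ℝ :=
  Matrix.fromBlocks
    !![0, -((1 + ρ) / √2), 0;
       (1 - ρ) / √2, 0, (1 - ρ) / √2;
       0, (1 + ρ) / √2, 0]
    (Matrix.of ![u, 0, -u])
    (Matrix.of fun j => ![u j, 0, u j])
    (Matrix.fromBlocks (Matrix.blockDiagonal fun i => L₁ 0 (c i)) 0 0 0)

variable {V : Type*} [AddCommGroup V] [Module ℝ V] [FiniteDimensional ℝ V]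

/-- The basis `(e₁, …, e_{n-1})` of the subspace `W`, as a family of vectors of `V`. -/
def frame {W : Submodule ℝ V} {k l : ℕ} (e : Basis (Idx k l) ℝ W) : Idx k l → V :=
  fun i => (e i : V)

/-- The basis of `U₁`. -/
def frame₁ {W : Submodule ℝ V} {k l : ℕ} (e : Basis (Idx k l) ℝ W) : Fin 2 × Fin k → V :=
  fun p => frame e (Sum.inr (Sum.inl p))

/-- The basis of `U₂`. -/
def frame₂ {W : Submodule ℝ V} {k l : ℕ} (e : Basis (Idx k l) ℝ W) : Fin l → V :=
  fun q => frame e (Sum.inr (Sum.inr q))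

def U₁ {W : Submodule ℝ V} {k l : ℕ} (e : Basis (Idx k l) ℝ W) : Submodule ℝ V :=
  Submodule.span ℝ (Set.range (frame₁ e))

def U₂ {W : Submodule ℝ V} {k l : ℕ} (e : Basis (Idx k l) ℝ W) : Submodule ℝ V :=
  Submodule.span ℝ (Set.range (frame₂ e))

/-- The one-forms `e^1, e^2, e^3`, numbered from `0`. -/
def dual₃ (g : PseudoMetric V) {W : Submodule ℝ V} {k l : ℕ} (e : Basis (Idx k l) ℝ W)
    (i : Fin 3) : Dual ℝ V :=
  g.coframe (frame e) (Sum.inl i)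

/-- The endomorphism of `V` with matrix `diag(L₁(0, 1), …, L₁(0, 1))` in the orthonormal family
`v`, extended by zero to the orthogonal complement of `v`. -/
def complexStructure (g : PseudoMetric V) {k : ℕ} (v : Fin 2 × Fin k → V) : End ℝ V :=
  ∑ p, ∑ q, Matrix.blockDiagonal (fun _ : Fin k => L₁ 0 1) q p • (g.coframe v p).smulRight (v q)

end NormalForm

end GenLie

end

/-! The generalised geometry is removed first. The maps x ↦ x ± gx identify E₊ and E₋ with 𝔤.
Vanishing torsion forces the mixed components of every generalised Levi-Civita connection to be
projections of the Dorfman bracket, and for divergence zero the Ricci traces involve nothing else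
(`trace_curvature_of_splitting`): both are -tr(∇⁺x ∘ ∇⁻y). A connection of divergence zero exists
(`canonicalGenLeviCivita`), so being Einstein means that this trace vanishes for all x and y
(`isGeneralisedEinstein_iff`).

Let S and A be twice the symmetric and skew parts of ad_X on the ideal N, and ω = H(X,·,·). The
trace then splits into the scalar equation |S|² + |ω|² = 0, a symmetric and a skew equation on N,
and a mixed equation for X and N (`ricciForm_XX`, `ricciForm_NN`, `ricciForm_XN`). If N is
Euclidean, or if S has a timelike eigenvector, suitable diagonal equations are sums of squares and
give H = 0. A symmetric endomorphism that is not of second type has a causal eigenvector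
(`exists_causal_eigenvector`). Hence X is spacelike and S has a null eigenvector l.

Complete l to a null frame (l, l', e). The only obstacle to reading the equations as sums of squares
is the number ∑ A(l,eᵢ) S(l',eᵢ). Contracting the (eᵢ,eⱼ) equations twice with q = A(l,·), and using
dH = 0 and Lagrange's identity, shows that it is zero (`nullFrame_vanishing`). Then H is divisible
by g(l,·), and `nullFrame_rigidity` uses H ≠ 0 to obtain A(l,·) = 0 and S(l',eᵢ) ≠ 0 for some i. So
S is, up to scale, the symmetric product of l♭ with a unit vector s♭.

What is left is the (l',l') equation, which fixes A(l',s) = -2ρ̃ through the norm of H, together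
with the statement that H(X,l',·) and H(l',·,·) on the span of the frame vectors e are annihilated
by the rotational part of ad_X. In the normal form of that skew endomorphism this gives U₁, U₂ and
the conditions on τ₁ (`IsLorentzOn.exists_isNormalFrame`). Conversely, in such a frame all equations
other than the (l',l') one hold by vanishing or cancellation of components. The orthonormal basis of
the theorem has e₁ = (l' - l)/√2, e₂ = s, e₃ = (l + l')/√2, whence e¹ + e³ = √2 l♭. -/

noncomputable section

namespace GenLie

/-! ### Traces of curvature and of skew endomorphisms. -/

section TraceLemmas

variable {V E : Type*} [AddCommGroup V] [Module ℝ V] [FiniteDimensional ℝ V]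
  [AddCommGroup E] [Module ℝ E] [FiniteDimensional ℝ E]

/-- The trace of the curvature of a torsion-free divergence-free connection over one of the two
summands, for mixed arguments. -/
theorem trace_curvature_of_splitting (i j : V →ₗ[ℝ] E) (p q : E →ₗ[ℝ] V)
    (hsum : ∀ a, i (p a) + j (q a) = a)
    (D B : E →ₗ[ℝ] E →ₗ[ℝ] E) (hD : ∀ a x, q (D a (i x)) = 0)
    (hDB : ∀ z x, p (D (j z) (i x)) = p (B (j z) (i x)))
    (hB : ∀ z y, p (B (i z) (j y)) = -p (B (j y) (i z)))
    (htr : ∀ x, LinearMap.trace ℝ E (D.flip (i x)) = 0) (x y : V) :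
    LinearMap.trace ℝ V (p ∘ₗ (D.flip (D (j y) (i x)) - D (j y) ∘ₗ D.flip (i x)
      - D.flip (i x) ∘ₗ B.flip (j y)) ∘ₗ i)
    = -LinearMap.trace ℝ V ((p ∘ₗ B.flip (i x) ∘ₗ j) ∘ₗ (q ∘ₗ B.flip (j y) ∘ₗ i)) := by
  have hDi : ∀ a x, D a (i x) = i (p (D a (i x))) := fun a x => by
    conv_lhs => rw [← hsum (D a (i x)), hD, map_zero, add_zero]
  set T₁ : V →ₗ[ℝ] V := p ∘ₗ D (j y) ∘ₗ i with hT₁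
  set T₂ : V →ₗ[ℝ] V := p ∘ₗ D.flip (i x) ∘ₗ i with hT₂
  -- Every D_a preserves the image of i, so this partial trace equals the full divergence of
  -- D_{jy}(ix), which is zero.
  have h1 : LinearMap.trace ℝ V (p ∘ₗ D.flip (D (j y) (i x)) ∘ₗ i) = 0 := by
    rw [LinearMap.trace_comp_comm', hDi, LinearMap.comp_assoc,
      ← htr (p (D (j y) (i x))), LinearMap.trace_comp_comm']
    congr 1
    ext a
    simp only [LinearMap.comp_apply, LinearMap.flip_apply]
    rw [← hDi]
  have h2 : p ∘ₗ (D.flip (D (j y) (i x)) - D (j y) ∘ₗ D.flip (i x)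
      - D.flip (i x) ∘ₗ B.flip (j y)) ∘ₗ i
      = p ∘ₗ D.flip (D (j y) (i x)) ∘ₗ i - T₁ ∘ₗ T₂ + T₂ ∘ₗ T₁
        - (p ∘ₗ B.flip (i x) ∘ₗ j) ∘ₗ (q ∘ₗ B.flip (j y) ∘ₗ i) := by
    ext z
    simp only [LinearMap.comp_apply, LinearMap.sub_apply, LinearMap.add_apply,
      LinearMap.flip_apply, map_sub, hT₁, hT₂]
    rw [← hDi (i z) x]
    -- The bracket [iz, jy] is split into its two components. The i-component is -T₁z and completes
    -- a commutator of T₁ and T₂, which has no trace; only the j-component survives.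
    conv_lhs =>
      rw [← hsum (B (i z) (j y)), hB, ← hDB]
    simp only [map_add, map_neg, LinearMap.add_apply, LinearMap.neg_apply, hDB]
    abel
  rw [h2, map_sub, map_add, map_sub, h1, LinearMap.trace_comp_comm' T₁ T₂]
  ring

/-- Skewness says that T = -g⁻¹Tᵗg, and Tᵗ has the same trace as T. -/
theorem trace_eq_zero_of_skew (g : PseudoMetric V) (T : End ℝ V)
    (hT : ∀ x y, g.form (T x) y = -g.form x (T y)) : LinearMap.trace ℝ V T = 0 := by
  have h : T = -((g.flat.symm : Dual ℝ V →ₗ[ℝ] V) ∘ₗ Dual.transpose (R := ℝ) T ∘ₗ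
      (g.flat : V →ₗ[ℝ] Dual ℝ V)) := by
    ext x
    apply g.flat.injective
    ext y
    simp only [LinearMap.neg_apply, LinearMap.comp_apply, LinearEquiv.coe_coe, map_neg,
      LinearEquiv.apply_symm_apply]
    exact hT x y
  have h2 : LinearMap.trace ℝ V T = -LinearMap.trace ℝ V T := by
    conv_lhs => rw [h]
    rw [map_neg, LinearMap.trace_comp_comm', LinearMap.comp_assoc]
    have : ((g.flat : V →ₗ[ℝ] Dual ℝ V) ∘ₗ (g.flat.symm : Dual ℝ V →ₗ[ℝ] V)) = LinearMap.id := by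
      ext; simp
    rw [this, LinearMap.comp_id, LinearMap.trace_transpose']
  linarith

end TraceLemmas

/-! ### The Dorfman bracket and the splitting E = E₊ ⊕ E₋. -/

section Splitting

variable {𝔤 : Type*} [LieRing 𝔤] [LieAlgebra ℝ 𝔤]

/-- On left-invariant sections the pairing is constant, so the bracket behaves like that of a
quadratic Lie algebra: in this form the expression is visibly cyclic, and its total skewness is what
the symmetry and trace arguments use. -/
theorem pairing_dorfman (H : 𝔤 [⋀^Fin 3]→ₗ[ℝ] ℝ) (a b c : GenSpace 𝔤) :
    pairing (dorfman H a b) c = (1 / 2) * (H ![a.1, b.1, c.1] + c.2 ⁅a.1, b.1⁆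
      + a.2 ⁅b.1, c.1⁆ + b.2 ⁅c.1, a.1⁆) := by
  have h : dorfman H a b = (⁅a.1, b.1⁆, lieDeriv a.1 b.2 - lieDeriv b.1 a.2
    + contract H a.1 b.1) := rfl
  rw [h, pairing]
  simp only [LinearMap.add_apply, LinearMap.sub_apply, lieDeriv_apply, contract_apply]
  rw [← lie_skew a.1 c.1, map_neg]
  ring

theorem pairing_add_left (a a' b : GenSpace 𝔤) :
    pairing (a + a') b = pairing a b + pairing a' b := by
  simp [pairing]; ring

theorem pairing_smul_left (t : ℝ) (a b : GenSpace 𝔤) :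
    pairing (t • a) b = t * pairing a b := by
  simp [pairing]; ring

theorem pairing_comm (a b : GenSpace 𝔤) : pairing a b = pairing b a := by
  simp [pairing]; ring

theorem pairing_add_right (a b b' : GenSpace 𝔤) :
    pairing a (b + b') = pairing a b + pairing a b' := by
  simp [pairing]; ring

theorem threeForm_swap₁₂ {V : Type*} [AddCommGroup V] [Module ℝ V] (H : V [⋀^Fin 3]→ₗ[ℝ] ℝ)
    (x y z : V) : H ![y, x, z] = -H ![x, y, z] := by
  have h := H.map_swap ![x, y, z] (show (0 : Fin 3) ≠ 1 by decide)
  rw [← h]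
  congr 1
  ext i; fin_cases i <;> simp [Equiv.swap_apply_def]

theorem threeForm_swap₂₃ {V : Type*} [AddCommGroup V] [Module ℝ V] (H : V [⋀^Fin 3]→ₗ[ℝ] ℝ)
    (x y z : V) : H ![x, z, y] = -H ![x, y, z] := by
  have h := H.map_swap ![x, y, z] (show (1 : Fin 3) ≠ 2 by decide)
  rw [← h]
  congr 1
  ext i; fin_cases i <;> simp [Equiv.swap_apply_def]

theorem pairing_dorfman_swap₁₂ (H : 𝔤 [⋀^Fin 3]→ₗ[ℝ] ℝ) (a b c : GenSpace 𝔤) :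
    pairing (dorfman H b a) c = -pairing (dorfman H a b) c := by
  rw [pairing_dorfman, pairing_dorfman, threeForm_swap₁₂, ← lie_skew a.1 b.1,
    ← lie_skew b.1 c.1, ← lie_skew c.1 a.1]
  simp only [map_neg]
  ring

theorem pairing_dorfman_swap₂₃ (H : 𝔤 [⋀^Fin 3]→ₗ[ℝ] ℝ) (a b c : GenSpace 𝔤) :
    pairing (dorfman H a c) b = -pairing (dorfman H a b) c := by
  rw [pairing_dorfman, pairing_dorfman, threeForm_swap₂₃, ← lie_skew a.1 b.1,
    ← lie_skew b.1 c.1, ← lie_skew c.1 a.1]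
  simp only [map_neg]
  ring

variable [FiniteDimensional ℝ 𝔤] (g : PseudoMetric 𝔤)

/-- The isomorphism `x ↦ x + g x` of `𝔤` with `E₊`. -/
def inclPos : 𝔤 →ₗ[ℝ] GenSpace 𝔤 := LinearMap.prod LinearMap.id (g.flat : 𝔤 →ₗ[ℝ] Dual ℝ 𝔤)

/-- The isomorphism `x ↦ x - g x` of `𝔤` with `E₋`. -/
def inclNeg : 𝔤 →ₗ[ℝ] GenSpace 𝔤 := LinearMap.prod LinearMap.id (-(g.flat : 𝔤 →ₗ[ℝ] Dual ℝ 𝔤))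

/-- The projection to `E₊`, read in `𝔤`. -/
def projPos : GenSpace 𝔤 →ₗ[ℝ] 𝔤 := (1 / 2 : ℝ) • (LinearMap.fst ℝ 𝔤 (Dual ℝ 𝔤)
  + (g.flat.symm : Dual ℝ 𝔤 →ₗ[ℝ] 𝔤) ∘ₗ LinearMap.snd ℝ 𝔤 (Dual ℝ 𝔤))

/-- The projection to `E₋`, read in `𝔤`. -/
def projNeg : GenSpace 𝔤 →ₗ[ℝ] 𝔤 := (1 / 2 : ℝ) • (LinearMap.fst ℝ 𝔤 (Dual ℝ 𝔤)
  - (g.flat.symm : Dual ℝ 𝔤 →ₗ[ℝ] 𝔤) ∘ₗ LinearMap.snd ℝ 𝔤 (Dual ℝ 𝔤))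

theorem inclPos_apply (x : 𝔤) : inclPos g x = (x, g.flat x) := rfl

theorem inclNeg_apply (x : 𝔤) : inclNeg g x = (x, -g.flat x) := rfl

theorem projPos_apply (a : GenSpace 𝔤) :
    projPos g a = (1 / 2 : ℝ) • (a.1 + g.flat.symm a.2) := rfl

theorem projNeg_apply (a : GenSpace 𝔤) :
    projNeg g a = (1 / 2 : ℝ) • (a.1 - g.flat.symm a.2) := rfl

@[simp] theorem projPos_inclPos (x : 𝔤) : projPos g (inclPos g x) = x := by
  rw [projPos_apply, inclPos_apply]; simp only [LinearEquiv.symm_apply_apply]; module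

@[simp] theorem projNeg_inclNeg (x : 𝔤) : projNeg g (inclNeg g x) = x := by
  rw [projNeg_apply, inclNeg_apply]; simp only [map_neg, LinearEquiv.symm_apply_apply]; module

@[simp] theorem projNeg_inclPos (x : 𝔤) : projNeg g (inclPos g x) = 0 := by
  rw [projNeg_apply, inclPos_apply]; simp only [LinearEquiv.symm_apply_apply]; module

@[simp] theorem projPos_inclNeg (x : 𝔤) : projPos g (inclNeg g x) = 0 := by
  rw [projPos_apply, inclNeg_apply]; simp only [map_neg, LinearEquiv.symm_apply_apply]; module

theorem incl_proj_add (a : GenSpace 𝔤) :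
    inclPos g (projPos g a) + inclNeg g (projNeg g a) = a := by
  rw [inclPos_apply, inclNeg_apply, projPos_apply, projNeg_apply]
  ext1
  · simp only [Prod.fst_add]; module
  · simp only [Prod.snd_add, map_smul, map_add, map_sub, LinearEquiv.apply_symm_apply]; module

@[simp] theorem genMetric_inclPos (x : 𝔤) : genMetric g (inclPos g x) = inclPos g x := by
  ext1 <;> simp [genMetric, inclPos]

@[simp] theorem genMetric_inclNeg (x : 𝔤) : genMetric g (inclNeg g x) = -inclNeg g x := by
  ext1 <;> simp [genMetric, inclNeg]

theorem pairing_inclPos (a : GenSpace 𝔤) (x : 𝔤) :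
    pairing a (inclPos g x) = g.form (projPos g a) x := by
  rw [inclPos_apply, projPos_apply, pairing]
  have h : a.2 x = g.form (g.flat.symm a.2) x := by
    conv_lhs => rw [← g.flat.apply_symm_apply a.2]
    rfl
  have h2 : g.flat x a.1 = g.form a.1 x := g.symm.eq x a.1
  simp only [map_smul, map_add, LinearMap.smul_apply, LinearMap.add_apply, smul_eq_mul, h, h2]

theorem pairing_inclNeg (a : GenSpace 𝔤) (x : 𝔤) :
    pairing a (inclNeg g x) = -g.form (projNeg g a) x := by
  rw [inclNeg_apply, projNeg_apply, pairing]
  have h : a.2 x = g.form (g.flat.symm a.2) x := by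
    conv_lhs => rw [← g.flat.apply_symm_apply a.2]
    rfl
  have h2 : g.flat x a.1 = g.form a.1 x := g.symm.eq x a.1
  simp only [map_smul, map_sub, LinearMap.smul_apply, LinearMap.sub_apply, smul_eq_mul, h, h2,
    LinearMap.neg_apply]
  ring

theorem form_ext {V : Type*} [AddCommGroup V] [Module ℝ V] (g : PseudoMetric V) {x y : V}
    (h : ∀ z, g.form x z = g.form y z) : x = y := by
  rw [← sub_eq_zero]
  apply g.nondegenerate.1
  intro z
  rw [map_sub, LinearMap.sub_apply, h, sub_self]

theorem mem_Epos_iff (a : GenSpace 𝔤) : a ∈ Epos g ↔ inclPos g (projPos g a) = a := by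
  rw [Epos, End.mem_eigenspace_iff]
  constructor
  · intro h
    rw [← incl_proj_add g a] at h
    simp only [map_add, genMetric_inclPos, genMetric_inclNeg, one_smul] at h
    have h2 : (2 : ℝ) • inclNeg g (projNeg g a) = 0 := by
      rw [two_smul]; nth_rewrite 1 [← add_left_cancel h]; simp
    have h3 : inclNeg g (projNeg g a) = 0 := (smul_eq_zero.1 h2).resolve_left two_ne_zero
    conv_rhs => rw [← incl_proj_add g a, h3, add_zero]
  · intro h
    rw [← h, genMetric_inclPos, one_smul]

theorem mem_Eneg_iff (a : GenSpace 𝔤) : a ∈ Eneg g ↔ inclNeg g (projNeg g a) = a := by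
  rw [Eneg, End.mem_eigenspace_iff]
  constructor
  · intro h
    rw [← incl_proj_add g a] at h
    simp only [map_add, genMetric_inclPos, genMetric_inclNeg, neg_smul, one_smul, neg_add] at h
    have h2 : (2 : ℝ) • inclPos g (projPos g a) = 0 := by
      rw [two_smul]; nth_rewrite 1 [add_right_cancel h]; simp
    have h3 : inclPos g (projPos g a) = 0 := (smul_eq_zero.1 h2).resolve_left two_ne_zero
    conv_rhs => rw [← incl_proj_add g a, h3, zero_add]
  · intro h
    rw [← h, genMetric_inclNeg, neg_smul, one_smul]

/-- Since p inverts i on W, cyclicity of the trace moves the computation from the eigenspace to 𝔤.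
-/
theorem trace_restrict_of_retract {V E : Type*} [AddCommGroup V] [Module ℝ V]
    [FiniteDimensional ℝ V] [AddCommGroup E] [Module ℝ E] [FiniteDimensional ℝ E]
    (W : Submodule ℝ E) (i : V →ₗ[ℝ] E) (p : E →ₗ[ℝ] V) (hi : ∀ x, i x ∈ W)
    (hip : ∀ a ∈ W, i (p a) = a) (T : W →ₗ[ℝ] W) (S : E →ₗ[ℝ] E)
    (hTS : ∀ a : W, (T a : E) = S a) :
    LinearMap.trace ℝ W T = LinearMap.trace ℝ V (p ∘ₗ S ∘ₗ i) := by
  have h1 : (i.codRestrict W hi) ∘ₗ (p ∘ₗ W.subtype) = LinearMap.id := by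
    ext a
    simp [hip a a.2]
  have h2 : T = (T ∘ₗ i.codRestrict W hi) ∘ₗ (p ∘ₗ W.subtype) := by
    rw [LinearMap.comp_assoc, h1, LinearMap.comp_id]
  rw [h2, LinearMap.trace_comp_comm']
  congr 1
  ext x
  simp [hTS]

/-- The map `z ↦ D_{z₋} x₊`, read in `𝔤`: this is `∇⁺ x` for the connection with torsion `H`. -/
def covPos (H : 𝔤 [⋀^Fin 3]→ₗ[ℝ] ℝ) (x : 𝔤) : End ℝ 𝔤 :=
  projPos g ∘ₗ (dorfman H).flip (inclPos g x) ∘ₗ inclNeg g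

/-- The map `z ↦ D_{z₊} x₋`, read in `𝔤`: this is `∇⁻ x` for the connection with torsion `-H`. -/
def covNeg (H : 𝔤 [⋀^Fin 3]→ₗ[ℝ] ℝ) (x : 𝔤) : End ℝ 𝔤 :=
  projNeg g ∘ₗ (dorfman H).flip (inclNeg g x) ∘ₗ inclPos g

/-- The bilinear form `g (∇⁺_z x, w)`. -/
def covForm (H : 𝔤 [⋀^Fin 3]→ₗ[ℝ] ℝ) (x z w : 𝔤) : ℝ :=
  (1 / 2) * (H ![z, x, w] + g.form ⁅z, x⁆ w - g.form ⁅x, w⁆ z + g.form ⁅w, z⁆ x)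

theorem form_covPos (H : 𝔤 [⋀^Fin 3]→ₗ[ℝ] ℝ) (x z w : 𝔤) :
    g.form (covPos g H x z) w = covForm g H x z w := by
  have h : covPos g H x z = projPos g (dorfman H (inclNeg g z) (inclPos g x)) := rfl
  have h2 : ∀ u v, g.flat u v = g.form v u := fun u v => g.symm.eq u v
  rw [h, ← pairing_inclPos, pairing_dorfman, covForm]
  simp only [inclPos_apply, inclNeg_apply, LinearMap.neg_apply, h2]
  ring

theorem form_covNeg (H : 𝔤 [⋀^Fin 3]→ₗ[ℝ] ℝ) (x z w : 𝔤) :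
    g.form (covNeg g H x z) w = covForm g (-H) x z w := by
  have h : covNeg g H x z = projNeg g (dorfman H (inclPos g z) (inclNeg g x)) := rfl
  have h2 : ∀ u v, g.flat u v = g.form v u := fun u v => g.symm.eq u v
  rw [h, ← neg_neg (g.form _ _), ← pairing_inclNeg, pairing_dorfman, covForm]
  simp only [inclPos_apply, inclNeg_apply, LinearMap.neg_apply, h2, AlternatingMap.neg_apply]
  ring

end Splitting

/-! ### Ricci curvature for divergence zero, and existence of a connection. -/

section Einstein

variable {𝔤 : Type*} [LieRing 𝔤] [LieAlgebra ℝ 𝔤] [FiniteDimensional ℝ 𝔤]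
  {g : PseudoMetric 𝔤} {H : 𝔤 [⋀^Fin 3]→ₗ[ℝ] ℝ}

omit [FiniteDimensional ℝ 𝔤] in
theorem pairing_sub_left (a a' b : GenSpace 𝔤) :
    pairing (a - a') b = pairing a b - pairing a' b := by
  simp [pairing]; ring

theorem form_comm {V : Type*} [AddCommGroup V] [Module ℝ V] (g : PseudoMetric V) (x y : V) :
    g.form x y = g.form y x := g.symm.eq x y

namespace GenLeviCivita

variable (D : GenLeviCivita g H)

theorem projNeg_D_inclPos (a : GenSpace 𝔤) (x : 𝔤) : projNeg g (D.D a (inclPos g x)) = 0 := by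
  have h : D.D a (inclPos g x) ∈ Epos g := by
    rw [Epos, End.mem_eigenspace_iff, one_smul, ← D.metric, genMetric_inclPos]
  rw [← (mem_Epos_iff g _).1 h, projNeg_inclPos]

theorem projPos_D_inclNeg (a : GenSpace 𝔤) (x : 𝔤) : projPos g (D.D a (inclNeg g x)) = 0 := by
  have h : D.D a (inclNeg g x) ∈ Eneg g := by
    rw [Eneg, End.mem_eigenspace_iff, neg_one_smul, ← D.metric, genMetric_inclNeg, map_neg]
  rw [← (mem_Eneg_iff g _).1 h, projPos_inclNeg]

/-- When the torsion is paired with an element of E₊, the terms D_{x₊}z₋ and (Dz₋)^*x₊ drop out,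
because D preserves E₋ and E₋ is orthogonal to E₊. Hence the mixed components do not depend on the
connection. -/
theorem projPos_D_inclNeg_inclPos (z x : 𝔤) :
    projPos g (D.D (inclNeg g z) (inclPos g x))
      = projPos g (dorfman H (inclNeg g z) (inclPos g x)) := by
  apply form_ext g
  intro w
  have h := D.torsion_free (inclNeg g z) (inclPos g x) (inclPos g w)
  rw [pairing_comm (inclPos g x)] at h
  simp only [pairing_inclPos, projPos_D_inclNeg, map_sub, map_zero, LinearMap.zero_apply,
    LinearMap.sub_apply] at h
  linarith

theorem projNeg_D_inclPos_inclNeg (z x : 𝔤) :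
    projNeg g (D.D (inclPos g z) (inclNeg g x))
      = projNeg g (dorfman H (inclPos g z) (inclNeg g x)) := by
  apply form_ext g
  intro w
  have h := D.torsion_free (inclPos g z) (inclNeg g x) (inclNeg g w)
  rw [pairing_comm (inclNeg g x)] at h
  simp only [pairing_inclNeg, projNeg_D_inclPos, map_sub, map_zero, LinearMap.zero_apply,
    LinearMap.sub_apply] at h
  linarith

end GenLeviCivita

theorem projPos_dorfman_swap (z y : 𝔤) :
    projPos g (dorfman H (inclPos g z) (inclNeg g y))
      = -projPos g (dorfman H (inclNeg g y) (inclPos g z)) := by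
  apply form_ext g
  intro w
  rw [map_neg, LinearMap.neg_apply, ← pairing_inclPos, ← pairing_inclPos, pairing_dorfman_swap₁₂]

theorem projNeg_dorfman_swap (z y : 𝔤) :
    projNeg g (dorfman H (inclNeg g z) (inclPos g y))
      = -projNeg g (dorfman H (inclPos g y) (inclNeg g z)) := by
  apply form_ext g
  intro w
  have h := pairing_dorfman_swap₁₂ H (inclPos g y) (inclNeg g z) (inclNeg g w)
  rw [pairing_inclNeg, pairing_inclNeg] at h
  rw [map_neg, LinearMap.neg_apply]
  linarith

namespace GenLeviCivita

variable (D : GenLeviCivita g H)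

/-- The right-hand side contains only brackets: among connections of divergence zero the Ricci
curvature does not depend on the choice. -/
theorem ricciPos_eq (hδ : D.divergence = 0) (v : Eneg g) (u : Epos g) :
    D.ricciPos v u = -LinearMap.trace ℝ 𝔤
      (covPos g H (projPos g u) ∘ₗ covNeg g H (projNeg g v)) := by
  rw [ricciPos, trace_restrict_of_retract (Epos g) (inclPos g) (projPos g)
    (fun x => by rw [mem_Epos_iff, projPos_inclPos])
    (fun a ha => (mem_Epos_iff g a).1 ha) _ (D.curvature v u) (fun a => rfl)]
  have h := trace_curvature_of_splitting (inclPos g) (inclNeg g) (projPos g) (projNeg g)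
    (incl_proj_add g) D.D (dorfman H) D.projNeg_D_inclPos D.projPos_D_inclNeg_inclPos
    projPos_dorfman_swap
    (fun x => by simpa [divergence] using LinearMap.congr_fun hδ (inclPos g x))
    (projPos g u) (projNeg g v)
  rw [(mem_Epos_iff g _).1 u.2, (mem_Eneg_iff g _).1 v.2] at h
  rw [curvature, h, covPos, covNeg, (mem_Epos_iff g _).1 u.2, (mem_Eneg_iff g _).1 v.2]

/-- The same computation with the two summands exchanged. By cyclicity it gives the same trace as
for 𝓡𝓒⁺, so that one equation decides both. -/
theorem ricciNeg_eq (hδ : D.divergence = 0) (u : Epos g) (v : Eneg g) :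
    D.ricciNeg u v = -LinearMap.trace ℝ 𝔤
      (covPos g H (projPos g u) ∘ₗ covNeg g H (projNeg g v)) := by
  rw [ricciNeg, trace_restrict_of_retract (Eneg g) (inclNeg g) (projNeg g)
    (fun x => by rw [mem_Eneg_iff, projNeg_inclNeg])
    (fun a ha => (mem_Eneg_iff g a).1 ha) _ (D.curvature u v) (fun a => rfl)]
  have h := trace_curvature_of_splitting (inclNeg g) (inclPos g) (projNeg g) (projPos g)
    (fun a => by rw [add_comm, incl_proj_add g]) D.D (dorfman H)
    D.projPos_D_inclNeg D.projNeg_D_inclPos_inclNeg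
    projNeg_dorfman_swap
    (fun x => by simpa [divergence] using LinearMap.congr_fun hδ (inclNeg g x))
    (projNeg g v) (projPos g u)
  rw [(mem_Epos_iff g _).1 u.2, (mem_Eneg_iff g _).1 v.2] at h
  rw [curvature, h, covPos, covNeg, (mem_Epos_iff g _).1 u.2, (mem_Eneg_iff g _).1 v.2,
    LinearMap.trace_comp_comm']

end GenLeviCivita

variable (g H)

/-- The generalised Levi-Civita connection whose pure components are one third of the bracket. -/
def canonicalD : GenSpace 𝔤 →ₗ[ℝ] GenSpace 𝔤 →ₗ[ℝ] GenSpace 𝔤 :=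
  let P := inclPos g ∘ₗ projPos g
  let N := inclNeg g ∘ₗ projNeg g
  ((dorfman H).compl₁₂ N P).compr₂ P + (1 / 3 : ℝ) • ((dorfman H).compl₁₂ P P).compr₂ P
    + ((dorfman H).compl₁₂ P N).compr₂ N + (1 / 3 : ℝ) • ((dorfman H).compl₁₂ N N).compr₂ N

theorem canonicalD_apply (a b : GenSpace 𝔤) : canonicalD g H a b =
    inclPos g (projPos g (dorfman H (inclNeg g (projNeg g a)) (inclPos g (projPos g b))))
    + (1 / 3 : ℝ) •
      inclPos g (projPos g (dorfman H (inclPos g (projPos g a)) (inclPos g (projPos g b))))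
    + inclNeg g (projNeg g (dorfman H (inclPos g (projPos g a)) (inclNeg g (projNeg g b))))
    + (1 / 3 : ℝ) •
      inclNeg g (projNeg g (dorfman H (inclNeg g (projNeg g a)) (inclNeg g (projNeg g b)))) :=
  rfl

theorem pairing_inclPos_projPos (a b : GenSpace 𝔤) :
    pairing (inclPos g (projPos g a)) b = pairing a (inclPos g (projPos g b)) := by
  rw [pairing_comm, pairing_inclPos, pairing_inclPos, form_comm]

theorem pairing_inclNeg_projNeg (a b : GenSpace 𝔤) :
    pairing (inclNeg g (projNeg g a)) b = pairing a (inclNeg g (projNeg g b)) := by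
  rw [pairing_comm, pairing_inclNeg, pairing_inclNeg, form_comm]

theorem pairing_canonicalD (a b c : GenSpace 𝔤) : pairing (canonicalD g H a b) c =
    pairing (dorfman H (inclNeg g (projNeg g a)) (inclPos g (projPos g b)))
      (inclPos g (projPos g c))
    + 1 / 3 * pairing (dorfman H (inclPos g (projPos g a)) (inclPos g (projPos g b)))
      (inclPos g (projPos g c))
    + pairing (dorfman H (inclPos g (projPos g a)) (inclNeg g (projNeg g b)))
      (inclNeg g (projNeg g c))
    + 1 / 3 * pairing (dorfman H (inclNeg g (projNeg g a)) (inclNeg g (projNeg g b)))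
      (inclNeg g (projNeg g c)) := by
  rw [canonicalD_apply]
  simp only [pairing_add_left, pairing_smul_left]
  simp only [pairing_inclPos_projPos, pairing_inclNeg_projNeg]

/-- The generalised Levi-Civita connection whose pure components are one third of the bracket. -/
def canonicalGenLeviCivita : GenLeviCivita g H where
  D := canonicalD g H
  pairing_compat a b c := by
    rw [pairing_comm b, pairing_canonicalD, pairing_canonicalD]
    set ap := inclPos g (projPos g a)
    set an := inclNeg g (projNeg g a)
    set bp := inclPos g (projPos g b)
    set bn := inclNeg g (projNeg g b)
    set cp := inclPos g (projPos g c)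
    set cn := inclNeg g (projNeg g c)
    rw [pairing_dorfman_swap₂₃ H an bp cp, pairing_dorfman_swap₂₃ H ap bp cp,
      pairing_dorfman_swap₂₃ H ap bn cn, pairing_dorfman_swap₂₃ H an bn cn]
    ring
  -- On arguments of pure type the three connection terms contribute one third of the bracket each,
  -- which cancels the bracket term; this is where the factor 1/3 comes from. On mixed arguments a
  -- single connection term cancels it.
  torsion_free a b c := by
    rw [pairing_sub_left, pairing_sub_left, pairing_comm b,
      pairing_canonicalD, pairing_canonicalD, pairing_canonicalD]
    have ha := incl_proj_add g a
    have hb := incl_proj_add g b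
    have hc := incl_proj_add g c
    set ap := inclPos g (projPos g a)
    set an := inclNeg g (projNeg g a)
    set bp := inclPos g (projPos g b)
    set bn := inclNeg g (projNeg g b)
    set cp := inclPos g (projPos g c)
    set cn := inclNeg g (projNeg g c)
    have cyc : ∀ x y z, pairing (dorfman H z x) y = pairing (dorfman H x y) z := fun x y z => by
      rw [pairing_dorfman_swap₁₂, pairing_dorfman_swap₂₃, neg_neg]
    rw [← ha, ← hb, ← hc]
    simp only [map_add, LinearMap.add_apply, pairing_add_left, pairing_add_right]
    have e3 := cyc ap bp cp
    have e4 := cyc ap bp cn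
    have e5 := cyc an bn cn
    have e6 := cyc an bn cp
    have e7 := pairing_dorfman_swap₁₂ H an bp cn
    have e8 := pairing_dorfman_swap₁₂ H ap bp cp
    have e9 := pairing_dorfman_swap₁₂ H ap bn cp
    have e10 := pairing_dorfman_swap₁₂ H an bn cn
    have e1 := pairing_dorfman_swap₁₂ H ap bn cp
    have e2 := pairing_dorfman_swap₁₂ H an bp cn
    linarith
  metric a b := by
    have h : genMetric g b = inclPos g (projPos g b) - inclNeg g (projNeg g b) := by
      conv_lhs => rw [← incl_proj_add g b]
      rw [map_add, genMetric_inclPos, genMetric_inclNeg, sub_eq_add_neg]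
    rw [h, canonicalD_apply, canonicalD_apply]
    simp only [map_sub, map_add, map_smul, genMetric_inclPos, genMetric_inclNeg,
      projPos_inclPos, projPos_inclNeg, projNeg_inclPos, projNeg_inclNeg, map_zero]
    module

/-- By total skewness of the paired bracket, z ↦ [z₊, b]₊ is skew for g. -/
theorem trace_projPos_dorfman (b : GenSpace 𝔤) :
    LinearMap.trace ℝ 𝔤 (projPos g ∘ₗ (dorfman H).flip b ∘ₗ inclPos g) = 0 := by
  apply trace_eq_zero_of_skew g
  intro x y
  simp only [LinearMap.comp_apply, LinearMap.flip_apply]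
  rw [form_comm g x, ← pairing_inclPos, ← pairing_inclPos,
    pairing_dorfman_swap₁₂, pairing_dorfman_swap₂₃, pairing_dorfman_swap₁₂, neg_neg]

theorem trace_projNeg_dorfman (b : GenSpace 𝔤) :
    LinearMap.trace ℝ 𝔤 (projNeg g ∘ₗ (dorfman H).flip b ∘ₗ inclNeg g) = 0 := by
  apply trace_eq_zero_of_skew g
  intro x y
  simp only [LinearMap.comp_apply, LinearMap.flip_apply]
  have h : pairing (dorfman H (inclNeg g x) b) (inclNeg g y)
      = -pairing (dorfman H (inclNeg g y) b) (inclNeg g x) := by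
    rw [pairing_dorfman_swap₁₂, pairing_dorfman_swap₂₃, pairing_dorfman_swap₁₂, neg_neg]
  rw [pairing_inclNeg, pairing_inclNeg] at h
  rw [form_comm g x]
  linarith

/-- The mixed components map one eigenspace to the other and have no diagonal block; the pure ones
are skew. -/
theorem divergence_canonicalGenLeviCivita : (canonicalGenLeviCivita g H).divergence = 0 := by
  refine LinearMap.ext fun b => ?_
  have h : (canonicalD g H).flip b =
      inclPos g ∘ₗ (projPos g ∘ₗ (dorfman H).flip (inclPos g (projPos g b)) ∘ₗ inclNeg g) ∘ₗ
        projNeg g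
      + (1 / 3 : ℝ) • inclPos g ∘ₗ (projPos g ∘ₗ (dorfman H).flip (inclPos g (projPos g b)) ∘ₗ
        inclPos g) ∘ₗ projPos g
      + inclNeg g ∘ₗ (projNeg g ∘ₗ (dorfman H).flip (inclNeg g (projNeg g b)) ∘ₗ inclPos g) ∘ₗ
        projPos g
      + (1 / 3 : ℝ) • inclNeg g ∘ₗ (projNeg g ∘ₗ (dorfman H).flip (inclNeg g (projNeg g b)) ∘ₗ
        inclNeg g) ∘ₗ projNeg g :=
    LinearMap.ext fun a => canonicalD_apply g H a b
  have hpp : projPos g ∘ₗ inclPos g = LinearMap.id := LinearMap.ext (projPos_inclPos g)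
  have hnn : projNeg g ∘ₗ inclNeg g = LinearMap.id := LinearMap.ext (projNeg_inclNeg g)
  have hpn : projPos g ∘ₗ inclNeg g = 0 := LinearMap.ext (projPos_inclNeg g)
  have hnp : projNeg g ∘ₗ inclPos g = 0 := LinearMap.ext (projNeg_inclPos g)
  change LinearMap.trace ℝ _ ((canonicalD g H).flip b) = 0
  rw [h]
  simp only [map_add, map_smul]
  rw [LinearMap.trace_comp_comm' _ (inclPos g), LinearMap.trace_comp_comm' _ (inclPos g),
    LinearMap.trace_comp_comm' _ (inclNeg g), LinearMap.trace_comp_comm' _ (inclNeg g)]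
  simp only [LinearMap.comp_assoc]
  rw [hpp, hnn, hpn, hnp]
  simp only [LinearMap.comp_zero, LinearMap.comp_id, trace_projPos_dorfman, trace_projNeg_dorfman]
  simp

variable {g H}

/-- The existential quantifier over connections is discharged by the canonical connection, since the
Ricci curvature is the same for all candidates. -/
theorem isGeneralisedEinstein_iff : IsGeneralisedEinstein g H 0 ↔
    ∀ x y, LinearMap.trace ℝ 𝔤 (covPos g H x ∘ₗ covNeg g H y) = 0 := by
  constructor
  · rintro ⟨D, hδ, h, -⟩ x y
    have h1 := h ⟨inclNeg g y, by rw [mem_Eneg_iff, projNeg_inclNeg]⟩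
      ⟨inclPos g x, by rw [mem_Epos_iff, projPos_inclPos]⟩
    rw [D.ricciPos_eq hδ] at h1
    simpa using h1
  · intro h
    refine ⟨canonicalGenLeviCivita g H, divergence_canonicalGenLeviCivita g H,
      fun v u => ?_, fun u v => ?_⟩
    · rw [GenLeviCivita.ricciPos_eq _ (divergence_canonicalGenLeviCivita g H), h, neg_zero]
    · rw [GenLeviCivita.ricciNeg_eq _ (divergence_canonicalGenLeviCivita g H), h, neg_zero]

end Einstein

/-! ### Dual frames and contractions. -/

section Frames

variable {V : Type*} [AddCommGroup V] [Module ℝ V] {κ : Type*} [Fintype κ]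

/-- The families `b` and `b'` in the subspace `N` are dual to each other with respect to `g`. -/
structure IsDualFrame (g : PseudoMetric V) (N : Submodule ℝ V) (b b' : κ → V) : Prop where
  mem : ∀ a, b a ∈ N
  mem' : ∀ a, b' a ∈ N
  expand : ∀ v ∈ N, v = ∑ a, g.form v (b' a) • b a

/-- The contraction of two one-forms in a pair of dual frames. -/
def contr₁ (b b' : κ → V) (u v : Dual ℝ V) : ℝ := ∑ a, u (b a) * v (b' a)

/-- The contraction of two bilinear forms in a pair of dual frames. -/
def contr₂ (b b' : κ → V) (u v : LinearMap.BilinForm ℝ V) : ℝ :=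
  ∑ a, ∑ c, u (b a) (b c) * v (b' a) (b' c)

variable {g : PseudoMetric V} {N : Submodule ℝ V} {b b' : κ → V}

/-- Expanding b' in terms of b turns both sides into the same double sum, because the coefficients
g(b'ₐ, b'_c) are symmetric. -/
theorem IsDualFrame.swap (h : IsDualFrame g N b b') (u v : Dual ℝ V) :
    ∑ a, u (b' a) * v (b a) = ∑ a, u (b a) * v (b' a) := by
  have e : ∀ (u : Dual ℝ V) a, u (b' a) = ∑ c, g.form (b' a) (b' c) * u (b c) := fun u a => by
    conv_lhs => rw [h.expand _ (h.mem' a)]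
    simp [map_sum]
  have e1 : ∑ a, u (b' a) * v (b a) = ∑ a, ∑ c, g.form (b' a) (b' c) * u (b c) * v (b a) :=
    Finset.sum_congr rfl fun a _ => by rw [e u a, Finset.sum_mul]
  have e2 : ∑ a, u (b a) * v (b' a) = ∑ a, ∑ c, u (b a) * (g.form (b' a) (b' c) * v (b c)) :=
    Finset.sum_congr rfl fun a _ => by rw [e v a, Finset.mul_sum]
  rw [e1, e2, Finset.sum_comm]
  refine Finset.sum_congr rfl fun a _ => Finset.sum_congr rfl fun c _ => ?_
  rw [form_comm g]
  ring

theorem contr₂_eq_zero (u v : LinearMap.BilinForm ℝ V) (hu : ∀ x y, u y x = u x y)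
    (hv : ∀ x y, v y x = -v x y) : contr₂ b b' u v = 0 := by
  have : contr₂ b b' u v = -contr₂ b b' u v := by
    conv_lhs => rw [contr₂, Finset.sum_comm]
    simp only [contr₂, ← Finset.sum_neg_distrib]
    refine Finset.sum_congr rfl fun a _ => Finset.sum_congr rfl fun c _ => ?_
    rw [hu, hv]; ring
  linarith

theorem contr₂_eq_zero' (u v : LinearMap.BilinForm ℝ V) (hu : ∀ x y, u y x = -u x y)
    (hv : ∀ x y, v y x = v x y) : contr₂ b b' u v = 0 := by
  have : contr₂ b b' u v = -contr₂ b b' u v := by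
    conv_lhs => rw [contr₂, Finset.sum_comm]
    simp only [contr₂, ← Finset.sum_neg_distrib]
    refine Finset.sum_congr rfl fun a _ => Finset.sum_congr rfl fun c _ => ?_
    rw [hu, hv]; ring
  linarith

theorem IsDualFrame.sum_mixed (h : IsDualFrame g N b b') (u v : LinearMap.BilinForm ℝ V) :
    ∑ a, ∑ c, u (b a) (b' c) * v (b' a) (b c) = contr₂ b b' u v :=
  Finset.sum_congr rfl fun _ _ => h.swap _ _

/-- T is the sum of the rank-one maps g(b'ₐ,·) ⊗ T bₐ. -/
theorem IsDualFrame.trace_eq [FiniteDimensional ℝ V] {B B' : κ → V} (h : IsDualFrame g ⊤ B B')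
    (T : End ℝ V) : LinearMap.trace ℝ V T = ∑ a, g.form (T (B a)) (B' a) := by
  have h1 : T = ∑ a, (g.flat (B' a)).smulRight (T (B a)) := by
    ext v
    conv_lhs => rw [h.expand v trivial]
    simp only [map_sum, map_smul, LinearMap.sum_apply, LinearMap.smulRight_apply]
    exact Finset.sum_congr rfl fun a _ => by rw [form_comm g]; rfl
  conv_lhs => rw [h1]
  simp only [map_sum, LinearMap.trace_smulRight]
  exact Finset.sum_congr rfl fun a _ => by rw [form_comm g]; rfl

theorem IsDualFrame.trace_comp [FiniteDimensional ℝ V] {B B' : κ → V} (h : IsDualFrame g ⊤ B B')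
    (S T : End ℝ V) : LinearMap.trace ℝ V (S ∘ₗ T)
      = ∑ a, ∑ c, g.form (T (B a)) (B' c) * g.form (S (B c)) (B' a) := by
  rw [h.trace_eq]
  refine Finset.sum_congr rfl fun a _ => ?_
  rw [LinearMap.comp_apply]
  conv_lhs => rw [h.expand (T (B a)) trivial]
  simp [map_sum]

end Frames

/-! ### Abelian ideals of codimension one: the connection forms. -/

section AlmostAbelian

variable {𝔤 : Type*} [LieRing 𝔤] [LieAlgebra ℝ 𝔤]

/-- `N` is an abelian ideal and `X` a vector of square `ε = ±1` spanning its orthogonal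
complement. -/
structure IsAlmostAbelian (g : PseudoMetric 𝔤) (N : Submodule ℝ 𝔤) (X : 𝔤) (ε : ℝ) : Prop where
  norm : g.form X X = ε
  sq : ε * ε = 1
  orth : ∀ y ∈ N, g.form X y = 0
  abel : ∀ y ∈ N, ∀ z ∈ N, ⁅y, z⁆ = 0
  ideal : ∀ y ∈ N, ⁅X, y⁆ ∈ N
  split : ∀ v, v - (ε * g.form v X) • X ∈ N

/-- The bilinear form `g ([X, y], z)`. -/
def adForm (g : PseudoMetric 𝔤) (X : 𝔤) : LinearMap.BilinForm ℝ 𝔤 :=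
  g.form ∘ₗ (LieAlgebra.ad ℝ 𝔤 X : 𝔤 →ₗ[ℝ] 𝔤)

theorem adForm_apply (g : PseudoMetric 𝔤) (X y z : 𝔤) : adForm g X y z = g.form ⁅X, y⁆ z := rfl

/-- Twice the symmetric part of `g ([X, y], z)`. -/
def symForm (g : PseudoMetric 𝔤) (X : 𝔤) : LinearMap.BilinForm ℝ 𝔤 :=
  adForm g X + (adForm g X).flip

/-- Twice the skew part of `g ([X, y], z)`. -/
def skewForm (g : PseudoMetric 𝔤) (X : 𝔤) : LinearMap.BilinForm ℝ 𝔤 :=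
  adForm g X - (adForm g X).flip

variable {g : PseudoMetric 𝔤} {N : Submodule ℝ 𝔤} {X : 𝔤} {ε : ℝ} {H : 𝔤 [⋀^Fin 3]→ₗ[ℝ] ℝ}

theorem symForm_apply (y z : 𝔤) : symForm g X y z = g.form ⁅X, y⁆ z + g.form ⁅X, z⁆ y := rfl

theorem skewForm_apply (y z : 𝔤) : skewForm g X y z = g.form ⁅X, y⁆ z - g.form ⁅X, z⁆ y := rfl

theorem symForm_comm (y z : 𝔤) : symForm g X z y = symForm g X y z := by
  simp only [symForm_apply]; ring

theorem skewForm_comm (y z : 𝔤) : skewForm g X z y = -skewForm g X y z := by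
  simp only [skewForm_apply]; ring

theorem contract_swap₁₂ (x y z : 𝔤) : contract H y x z = -contract H x y z := by
  simp only [contract_apply, threeForm_swap₁₂ H x y z]

theorem contract_swap₂₃ (x y z : 𝔤) : contract H x z y = -contract H x y z := by
  simp only [contract_apply, threeForm_swap₂₃ H x y z]

theorem contract_self₁₂ (x z : 𝔤) : contract H x x z = 0 := by
  have := contract_swap₁₂ (H := H) x x z; linarith

theorem contract_self₂₃ (x z : 𝔤) : contract H x z z = 0 := by
  have := contract_swap₂₃ (H := H) x z z; linarith

namespace IsAlmostAbelian

variable (h : IsAlmostAbelian g N X ε)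

include h

theorem form_ad (y : 𝔤) (hy : y ∈ N) : g.form ⁅X, y⁆ X = 0 := by
  rw [form_comm g]; exact h.orth _ (h.ideal y hy)

/-- Here and in the following evaluations, brackets inside N vanish and ad_X maps N into X^⊥, so at
most the forms S, A, H(X,·,·) and H on N remain of the Koszul-type expression. -/
theorem covForm_XX (w : 𝔤) (hw : w ∈ N) : covForm g H X X w = 0 := by
  rw [covForm, ← contract_apply, contract_self₁₂, lie_self, h.form_ad w hw, ← lie_skew w X,
    map_neg, LinearMap.neg_apply, h.form_ad w hw]
  simp

omit h in
theorem covForm_right_eq (x z : 𝔤) : covForm g H x z x = 0 := by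
  have := contract_self₂₃ (H := H) z x
  rw [covForm, ← contract_apply, this, ← lie_skew z x, lie_self]
  simp only [map_neg, LinearMap.neg_apply, map_zero, LinearMap.zero_apply]
  ring

theorem covForm_X (y w : 𝔤) (hy : y ∈ N) (hw : w ∈ N) :
    covForm g H X y w = -(1 / 2) * (contract H X y w + symForm g X y w) := by
  rw [covForm, ← contract_apply, contract_swap₁₂, ← lie_skew y X, h.abel w hw y hy, symForm_apply]
  simp only [map_neg, LinearMap.neg_apply, map_zero, LinearMap.zero_apply]
  ring

omit h in
theorem covForm_of_X (y w : 𝔤) :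
    covForm g H y X w = (1 / 2) * (contract H X y w + skewForm g X y w - g.form ⁅y, w⁆ X) := by
  rw [covForm, ← contract_apply, ← lie_skew w X, skewForm_apply]
  simp only [map_neg, LinearMap.neg_apply]
  ring

theorem covForm_to_X (y z : 𝔤) (hy : y ∈ N) (hz : z ∈ N) :
    covForm g H y z X = (1 / 2) * (-contract H X y z + symForm g X y z) := by
  have : contract H z y X = -contract H X y z := by
    rw [contract_swap₂₃, contract_swap₁₂, contract_swap₂₃, neg_neg]
  rw [covForm, ← contract_apply, this, ← lie_skew y X, h.abel z hz y hy, symForm_apply]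
  simp only [map_neg, LinearMap.neg_apply, map_zero, LinearMap.zero_apply]
  ring

theorem covForm_N (y z w : 𝔤) (hy : y ∈ N) (hz : z ∈ N) (hw : w ∈ N) :
    covForm g H y z w = -(1 / 2) * contract H y z w := by
  rw [covForm, ← contract_apply, contract_swap₁₂, h.abel z hz y hy, h.abel w hw z hz,
    h.abel y hy w hw]
  simp

/-- A frame of the ideal extends to 𝔤 by X, whose dual vector is εX because ε² = 1. -/
theorem isDualFrame_option {κ : Type*} [Fintype κ] {b b' : κ → 𝔤} (hb : IsDualFrame g N b b') :
    IsDualFrame g ⊤ (fun o : Option κ => o.elim X b) (fun o : Option κ => o.elim (ε • X) b') where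
  mem _ := trivial
  mem' _ := trivial
  expand v _ := by
    have h1 := hb.expand _ (h.split v)
    rw [Fintype.sum_option]
    simp only [Option.elim, map_smul, smul_eq_mul]
    rw [sub_eq_iff_eq_add] at h1
    rw [add_comm]
    conv_lhs => rw [h1]
    congr 1
    refine Finset.sum_congr rfl fun a _ => ?_
    rw [map_sub, LinearMap.sub_apply, map_smul, LinearMap.smul_apply, h.orth _ (hb.mem' a)]
    simp

end IsAlmostAbelian

end AlmostAbelian

/-! ### The Ricci form on an almost Abelian Lie algebra. -/

section AlmostAbelian

variable {𝔤 : Type*} [LieRing 𝔤] [LieAlgebra ℝ 𝔤] [FiniteDimensional ℝ 𝔤]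
  {g : PseudoMetric 𝔤} {N : Submodule ℝ 𝔤} {X : 𝔤} {ε : ℝ} {H : 𝔤 [⋀^Fin 3]→ₗ[ℝ] ℝ}
  {κ : Type*} [Fintype κ] {b b' : κ → 𝔤}

variable (g H) in
/-- The generalised Ricci curvature, up to sign, as a bilinear form on `𝔤`. -/
def ricciForm : LinearMap.BilinForm ℝ 𝔤 :=
  LinearMap.mk₂ ℝ (fun x y => LinearMap.trace ℝ 𝔤 (covPos g H x ∘ₗ covNeg g H y))
    (fun x x' y => by simp [covPos, LinearMap.add_comp, LinearMap.comp_add])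
    (fun c x y => by simp [covPos, LinearMap.smul_comp, LinearMap.comp_smul])
    (fun x y y' => by simp [covNeg, LinearMap.add_comp, LinearMap.comp_add])
    (fun c x y => by simp [covNeg, LinearMap.smul_comp, LinearMap.comp_smul])

theorem ricciForm_apply (x y : 𝔤) :
    ricciForm g H x y = LinearMap.trace ℝ 𝔤 (covPos g H x ∘ₗ covNeg g H y) := rfl

omit [FiniteDimensional ℝ 𝔤] in
theorem covForm_smul_right (x z w : 𝔤) (t : ℝ) :
    covForm g H x z (t • w) = t * covForm g H x z w := by
  simp only [covForm, ← contract_apply, map_smul, LinearMap.smul_apply, smul_eq_mul, lie_smul,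
    smul_lie]
  ring

variable (g H X ε b b') in
/-- The symmetric part of the generalised Ricci curvature on an abelian ideal of codimension one,
up to a factor. -/
def symRicci (y z : 𝔤) : ℝ :=
  ε * (2 * contr₁ b b' (contract H X y) (contract H X z)
    + contr₁ b b' (skewForm g X y) (symForm g X z) + contr₁ b b' (symForm g X y) (skewForm g X z))
    + contr₂ b b' (contract H y) (contract H z)

omit [FiniteDimensional ℝ 𝔤] in
theorem contract_neg (x y z : 𝔤) : contract (-H) x y z = -contract H x y z := by
  simp [contract_apply]

theorem ricciForm_option (h : IsAlmostAbelian g N X ε) (hb : IsDualFrame g N b b') (x y : 𝔤) :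
    ricciForm g H x y = ε * (covForm g (-H) y X X * covForm g H x X (ε • X))
      + (∑ c, covForm g (-H) y X (b' c) * (ε * covForm g H x (b c) X)
      + ∑ a, (ε * covForm g (-H) y (b a) X) * covForm g H x X (b' a))
      + ∑ a, ∑ c, covForm g (-H) y (b a) (b' c) * covForm g H x (b c) (b' a) := by
  rw [ricciForm_apply, (h.isDualFrame_option hb).trace_comp]
  simp only [form_covPos, form_covNeg, Fintype.sum_option, Option.elim, covForm_smul_right,
    Finset.sum_add_distrib]
  ring

/-- All terms in which X occurs once more vanish, and contractions of the symmetric S with the skew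
form H(X,·,·) are zero. The 4 clears the factor 1/2 of each connection form. -/
theorem ricciForm_XX (h : IsAlmostAbelian g N X ε) (hb : IsDualFrame g N b b') :
    4 * ricciForm g H X X = contr₂ b b' (symForm g X) (symForm g X)
      + contr₂ b b' (contract H X) (contract H X) := by
  rw [ricciForm_option h hb]
  have e1 : ∀ c, covForm g (-H) X X (b' c) = 0 := fun c => h.covForm_XX _ (hb.mem' c)
  have e2 : ∀ c, covForm g H X X (b' c) = 0 := fun c => h.covForm_XX _ (hb.mem' c)
  have e3 : covForm g (-H) X X X = 0 := IsAlmostAbelian.covForm_right_eq X X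
  simp only [e1, e2, e3, zero_mul, mul_zero, Finset.sum_const_zero, zero_add]
  have e4 : ∀ a c, covForm g (-H) X (b a) (b' c) * covForm g H X (b c) (b' a)
      = 1 / 4 * (symForm g X (b a) (b' c) * symForm g X (b' a) (b c)
        + contract H X (b a) (b' c) * contract H X (b' a) (b c)
        + (contract H X (b a) (b' c) * symForm g X (b' a) (b c)) * (-1)
        + (symForm g X (b a) (b' c) * contract H X (b' a) (b c)) * (-1)) := fun a c => by
    rw [h.covForm_X _ _ (hb.mem a) (hb.mem' c), h.covForm_X _ _ (hb.mem c) (hb.mem' a),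
      contract_neg, symForm_comm (b' a) (b c), contract_swap₂₃ X (b' a) (b c)]
    ring
  simp only [e4, ← Finset.mul_sum, Finset.sum_add_distrib, hb.sum_mixed, ← Finset.sum_mul]
  rw [contr₂_eq_zero' (contract H X) (symForm g X) (contract_swap₂₃ X) symForm_comm,
    contr₂_eq_zero (symForm g X) (contract H X) symForm_comm (contract_swap₂₃ X)]
  ring

omit [FiniteDimensional ℝ 𝔤] in
theorem covForm_of_X_X (h : IsAlmostAbelian g N X ε) (y : 𝔤) (hy : y ∈ N) :
    covForm g H y X X = 0 := by
  have h1 : contract H X y X = 0 := by rw [contract_swap₂₃, contract_self₁₂, neg_zero]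
  rw [IsAlmostAbelian.covForm_of_X, h1, skewForm_apply, h.form_ad y hy, lie_self,
    ← lie_skew, map_neg, LinearMap.neg_apply, h.form_ad y hy]
  simp

/-- The S-term drops out as a contraction of a symmetric with a skew form. The remaining value is
the same as for the arguments in the opposite order, so X and N together give one equation. -/
theorem ricciForm_XN (h : IsAlmostAbelian g N X ε) (hb : IsDualFrame g N b b') (y : 𝔤)
    (hy : y ∈ N) : 4 * ricciForm g H X y = contr₂ b b' (contract H X) (contract H y) := by
  rw [ricciForm_option h hb]
  have e2 : ∀ c, covForm g H X X (b' c) = 0 := fun c => h.covForm_XX _ (hb.mem' c)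
  have e3 : covForm g H X X X = 0 := IsAlmostAbelian.covForm_right_eq X X
  have e1 : ∀ c, covForm g H X (b c) X = 0 := fun c => IsAlmostAbelian.covForm_right_eq X (b c)
  simp only [e1, e2, covForm_smul_right, e3, mul_zero, Finset.sum_const_zero, zero_add]
  have e4 : ∀ a c, covForm g (-H) y (b a) (b' c) * covForm g H X (b c) (b' a)
      = 1 / 4 * (contract H X (b' a) (b c) * contract H y (b a) (b' c)
        + (contract H y (b a) (b' c) * symForm g X (b' a) (b c)) * (-1)) := fun a c => by
    rw [h.covForm_N _ _ _ hy (hb.mem a) (hb.mem' c), h.covForm_X _ _ (hb.mem c) (hb.mem' a),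
      contract_neg, symForm_comm (b' a) (b c), contract_swap₂₃ X (b' a) (b c)]
    ring
  simp only [e4, ← Finset.mul_sum, Finset.sum_add_distrib, hb.sum_mixed, ← Finset.sum_mul]
  rw [contr₂_eq_zero' (contract H y) (symForm g X) (contract_swap₂₃ y) symForm_comm]
  have e5 : ∑ a, ∑ c, contract H X (b' a) (b c) * contract H y (b a) (b' c)
      = contr₂ b b' (contract H X) (contract H y) := by
    rw [← hb.sum_mixed, Finset.sum_comm]
    refine Finset.sum_congr rfl fun a _ => Finset.sum_congr rfl fun c _ => ?_
    rw [contract_swap₂₃ X (b a), contract_swap₂₃ y (b' a)]; ring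
  rw [e5]
  ring

theorem ricciForm_NX (h : IsAlmostAbelian g N X ε) (hb : IsDualFrame g N b b') (y : 𝔤)
    (hy : y ∈ N) : 4 * ricciForm g H y X = contr₂ b b' (contract H X) (contract H y) := by
  rw [ricciForm_option h hb]
  have e2 : ∀ c, covForm g (-H) X X (b' c) = 0 := fun c => h.covForm_XX _ (hb.mem' c)
  have e3 : covForm g (-H) X X X = 0 := IsAlmostAbelian.covForm_right_eq X X
  have e1 : ∀ c, covForm g (-H) X (b c) X = 0 :=
    fun c => IsAlmostAbelian.covForm_right_eq X (b c)
  simp only [e1, e2, covForm_smul_right, e3, zero_mul, mul_zero, Finset.sum_const_zero, zero_add]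
  have e4 : ∀ a c, covForm g (-H) X (b a) (b' c) * covForm g H y (b c) (b' a)
      = 1 / 4 * (contract H X (b a) (b' c) * contract H y (b' a) (b c)
        + (symForm g X (b a) (b' c) * contract H y (b' a) (b c)) * (-1)) := fun a c => by
    rw [h.covForm_N _ _ _ hy (hb.mem c) (hb.mem' a), h.covForm_X _ _ (hb.mem a) (hb.mem' c),
      contract_neg, contract_swap₂₃ y (b' a) (b c)]
    ring
  simp only [e4, ← Finset.mul_sum, Finset.sum_add_distrib, hb.sum_mixed, ← Finset.sum_mul]
  rw [contr₂_eq_zero (symForm g X) (contract H y) symForm_comm (contract_swap₂₃ y)]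
  ring

/-- The first summand is symmetric and the second skew in the two arguments, so that they can be
made to vanish separately. -/
theorem ricciForm_NN (h : IsAlmostAbelian g N X ε) (hb : IsDualFrame g N b b') (x y : 𝔤)
    (hx : x ∈ N) (hy : y ∈ N) : 4 * ricciForm g H x y = symRicci g X ε H b b' y x
      + 2 * ε * (contr₁ b b' ((adForm g X).flip y) (contract H X x)
        - contr₁ b b' (contract H X y) ((adForm g X).flip x)) := by
  rw [ricciForm_option h hb, covForm_of_X_X h y hy]
  have e0 : ∀ x ∈ N, ∀ y ∈ N, g.form ⁅x, y⁆ X = 0 := fun x hx y hy => by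
    rw [h.abel x hx y hy]; simp
  have e1 : ∀ c, covForm g (-H) y X (b' c) * (ε * covForm g H x (b c) X)
      = ε / 4 * ((skewForm g X y - contract H X y) (b' c)
        * (symForm g X x - contract H X x) (b c)) := fun c => by
    rw [IsAlmostAbelian.covForm_of_X, h.covForm_to_X _ _ hx (hb.mem c), contract_neg,
      e0 y hy _ (hb.mem' c)]
    simp only [LinearMap.sub_apply]
    ring
  have e2 : ∀ a, (ε * covForm g (-H) y (b a) X) * covForm g H x X (b' a)
      = ε / 4 * ((symForm g X y + contract H X y) (b a)
        * (skewForm g X x + contract H X x) (b' a)) := fun c => by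
    rw [h.covForm_to_X _ _ hy (hb.mem c), IsAlmostAbelian.covForm_of_X, contract_neg,
      e0 x hx _ (hb.mem' c)]
    simp only [LinearMap.add_apply]
    ring
  have e3 : ∀ a c, covForm g (-H) y (b a) (b' c) * covForm g H x (b c) (b' a)
      = 1 / 4 * (contract H y (b a) (b' c) * contract H x (b' a) (b c)) := fun a c => by
    rw [h.covForm_N _ _ _ hy (hb.mem a) (hb.mem' c), h.covForm_N _ _ _ hx (hb.mem c) (hb.mem' a),
      contract_neg, contract_swap₂₃ x (b' a) (b c)]
    ring
  simp only [e1, e2, e3, ← Finset.mul_sum, hb.sum_mixed]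
  rw [hb.swap (skewForm g X y - contract H X y)]
  -- Eliminating A in favour of S and the transpose of ad_X isolates the skew part: contractions of
  -- S with H(X,·,·) cancel and only those with the transpose remain.
  have e4 : skewForm g X = symForm g X - (2 : ℝ) • (adForm g X).flip := by
    rw [skewForm, symForm]; module
  have e5 : ∀ v : 𝔤, skewForm g X v = symForm g X v - (2 : ℝ) • (adForm g X).flip v := fun v => by
    rw [e4]; rfl
  rw [symRicci]
  simp only [contr₁, e5, LinearMap.sub_apply, LinearMap.add_apply, LinearMap.smul_apply,
    smul_eq_mul, mul_add, add_mul, mul_sub, sub_mul, Finset.sum_add_distrib,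
    Finset.sum_sub_distrib]
  have e6 : ∀ u v : Dual ℝ 𝔤, ∑ a, u (b a) * (2 * v (b' a)) = 2 * ∑ a, u (b a) * v (b' a) :=
    fun u v => by rw [Finset.mul_sum]; exact Finset.sum_congr rfl fun a _ => by ring
  have e7 : ∀ u v : Dual ℝ 𝔤, ∑ a, (2 * u (b a)) * v (b' a) = 2 * ∑ a, u (b a) * v (b' a) :=
    fun u v => by rw [Finset.mul_sum]; exact Finset.sum_congr rfl fun a _ => by ring
  simp only [e6, e7]
  ring

end AlmostAbelian

/-! ### The Einstein equations in a null frame as equations between real arrays. -/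

section Arrays

variable {ι : Type*} [Fintype ι]

theorem sum_sq_eq_zero {x : ι → ℝ} (h : ∑ i, x i ^ 2 = 0) (i : ι) : x i = 0 := by
  have := (Finset.sum_eq_zero_iff_of_nonneg (fun i _ => sq_nonneg (x i))).1 h i (Finset.mem_univ i)
  exact pow_eq_zero_iff two_ne_zero |>.1 this

theorem sum_sum_sq_eq_zero {x : ι → ι → ℝ} (h : ∑ i, ∑ j, x i j ^ 2 = 0) (i j : ι) :
    x i j = 0 := by
  have := (Finset.sum_eq_zero_iff_of_nonneg
    (fun i _ => Finset.sum_nonneg fun j _ => sq_nonneg (x i j))).1 h i (Finset.mem_univ i)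
  exact sum_sq_eq_zero this j

theorem sum_sum_skew {x : ι → ι → ℝ} (h : ∀ i j, x j i = -x i j) : ∑ i, ∑ j, x i j = 0 := by
  have h1 : ∑ i, ∑ j, x i j = -∑ i, ∑ j, x i j := by
    conv_lhs => rw [Finset.sum_comm]
    simp only [← Finset.sum_neg_distrib]
    exact Finset.sum_congr rfl fun i _ => Finset.sum_congr rfl fun j _ => h i j
  linarith

theorem lagrange_identity (q k : ι → ℝ) : ∑ i, ∑ j, (q i * k j - q j * k i) ^ 2
    = 2 * (∑ i, q i ^ 2) * (∑ i, k i ^ 2) - 2 * (∑ i, q i * k i) ^ 2 := by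
  have e : ∀ i j, (q i * k j - q j * k i) ^ 2
      = q i ^ 2 * k j ^ 2 + k i ^ 2 * q j ^ 2 - 2 * ((q i * k i) * (q j * k j)) := fun i j => by
    ring
  simp only [e, Finset.sum_add_distrib, Finset.sum_sub_distrib, ← Finset.mul_sum, ← Finset.sum_mul]
  ring

/-- The part of the Einstein equations which forces the components of positive and zero weight with
respect to the null direction to vanish. -/
theorem nullFrame_vanishing (L μ : ℝ) (s q k : ι → ℝ) (S A w : ι → ι → ℝ) (h : ι → ι → ι → ℝ)
    (hS : ∀ i j, S j i = S i j) (hA : ∀ i j, A j i = -A i j) (hw : ∀ i j, w j i = -w i j)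
    (E₁ : ∑ i, q i * s i - 2 * μ ^ 2 - 2 * ∑ i, k i ^ 2 = 0)
    (E₂ : ∀ i j, -(q i * s j) - s i * q j + (∑ m, A i m * S j m + ∑ m, S i m * A j m)
      + 2 * ∑ m, w i m * w j m - 2 * (k i * k j) + ∑ m, ∑ n, h i m n * h j m n = 0)
    (C₁ : 2 * L ^ 2 + ∑ i, ∑ j, S i j ^ 2 - 2 * μ ^ 2 + ∑ i, ∑ j, w i j ^ 2 = 0)
    (C₃ : ∀ i, μ * q i = -∑ m, w i m * q m)
    (K : ∀ i j, ∑ m, q m * h m i j = q i * k j - q j * k i) :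
    μ = 0 ∧ L = 0 ∧ ∑ i, q i * s i = 0 ∧ (∀ i, k i = 0) ∧ (∀ i j, S i j = 0) ∧
      (∀ i j, w i j = 0) ∧ ∀ i j l, h i j l = 0 := by
  have nn : ∀ x : ι → ℝ, 0 ≤ ∑ i, x i ^ 2 := fun x => Finset.sum_nonneg fun i _ => sq_nonneg _
  have nn2 : ∀ x : ι → ι → ℝ, 0 ≤ ∑ i, ∑ j, x i j ^ 2 := fun x =>
    Finset.sum_nonneg fun i _ => nn _
  -- Otherwise q ≠ 0. Contracting `C₃` with q kills μ, since w is skew, and then `C₁` is a sum of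
  -- squares, so L, S and w vanish.
  have key : ∑ i, q i * s i = 0 := by
    by_contra hqs
    have hq : ∑ i, q i ^ 2 ≠ 0 := fun h0 => hqs (Finset.sum_eq_zero fun i _ => by
      rw [sum_sq_eq_zero h0, zero_mul])
    have hμ : μ = 0 := by
      have h1 : μ * ∑ i, q i ^ 2 = 0 := by
        have h2 : μ * ∑ i, q i ^ 2 = -∑ i, ∑ m, q i * w i m * q m := by
          rw [Finset.mul_sum, ← Finset.sum_neg_distrib]
          refine Finset.sum_congr rfl fun i _ => ?_
          have := C₃ i
          calc μ * q i ^ 2 = q i * (μ * q i) := by ring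
            _ = _ := by
              rw [this, mul_neg, Finset.mul_sum]
              congr 1
              exact Finset.sum_congr rfl fun _ _ => by ring
        rw [h2, sum_sum_skew fun i j => by rw [hw i j]; ring, neg_zero]
      exact (mul_eq_zero.1 h1).resolve_right hq
    rw [hμ] at C₁ E₁
    have hL : L ^ 2 = 0 := by nlinarith [nn2 S, nn2 w, sq_nonneg L]
    have hS0 := sum_sum_sq_eq_zero (x := S) (by nlinarith [nn2 S, nn2 w])
    have hw0 := sum_sum_sq_eq_zero (x := w) (by nlinarith [nn2 S, nn2 w])
    -- The surviving part of `E₂` is contracted with q ⊗ q. The quadratic term in h becomes |q ∧ k|²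
    -- by `K`.
    have h3 : ∑ i, ∑ j, q i * q j * (-(q i * s j) - s i * q j - 2 * (k i * k j)
        + ∑ m, ∑ n, h i m n * h j m n) = 0 := by
      refine Finset.sum_eq_zero fun i _ => Finset.sum_eq_zero fun j _ => ?_
      have := E₂ i j
      simp only [hS0, hw0, mul_zero, zero_mul, Finset.sum_const_zero] at this
      rw [show -(q i * s j) - s i * q j - 2 * (k i * k j) + ∑ m, ∑ n, h i m n * h j m n = 0 by
        linarith, mul_zero]
    have h4 : ∑ i, ∑ j, q i * q j * ∑ m, ∑ n, h i m n * h j m n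
        = ∑ m, ∑ n, (q m * k n - q n * k m) ^ 2 := by
      simp only [← K, sq, Finset.sum_mul_sum]
      simp only [Finset.mul_sum]
      calc _ = ∑ i, ∑ m, ∑ j, ∑ n, q i * q j * (h i m n * h j m n) :=
            Finset.sum_congr rfl fun _ _ => Finset.sum_comm
        _ = ∑ m, ∑ i, ∑ j, ∑ n, q i * q j * (h i m n * h j m n) := Finset.sum_comm
        _ = ∑ m, ∑ i, ∑ n, ∑ j, q i * q j * (h i m n * h j m n) :=
            Finset.sum_congr rfl fun _ _ => Finset.sum_congr rfl fun _ _ => Finset.sum_comm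
        _ = ∑ m, ∑ n, ∑ i, ∑ j, q i * q j * (h i m n * h j m n) :=
            Finset.sum_congr rfl fun _ _ => Finset.sum_comm
        _ = _ := by
            refine Finset.sum_congr rfl fun _ _ => Finset.sum_congr rfl fun _ _ =>
              Finset.sum_congr rfl fun _ _ => Finset.sum_congr rfl fun _ _ => by ring
    have h5 : ∀ i j, q i * q j * (-(q i * s j) - s i * q j - 2 * (k i * k j)
        + ∑ m, ∑ n, h i m n * h j m n) = -(q i ^ 2 * (q j * s j)) - (q i * s i) * q j ^ 2
        - 2 * ((q i * k i) * (q j * k j)) + q i * q j * ∑ m, ∑ n, h i m n * h j m n :=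
      fun i j => by ring
    simp only [h5, Finset.sum_add_distrib, Finset.sum_sub_distrib, Finset.sum_neg_distrib, h4,
      ← Finset.mul_sum, ← Finset.sum_mul, lagrange_identity] at h3
    have hk : ∑ i, k i ^ 2 ≠ 0 := fun h0 => hqs (by rw [h0] at E₁; linarith)
    have hqp := lt_of_le_of_ne (nn q) (Ne.symm hq)
    have hkp := lt_of_le_of_ne (nn k) (Ne.symm hk)
    -- With this value the contracted equation reads -2|q|²|k|² - 4(q·k)² = 0, which is impossible
    -- because q and k are non-zero.
    have h6 : ∑ i, q i * s i = 2 * ∑ i, k i ^ 2 := by linarith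
    rw [h6] at h3
    nlinarith [mul_pos hqp hkp, sq_nonneg (∑ i, q i * k i)]
  rw [key] at E₁
  -- With q·s = 0, `E₁` is minus a sum of squares and gives μ = 0 and k = 0.
  have hμ : μ = 0 := by
    have : μ ^ 2 = 0 := by nlinarith [nn k, sq_nonneg μ]
    exact pow_eq_zero_iff two_ne_zero |>.1 this
  have hk := sum_sq_eq_zero (x := k) (by nlinarith [nn k, sq_nonneg μ])
  -- In the trace of `E₂` the products of S and A cancel by symmetry, which leaves 2|w|² + |h|² = 0.
  -- Afterwards `C₁` bounds L and S.
  have tr : ∑ i, (-(q i * s i) - s i * q i + (∑ m, A i m * S i m + ∑ m, S i m * A i m)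
      + 2 * ∑ m, w i m * w i m - 2 * (k i * k i) + ∑ m, ∑ n, h i m n * h i m n) = 0 :=
    Finset.sum_eq_zero fun i _ => E₂ i i
  have e1 : ∀ i, s i * q i = q i * s i := fun i => mul_comm _ _
  have e2 : ∑ i, ∑ m, A i m * S i m = 0 := sum_sum_skew fun i j => by rw [hA i j, hS i j]; ring
  have e3 : ∑ i, ∑ m, S i m * A i m = 0 := sum_sum_skew fun i j => by rw [hA i j, hS i j]; ring
  simp only [Finset.sum_add_distrib, Finset.sum_sub_distrib, Finset.sum_neg_distrib, e1, key, e2,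
    e3, hk, ← Finset.mul_sum, ← sq, zero_pow two_ne_zero, mul_zero, Finset.sum_const_zero] at tr
  have nn3 : ∀ i, 0 ≤ ∑ m, ∑ n, h i m n ^ 2 := fun i => nn2 _
  have nn4 : 0 ≤ ∑ i, ∑ m, ∑ n, h i m n ^ 2 := Finset.sum_nonneg fun i _ => nn3 i
  have hw0 := sum_sum_sq_eq_zero (x := w) (by nlinarith [nn2 w])
  have hh : ∑ i, ∑ m, ∑ n, h i m n ^ 2 = 0 := by nlinarith [nn2 w]
  have hh0 : ∀ i j l, h i j l = 0 := fun i =>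
    sum_sum_sq_eq_zero ((Finset.sum_eq_zero_iff_of_nonneg (fun i _ => nn3 i)).1 hh i
      (Finset.mem_univ i))
  rw [hμ] at C₁
  have hL : L ^ 2 = 0 := by nlinarith [nn2 S, nn2 w, sq_nonneg L]
  exact ⟨hμ, pow_eq_zero_iff two_ne_zero |>.1 hL, key, hk,
    sum_sum_sq_eq_zero (by nlinarith [nn2 S, nn2 w]), hw0, hh0⟩

/-- The remaining Einstein equations, once the components of non-negative weight vanish. -/
theorem nullFrame_rigidity (α σ : ℝ) (s q u p : ι → ℝ) (A a : ι → ι → ℝ)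
    (hA : ∀ i j, A j i = -A i j) (hqs : ∑ i, q i * s i = 0)
    (E₂ : ∀ i j, q i * s j + s i * q j = 0)
    (E₄ : 2 * (∑ i, u i * s i - α * σ) + 2 * ∑ i, p i ^ 2 + ∑ i, ∑ j, a i j ^ 2 = 0)
    (C₃ : ∀ i, α * p i = ∑ m, p m * A i m)
    (K : ∀ i j, α * a i j = ∑ m, A i m * a m j + ∑ m, A j m * a i m)
    (hpa : ¬ ((∀ i, p i = 0) ∧ ∀ i j, a i j = 0)) :
    (∃ i, s i ≠ 0) ∧ α = 0 ∧ ∀ i, q i = 0 := by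
  have nn : ∀ x : ι → ℝ, 0 ≤ ∑ i, x i ^ 2 := fun x => Finset.sum_nonneg fun i _ => sq_nonneg _
  -- Contracting `C₃` with p and `K` with a makes the right-hand sides vanish, because A is skew. A
  -- non-zero α would therefore force p = 0 and a = 0.
  have hα : α = 0 := by
    by_contra hα
    apply hpa
    constructor
    · apply sum_sq_eq_zero
      have : α * ∑ i, p i ^ 2 = 0 := by
        have h2 : α * ∑ i, p i ^ 2 = ∑ i, ∑ m, p i * (p m * A i m) := by
          rw [Finset.mul_sum]
          refine Finset.sum_congr rfl fun i _ => ?_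
          rw [← Finset.mul_sum, ← C₃]; ring
        rw [h2, sum_sum_skew fun i j => by rw [hA i j]; ring]
      exact (mul_eq_zero.1 this).resolve_left hα
    · apply sum_sum_sq_eq_zero
      have : α * ∑ i, ∑ j, a i j ^ 2 = 0 := by
        have h2 : α * ∑ i, ∑ j, a i j ^ 2 = ∑ i, ∑ j, ∑ m, a i j * (A i m * a m j)
            + ∑ i, ∑ j, ∑ m, a i j * (A j m * a i m) := by
          simp only [Finset.mul_sum, ← Finset.sum_add_distrib]
          refine Finset.sum_congr rfl fun i _ => Finset.sum_congr rfl fun j _ => ?_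
          have := K i j
          rw [← Finset.sum_add_distrib] at this
          simp only [← mul_add, ← Finset.mul_sum]
          rw [← this]; ring
        have h3 : ∑ i, ∑ j, ∑ m, a i j * (A i m * a m j) = 0 := by
          calc _ = ∑ i, ∑ m, ∑ j, a i j * (A i m * a m j) :=
                Finset.sum_congr rfl fun _ _ => Finset.sum_comm
            _ = 0 := sum_sum_skew fun i m => by
                rw [← Finset.sum_neg_distrib]
                refine Finset.sum_congr rfl fun j _ => ?_
                rw [hA i m]; ring
        have h4 : ∀ i, ∑ j, ∑ m, a i j * (A j m * a i m) = 0 := fun i =>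
          sum_sum_skew fun j m => by rw [hA j m]; ring
        rw [h2, h3, Finset.sum_eq_zero fun i _ => h4 i, add_zero]
      exact (mul_eq_zero.1 this).resolve_left hα
  -- For α = 0 and s = 0 the equation `E₄` is a sum of squares in p and a.
  have hs : ∃ i, s i ≠ 0 := by
    by_contra! hs
    apply hpa
    have e : ∑ i, u i * s i = 0 := Finset.sum_eq_zero fun i _ => by rw [hs, mul_zero]
    have nn2 : 0 ≤ ∑ i, ∑ j, a i j ^ 2 := Finset.sum_nonneg fun i _ => nn _
    rw [e, hα] at E₄
    exact ⟨sum_sq_eq_zero (by nlinarith [nn p]), sum_sum_sq_eq_zero (by nlinarith [nn p])⟩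
  refine ⟨hs, hα, fun i => ?_⟩
  -- Contraction of `E₂` with s, where the term containing q·s is zero.
  have h1 : q i * ∑ j, s j ^ 2 = 0 := by
    have h2 : ∑ j, (q i * s j + s i * q j) * s j = 0 :=
      Finset.sum_eq_zero fun j _ => by rw [E₂, zero_mul]
    have h3 : ∑ j, (q i * s j + s i * q j) * s j
        = q i * ∑ j, s j ^ 2 + s i * ∑ j, q j * s j := by
      simp only [Finset.mul_sum, ← Finset.sum_add_distrib]
      exact Finset.sum_congr rfl fun j _ => by ring
    rw [h3, hqs, mul_zero, add_zero] at h2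
    exact h2
  obtain ⟨j, hj⟩ := hs
  exact (mul_eq_zero.1 h1).resolve_right fun h0 => hj (sum_sq_eq_zero h0 j)

end Arrays

/-! ### Null frames and contractions in them. -/

section Contractions

variable {V : Type*} [AddCommGroup V] [Module ℝ V] {κ : Type*} [Fintype κ]
  {g : PseudoMetric V} {N : Submodule ℝ V} {b b' : κ → V}

theorem IsDualFrame.contr₁_comm (h : IsDualFrame g N b b') (u v : Dual ℝ V) :
    contr₁ b b' u v = contr₁ b b' v u := by
  rw [contr₁, ← h.swap u v, contr₁]
  exact Finset.sum_congr rfl fun a _ => mul_comm _ _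

theorem IsDualFrame.contr₂_comm (h : IsDualFrame g N b b') (u v : LinearMap.BilinForm ℝ V) :
    contr₂ b b' u v = contr₂ b b' v u := by
  rw [← h.sum_mixed u v, Finset.sum_comm]
  have e : contr₂ b b' v u = contr₂ b b' v.flip u.flip := by
    rw [contr₂, Finset.sum_comm]; rfl
  rw [e, ← h.sum_mixed]
  exact Finset.sum_congr rfl fun a _ => Finset.sum_congr rfl fun c _ =>
    mul_comm _ _

/-- `(l, l', e)` is a basis of `N` made of a hyperbolic pair and an orthonormal basis of its
orthogonal complement. -/
structure IsNullFrame (g : PseudoMetric V) (N : Submodule ℝ V) {ι : Type*} [Fintype ι]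
    [DecidableEq ι] (l l' : V) (e : ι → V) : Prop where
  mem : l ∈ N
  mem' : l' ∈ N
  mem_e : ∀ i, e i ∈ N
  null : g.form l l = 0
  null' : g.form l' l' = 0
  pair : g.form l l' = 1
  orth : ∀ i, g.form l (e i) = 0
  orth' : ∀ i, g.form l' (e i) = 0
  orthonormal : ∀ i j, g.form (e i) (e j) = if i = j then 1 else 0
  expand : ∀ v ∈ N, v = g.form v l' • l + g.form v l • l' + ∑ i, g.form v (e i) • e i

variable {ι : Type*} [Fintype ι] [DecidableEq ι] {l l' : V} {e : ι → V}

/-- A null frame as a family. -/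
def nullFamily (l l' : V) (e : ι → V) : Fin 2 ⊕ ι → V := Sum.elim ![l, l'] e

namespace IsNullFrame

/-- Duality exchanges the two vectors of the hyperbolic pair and fixes the orthonormal part. -/
theorem isDualFrame (h : IsNullFrame g N l l' e) :
    IsDualFrame g N (nullFamily l l' e) (nullFamily l' l e) where
  mem := by
    rintro (a | i)
    · fin_cases a
      exacts [h.mem, h.mem']
    · exact h.mem_e i
  mem' := by
    rintro (a | i)
    · fin_cases a
      exacts [h.mem', h.mem]
    · exact h.mem_e i
  expand v hv := by
    conv_lhs => rw [h.expand v hv]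
    simp [Fintype.sum_sum_type, nullFamily]

end IsNullFrame

omit [DecidableEq ι] in
theorem contr₁_null (u v : Dual ℝ V) : contr₁ (nullFamily l l' e) (nullFamily l' l e) u v
    = u l * v l' + u l' * v l + ∑ i, u (e i) * v (e i) := by
  simp [contr₁, Fintype.sum_sum_type, nullFamily]

omit [DecidableEq ι] in
theorem contr₂_null (u v : LinearMap.BilinForm ℝ V) :
    contr₂ (nullFamily l l' e) (nullFamily l' l e) u v
    = u l l * v l' l' + u l l' * v l' l + u l' l * v l l' + u l' l' * v l l
      + ∑ i, (u l (e i) * v l' (e i) + u l' (e i) * v l (e i)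
        + u (e i) l * v (e i) l' + u (e i) l' * v (e i) l)
      + ∑ i, ∑ j, u (e i) (e j) * v (e i) (e j) := by
  simp only [contr₂, Fintype.sum_sum_type, nullFamily, Fin.sum_univ_two, Sum.elim_inl,
    Sum.elim_inr, Finset.sum_add_distrib, Matrix.cons_val_zero, Matrix.cons_val_one]
  ring

omit [DecidableEq ι] in
theorem contr₂_null_skew (u v : LinearMap.BilinForm ℝ V) (hu : ∀ x y, u y x = -u x y)
    (hv : ∀ x y, v y x = -v x y) :
    contr₂ (nullFamily l l' e) (nullFamily l' l e) u v
    = -2 * (u l l' * v l l') + 2 * ∑ i, u l (e i) * v l' (e i) + 2 * ∑ i, u l' (e i) * v l (e i)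
      + ∑ i, ∑ j, u (e i) (e j) * v (e i) (e j) := by
  have u0 : ∀ x, u x x = 0 := fun x => by have := hu x x; linarith
  have e1 : ∀ i, u l (e i) * v l' (e i) + u l' (e i) * v l (e i)
        + u (e i) l * v (e i) l' + u (e i) l' * v (e i) l
        = 2 * (u l (e i) * v l' (e i)) + 2 * (u l' (e i) * v l (e i)) := fun i => by
    rw [hu l, hu l', hv l, hv l']; ring
  rw [contr₂_null]
  simp only [e1, Finset.sum_add_distrib, ← Finset.mul_sum, u0]
  rw [hu l l', hv l l']
  ring

end Contractions

/-! ### The Einstein equations of an almost Abelian Lie algebra. -/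

section AlmostAbelian

variable {𝔤 : Type*} [LieRing 𝔤] [LieAlgebra ℝ 𝔤]
  {g : PseudoMetric 𝔤} {N : Submodule ℝ 𝔤} {X : 𝔤} {ε : ℝ} {H : 𝔤 [⋀^Fin 3]→ₗ[ℝ] ℝ}
  {κ : Type*} [Fintype κ] {b b' : κ → 𝔤}

theorem symRicci_comm (hb : IsDualFrame g N b b') (y z : 𝔤) :
    symRicci g X ε H b b' z y = symRicci g X ε H b b' y z := by
  rw [symRicci, symRicci, hb.contr₁_comm (contract H X z), hb.contr₂_comm (contract H z),
    hb.contr₁_comm (skewForm g X z), hb.contr₁_comm (symForm g X z)]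
  ring

/-- The Einstein equations in the case of an abelian ideal of codimension one. -/
structure EinsteinEqs (g : PseudoMetric 𝔤) (N : Submodule ℝ 𝔤) (X : 𝔤) (ε : ℝ)
    (H : 𝔤 [⋀^Fin 3]→ₗ[ℝ] ℝ) (b b' : κ → 𝔤) : Prop where
  scalar : contr₂ b b' (symForm g X) (symForm g X) + contr₂ b b' (contract H X) (contract H X) = 0
  symm : ∀ y ∈ N, ∀ z ∈ N, symRicci g X ε H b b' y z = 0
  skew : ∀ y ∈ N, ∀ z ∈ N, contr₁ b b' ((adForm g X).flip y) (contract H X z)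
    = contr₁ b b' (contract H X y) ((adForm g X).flip z)

variable [FiniteDimensional ℝ 𝔤]

/-- The Ricci form at (y,z) and at (z,y) differ by the sign of the skew part; sum and difference
separate the two equations. -/
theorem IsAlmostAbelian.einsteinEqs (h : IsAlmostAbelian g N X ε) (hb : IsDualFrame g N b b')
    (hE : IsGeneralisedEinstein g H 0) : EinsteinEqs g N X ε H b b' := by
  rw [isGeneralisedEinstein_iff] at hE
  have hE' : ∀ x y, ricciForm g H x y = 0 := hE
  have hε : ε ≠ 0 := fun h0 => by have := h.sq; rw [h0] at this; norm_num at this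
  have key : ∀ y ∈ N, ∀ z ∈ N, symRicci g X ε H b b' y z = 0 ∧
      contr₁ b b' ((adForm g X).flip y) (contract H X z)
        = contr₁ b b' (contract H X y) ((adForm g X).flip z) := by
    intro y hy z hz
    have e1 := ricciForm_NN (H := H) h hb z y hz hy
    have e2 := ricciForm_NN (H := H) h hb y z hy hz
    rw [hE', symRicci_comm hb, hb.contr₁_comm ((adForm g X).flip z),
      hb.contr₁_comm (contract H X z)] at e2
    rw [hE'] at e1
    refine ⟨by linarith, ?_⟩
    have e3 : ε * (contr₁ b b' ((adForm g X).flip y) (contract H X z)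
        - contr₁ b b' (contract H X y) ((adForm g X).flip z)) = 0 := by linarith
    exact sub_eq_zero.1 ((mul_eq_zero.1 e3).resolve_left hε)
  refine ⟨?_, fun y hy z hz => (key y hy z hz).1, fun y hy z hz => (key y hy z hz).2⟩
  rw [← ricciForm_XX h hb, hE', mul_zero]

/-- By bilinearity the equations need to be checked on frame vectors only; the mixed equation for X
and N enters as a separate assumption. -/
theorem IsAlmostAbelian.isGeneralisedEinstein (h : IsAlmostAbelian g N X ε)
    (hb : IsDualFrame g N b b')
    (h1 : contr₂ b b' (symForm g X) (symForm g X)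
      + contr₂ b b' (contract H X) (contract H X) = 0)
    (h2 : ∀ a, contr₂ b b' (contract H X) (contract H (b a)) = 0)
    (h3 : ∀ a c, symRicci g X ε H b b' (b a) (b c) = 0)
    (h4 : ∀ a c, contr₁ b b' ((adForm g X).flip (b a)) (contract H X (b c))
      = contr₁ b b' (contract H X (b a)) ((adForm g X).flip (b c))) :
    IsGeneralisedEinstein g H 0 := by
  rw [isGeneralisedEinstein_iff]
  have hB := h.isDualFrame_option hb
  have key : ∀ I J : Option κ, ricciForm g H (I.elim X b) (J.elim X b) = 0 := by
    intro I J
    have : 4 * ricciForm g H (I.elim X b) (J.elim X b) = 0 := by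
      cases I with
      | none => cases J with
        | none => rw [← h1]; exact ricciForm_XX h hb
        | some a => rw [← h2 a]; exact ricciForm_XN h hb _ (hb.mem a)
      | some a => cases J with
        | none => rw [← h2 a]; exact ricciForm_NX h hb _ (hb.mem a)
        | some c =>
          refine (ricciForm_NN h hb _ _ (hb.mem a) (hb.mem c)).trans ?_
          rw [h3, h4, sub_self, mul_zero, add_zero]
    linarith
  intro x y
  rw [← ricciForm_apply, hB.expand x trivial, hB.expand y trivial]
  simp only [map_sum, LinearMap.sum_apply, map_smul, LinearMap.smul_apply, key, smul_zero,
    Finset.sum_const_zero]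

end AlmostAbelian

/-! ### Consequences of the Einstein equations in a null frame. -/

section NullFrame

variable {𝔤 : Type*} [LieRing 𝔤] [LieAlgebra ℝ 𝔤]
  {g : PseudoMetric 𝔤} {N : Submodule ℝ 𝔤} {X : 𝔤} {ε : ℝ} {H : 𝔤 [⋀^Fin 3]→ₗ[ℝ] ℝ}
  {ι : Type*} [Fintype ι] [DecidableEq ι] {l l' : 𝔤} {e : ι → 𝔤}

/-- In dH(X,y,z,w) the brackets inside the Abelian ideal vanish, so what remains is the derivation
action of ad_X on H restricted to N. -/
theorem IsAlmostAbelian.closed (h : IsAlmostAbelian g N X ε) (hH : IsClosedThreeForm H)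
    {y z w : 𝔤} (hy : y ∈ N) (hz : z ∈ N) (hw : w ∈ N) :
    contract H ⁅X, y⁆ z w - contract H ⁅X, z⁆ y w + contract H ⁅X, w⁆ y z = 0 := by
  have h1 := hH X y z w
  simp only [← contract_apply, h.abel y hy z hz, h.abel y hy w hw, h.abel z hz w hw, map_zero,
    LinearMap.zero_apply] at h1
  linarith

theorem adForm_eq (y z : 𝔤) : adForm g X y z = (1 / 2) * (symForm g X y z + skewForm g X y z) := by
  rw [symForm_apply, skewForm_apply, adForm_apply]; ring

theorem adForm_flip_eq (y z : 𝔤) :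
    (adForm g X).flip y z = (1 / 2) * (symForm g X y z - skewForm g X y z) := by
  have e : (adForm g X).flip y z = g.form ⁅X, z⁆ y := rfl
  rw [symForm_apply, skewForm_apply, e]; ring

theorem skewForm_self (y : 𝔤) : skewForm g X y y = 0 := by
  rw [skewForm_apply]; ring

theorem IsNullFrame.apply_eq_zero (F : IsNullFrame g N l l' e) (u : Dual ℝ 𝔤) (h1 : u l = 0)
    (h2 : u l' = 0) (h3 : ∀ i, u (e i) = 0) : ∀ z ∈ N, u z = 0 := by
  intro z hz
  rw [F.expand z hz]
  simp [h1, h2, h3]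

/-- The components of the three-form in a null frame, in contraction with `ad_X`. -/
theorem IsNullFrame.contract_ad (F : IsNullFrame g N l l' e) (h : IsAlmostAbelian g N X ε)
    {y : 𝔤} (hy : y ∈ N) (z w : 𝔤) : contract H ⁅X, y⁆ z w
      = adForm g X y l' * contract H l z w + adForm g X y l * contract H l' z w
        + ∑ i, adForm g X y (e i) * contract H (e i) z w := by
  conv_lhs => rw [F.expand _ (h.ideal y hy)]
  simp [adForm_apply]

set_option linter.unusedSimpArgs false in
/-- All components of `H` of non-negative weight vanish, and `ad_X` is nilpotent in the null
direction. -/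
theorem IsNullFrame.einstein (F : IsNullFrame g N l l' e) (h : IsAlmostAbelian g N X 1)
    (hH : IsClosedThreeForm H)
    (E : EinsteinEqs g N X 1 H (nullFamily l l' e) (nullFamily l' l e)) (L : ℝ)
    (hL : ∀ z ∈ N, symForm g X l z = L * g.form l z)
    (hH0 : ¬ ((∀ z ∈ N, contract H X l z = 0) ∧ (∀ y ∈ N, ∀ z ∈ N, contract H l y z = 0) ∧
      (∀ i j, contract H X (e i) (e j) = 0) ∧ (∀ i, contract H X l' (e i) = 0) ∧
      (∀ i j, contract H l' (e i) (e j) = 0) ∧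
      (∀ i j m, contract H (e i) (e j) (e m) = 0))) :
    ((∀ z ∈ N, contract H X l z = 0) ∧ (∀ y ∈ N, ∀ z ∈ N, contract H l y z = 0) ∧
      (∀ i j, contract H X (e i) (e j) = 0) ∧
      (∀ i j m, contract H (e i) (e j) (e m) = 0)) ∧
    ((∀ z ∈ N, symForm g X l z = 0) ∧ (∀ i j, symForm g X (e i) (e j) = 0) ∧
      (∀ z ∈ N, skewForm g X l z = 0) ∧ (∃ i, symForm g X l' (e i) ≠ 0)) ∧
    (∑ i, skewForm g X l' (e i) * symForm g X l' (e i) + ∑ i, contract H X l' (e i) ^ 2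
      + (1 / 2) * ∑ i, ∑ j, contract H l' (e i) (e j) ^ 2 = 0) ∧
    (∀ i, ∑ m, symForm g X l' (e m) * skewForm g X (e i) (e m) = 0) ∧
    (∀ i, ∑ m, contract H X l' (e m) * skewForm g X (e i) (e m) = 0) ∧
    (∀ i j, ∑ m, skewForm g X (e i) (e m) * contract H l' (e m) (e j)
      + ∑ m, skewForm g X (e j) (e m) * contract H l' (e i) (e m) = 0) := by
  have sll : symForm g X l l = 0 := by rw [hL l F.mem, F.null, mul_zero]
  have sll' : symForm g X l l' = L := by rw [hL l' F.mem', F.pair, mul_one]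
  have sl'l : symForm g X l' l = L := by rw [symForm_comm, sll']
  have sle : ∀ i, symForm g X l (e i) = 0 := fun i => by rw [hL _ (F.mem_e i), F.orth, mul_zero]
  have sel : ∀ i, symForm g X (e i) l = 0 := fun i => by rw [symForm_comm, sle]
  have sel' : ∀ i, symForm g X (e i) l' = symForm g X l' (e i) := fun i => symForm_comm _ _
  have cl'l : skewForm g X l' l = -skewForm g X l l' := skewForm_comm _ _
  have cel : ∀ i, skewForm g X (e i) l = -skewForm g X l (e i) := fun i => skewForm_comm _ _
  have cel' : ∀ i, skewForm g X (e i) l' = -skewForm g X l' (e i) := fun i => skewForm_comm _ _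
  have wl'l : contract H X l' l = -contract H X l l' := contract_swap₂₃ _ _ _
  have wel : ∀ i, contract H X (e i) l = -contract H X l (e i) := fun i => contract_swap₂₃ _ _ _
  have wel' : ∀ i, contract H X (e i) l' = -contract H X l' (e i) := fun i =>
    contract_swap₂₃ _ _ _
  -- the equation for `(l, l)`
  have E0 := E.symm l F.mem l F.mem
  rw [symRicci, contr₂_null_skew _ _ (contract_swap₂₃ l) (contract_swap₂₃ l)] at E0
  simp only [contr₁_null, contract_self₁₂, contract_self₂₃, skewForm_self, sll, sle, zero_mul,
    mul_zero, Finset.sum_const_zero, add_zero, zero_add, one_mul, ← sq] at E0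
  have nn : ∀ x : ι → ℝ, 0 ≤ ∑ i, x i ^ 2 := fun x => Finset.sum_nonneg fun i _ => sq_nonneg _
  have nn2 : ∀ x : ι → ι → ℝ, 0 ≤ ∑ i, ∑ j, x i j ^ 2 := fun x =>
    Finset.sum_nonneg fun i _ => nn _
  -- Since l is an eigenvector of S, the products of S and A drop out of the (l,l) equation, leaving
  -- a sum of squares.
  have wle : ∀ i, contract H X l (e i) = 0 := sum_sq_eq_zero (by
    nlinarith [nn fun i => contract H X l (e i), nn2 fun i j => contract H l (e i) (e j)])
  have hlee : ∀ i j, contract H l (e i) (e j) = 0 := sum_sum_sq_eq_zero (by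
    nlinarith [nn fun i => contract H X l (e i), nn2 fun i j => contract H l (e i) (e j)])
  have hlel' : ∀ i, contract H l (e i) l' = -contract H l l' (e i) := fun i =>
    contract_swap₂₃ _ _ _
  have hl'le : ∀ i, contract H l' l (e i) = -contract H l l' (e i) := fun i =>
    contract_swap₁₂ _ _ _
  have hel : ∀ i z, contract H (e i) l z = -contract H l (e i) z := fun i z =>
    contract_swap₁₂ _ _ _
  have hel' : ∀ i z, contract H (e i) l' z = -contract H l' (e i) z := fun i z =>
    contract_swap₁₂ _ _ _
  have hl'el : ∀ i, contract H l' (e i) l = contract H l l' (e i) := fun i => by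
    rw [contract_swap₂₃, hl'le, neg_neg]
  -- the equations for `(l, l')` and `(e i, e j)`
  have E1 := E.symm l F.mem l' F.mem'
  rw [symRicci, contr₂_null_skew _ _ (contract_swap₂₃ l) (contract_swap₂₃ l')] at E1
  simp only [contr₁_null, contract_self₁₂, contract_self₂₃, skewForm_self, sll, sle, sll', sl'l,
    zero_mul, wle, hlee, hlel', hl'le, wl'l, cl'l,
    mul_zero, Finset.sum_const_zero, add_zero, zero_add, one_mul] at E1
  have E2 : ∀ i j, _ := fun i j => E.symm (e i) (F.mem_e i) (e j) (F.mem_e j)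
  simp only [symRicci, fun i j => contr₂_null_skew (l := l) (l' := l') (e := e) _ _
    (contract_swap₂₃ (H := H) (e i)) (contract_swap₂₃ (H := H) (e j)), contr₁_null,
    contract_self₁₂, contract_self₂₃, skewForm_self, sel, cel, cel', sel', wel, wel', wle,
    hel, hel', hlel', hlee, neg_zero,
    zero_mul, mul_zero, Finset.sum_const_zero, add_zero, zero_add, one_mul] at E2
  have C1 := E.scalar
  rw [contr₂_null, contr₂_null_skew _ _ (contract_swap₂₃ X) (contract_swap₂₃ X)] at C1
  simp only [sll, sll', sl'l, sle, sel, wle, zero_mul, mul_zero, Finset.sum_const_zero, add_zero,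
    zero_add, ← sq] at C1
  have C3 : ∀ i, _ := fun i => E.skew l F.mem (e i) (F.mem_e i)
  simp only [contr₁_null, adForm_flip_eq, sll, sle, sel, skewForm_self, wel, wle, cel,
    contract_self₂₃, sll', wel', neg_zero, mul_zero, zero_mul, add_zero, zero_add,
    Finset.sum_const_zero] at C3
  have K : ∀ i j, _ := fun i j => h.closed hH F.mem (F.mem_e i) (F.mem_e j)
  simp only [F.contract_ad h F.mem, F.contract_ad h (F.mem_e _), adForm_eq, sll, sle, sel, cel,
    hel, hlee, contract_self₁₂, hl'le, skewForm_self, neg_zero, mul_zero, zero_mul, add_zero,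
    zero_add, Finset.sum_const_zero] at K
  obtain ⟨hμ, hL0, hqs, hk, hS, hw, hh⟩ := nullFrame_vanishing L (contract H X l l')
    (fun i => symForm g X l' (e i)) (fun i => skewForm g X l (e i))
    (fun i => contract H l l' (e i)) (fun i j => symForm g X (e i) (e j))
    (fun i j => skewForm g X (e i) (e j)) (fun i j => contract H X (e i) (e j))
    (fun i j m => contract H (e i) (e j) (e m)) (fun _ _ => symForm_comm _ _)
    (fun _ _ => skewForm_comm _ _) (fun _ _ => contract_swap₂₃ _ _ _)
    (by simp only [mul_neg, Finset.sum_neg_distrib, ← sq] at E1; linarith)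
    (fun i j => by
      have := E2 i j
      have e1 : ∀ m, symForm g X (e i) (e m) * skewForm g X (e j) (e m)
        = skewForm g X (e j) (e m) * symForm g X (e i) (e m) := fun m => mul_comm _ _
      simp only [neg_neg] at this
      linarith)
    (by linarith)
    (fun i => by
      have := C3 i
      have e1 : ∑ x, 1 / 2 * (0 - skewForm g X l (e x)) * contract H X (e i) (e x)
          = -(1 / 2) * ∑ x, contract H X (e i) (e x) * skewForm g X l (e x) := by
        rw [Finset.mul_sum]; exact Finset.sum_congr rfl fun x _ => by ring
      rw [e1] at this
      linarith)
    (fun i j => by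
      have := K i j
      simp only [mul_assoc, ← Finset.mul_sum] at this
      linarith)
  have wl'l0 : contract H X l' l = 0 := by rw [wl'l, hμ, neg_zero]
  -- With k, S, w and h gone, the (eᵢ,eⱼ) equations reduce to the vanishing of the symmetric product
  -- of A(l,·) and S(l',·).
  have E2' : ∀ i j, skewForm g X l (e i) * symForm g X l' (e j)
      + symForm g X l' (e i) * skewForm g X l (e j) = 0 := fun i j => by
    have := E2 i j
    simp only [hk, hS, hw, hh, mul_zero, zero_mul, Finset.sum_const_zero, neg_zero] at this
    linarith
  have E3 : ∀ i, _ := fun i => E.symm l' F.mem' (e i) (F.mem_e i)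
  simp only [symRicci, fun i => contr₂_null_skew (l := l) (l' := l') (e := e) _ _
    (contract_swap₂₃ (H := H) l') (contract_swap₂₃ (H := H) (e i)), contr₁_null,
    contract_self₁₂, contract_self₂₃, skewForm_self, sel, cel, cel', sel', wel, wel', wle, hw, hS,
    hel, hel', hlel', hlee, neg_zero, sl'l, hL0, hh, hk, hl'le, wl'l0, cl'l,
    zero_mul, mul_zero, Finset.sum_const_zero, add_zero, zero_add, one_mul] at E3
  have E4 := E.symm l' F.mem' l' F.mem'
  rw [symRicci, contr₂_null_skew _ _ (contract_swap₂₃ l') (contract_swap₂₃ l')] at E4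
  simp only [contr₁_null, contract_self₁₂, contract_self₂₃, skewForm_self, sl'l, hL0, hk, wl'l0,
    hl'le, neg_zero, cl'l, zero_mul, mul_zero, Finset.sum_const_zero, add_zero, zero_add, one_mul,
    ← sq] at E4
  have C3' : ∀ i, _ := fun i => E.skew l' F.mem' (e i) (F.mem_e i)
  simp only [contr₁_null, adForm_flip_eq, sl'l, hL0, sel, skewForm_self, wel, wel', wle, cel, hw,
    hS, contract_self₂₃, wl'l0, cl'l, neg_zero, mul_zero, zero_mul, add_zero, zero_add,
    Finset.sum_const_zero] at C3'
  have K' : ∀ i j, _ := fun i j => h.closed hH F.mem' (F.mem_e i) (F.mem_e j)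
  simp only [F.contract_ad h F.mem', F.contract_ad h (F.mem_e _), adForm_eq, sl'l, hL0, sel, cel,
    hel, hel', hlee, contract_self₁₂, hl'le, skewForm_self, hS, hh, hk, hl'el, hlel', cl'l,
    neg_zero, mul_zero, zero_mul, add_zero, zero_add, Finset.sum_const_zero] at K'
  have hl'll' : contract H l' l l' = 0 := by rw [contract_swap₂₃, contract_self₁₂, neg_zero]
  have Wl : ∀ z ∈ N, contract H X l z = 0 :=
    F.apply_eq_zero _ (contract_self₂₃ _ _) hμ wle
  have Hl : ∀ y ∈ N, ∀ z ∈ N, contract H l y z = 0 := by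
    intro y hy z hz
    refine F.apply_eq_zero ((contract H l).flip z) (contract_self₁₂ _ _) ?_ (fun i => ?_) y hy
    · exact F.apply_eq_zero (contract H l l') (by rw [contract_swap₂₃, contract_self₁₂, neg_zero])
        (contract_self₂₃ _ _) hk z hz
    · exact F.apply_eq_zero (contract H l (e i)) (by rw [contract_swap₂₃, contract_self₁₂, neg_zero])
        (by rw [hlel', hk, neg_zero]) (hlee i) z hz
  obtain ⟨hs, hα, hq⟩ := nullFrame_rigidity (skewForm g X l l') (symForm g X l' l')
    (fun i => symForm g X l' (e i)) (fun i => skewForm g X l (e i))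
    (fun i => skewForm g X l' (e i)) (fun i => contract H X l' (e i))
    (fun i j => skewForm g X (e i) (e j)) (fun i j => contract H l' (e i) (e j))
    (fun _ _ => skewForm_comm _ _) hqs E2'
    (by
      have e1 : ∀ x, symForm g X l' (e x) * skewForm g X l' (e x)
        = skewForm g X l' (e x) * symForm g X l' (e x) := fun x => mul_comm _ _
      simp only [e1, hl'll'] at E4
      simp only [zero_pow two_ne_zero, Finset.sum_const_zero] at E4
      linarith)
    (fun i => by
      have := C3' i
      have e1 : ∑ x, contract H X l' (e x) * (1 / 2 * (0 - skewForm g X (e i) (e x)))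
          = -(1 / 2) * ∑ x, contract H X l' (e x) * skewForm g X (e i) (e x) := by
        rw [Finset.mul_sum]; exact Finset.sum_congr rfl fun x _ => by ring
      rw [e1] at this
      linarith)
    (fun i j => by
      have := K' i j
      have e1 : ∀ i j, ∑ x, 1 / 2 * skewForm g X (e i) (e x) * -contract H l' (e x) (e j)
          = -(1 / 2) * ∑ x, skewForm g X (e i) (e x) * contract H l' (e x) (e j) := fun i j => by
        rw [Finset.mul_sum]; exact Finset.sum_congr rfl fun x _ => by ring
      have e2 : ∑ x, skewForm g X (e j) (e x) * contract H l' (e i) (e x)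
          = -∑ x, skewForm g X (e j) (e x) * contract H l' (e x) (e i) := by
        rw [← Finset.sum_neg_distrib]
        exact Finset.sum_congr rfl fun x _ => by rw [contract_swap₂₃ l' (e x) (e i)]; ring
      rw [e1, e1] at this
      rw [e2]
      linarith)
    -- If H(X,l',·) and H(l',·,·) vanished as well, no component of H would be left.
    (fun hpa => hH0 ⟨Wl, Hl, hw, hpa.1, hpa.2, hh⟩)
  refine ⟨⟨Wl, Hl, hw, hh⟩, ⟨fun z hz => by rw [hL z hz, hL0, zero_mul], hS, ?_, hs⟩,
    ?_, fun i => ?_, fun i => ?_, fun i j => ?_⟩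
  · exact F.apply_eq_zero _ (skewForm_self _) hα hq
  · have e1 : ∀ x, symForm g X l' (e x) * skewForm g X l' (e x)
        = skewForm g X l' (e x) * symForm g X l' (e x) := fun x => mul_comm _ _
    simp only [e1, hl'll', hα] at E4
    simp only [zero_pow two_ne_zero, Finset.sum_const_zero] at E4
    linarith
  · have := E3 i
    rw [hα, hq] at this
    linarith
  · have := C3' i
    have e1 : ∑ x, contract H X l' (e x) * (1 / 2 * (0 - skewForm g X (e i) (e x)))
        = -(1 / 2) * ∑ x, contract H X l' (e x) * skewForm g X (e i) (e x) := by
      rw [Finset.mul_sum]; exact Finset.sum_congr rfl fun x _ => by ring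
    rw [e1, hα] at this
    linarith
  · have := K' i j
    have e1 : ∀ i j, ∑ x, 1 / 2 * skewForm g X (e i) (e x) * -contract H l' (e x) (e j)
        = -(1 / 2) * ∑ x, skewForm g X (e i) (e x) * contract H l' (e x) (e j) := fun i j => by
      rw [Finset.mul_sum]; exact Finset.sum_congr rfl fun x _ => by ring
    have e2 : ∑ x, skewForm g X (e j) (e x) * contract H l' (e i) (e x)
        = -∑ x, skewForm g X (e j) (e x) * contract H l' (e x) (e i) := by
      rw [← Finset.sum_neg_distrib]
      exact Finset.sum_congr rfl fun x _ => by rw [contract_swap₂₃ l' (e x) (e i)]; ring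
    rw [e1, e1, hα] at this
    rw [e2]
    linarith

end NullFrame

/-! ### Orthonormal frames of Euclidean subspaces. -/

section Euclidean

variable {V : Type*} [AddCommGroup V] [Module ℝ V] {ι : Type*} [Fintype ι] [DecidableEq ι]

/-- `e` is an orthonormal basis of the subspace `W`. -/
structure IsOrthoFrame (g : PseudoMetric V) (W : Submodule ℝ V) (e : ι → V) : Prop where
  mem : ∀ i, e i ∈ W
  orthonormal : ∀ i j, g.form (e i) (e j) = if i = j then 1 else 0
  expand : ∀ v ∈ W, v = ∑ i, g.form v (e i) • e i

variable {g : PseudoMetric V} {W : Submodule ℝ V}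

/-- An orthogonal basis of the restricted form is rescaled to unit length, which positivity permits.
-/
theorem exists_isOrthoFrame [FiniteDimensional ℝ V] (hW : ∀ x ∈ W, x ≠ 0 → 0 < g.form x x) :
    ∃ e : Fin (finrank ℝ W) → V, IsOrthoFrame g W e := by
  have hsymm : (g.form.restrict W).IsSymm := ⟨fun x y => g.symm.eq (x : V) (y : V)⟩
  obtain ⟨v, hv⟩ := LinearMap.BilinForm.exists_orthogonal_basis
    (LinearMap.BilinForm.isSymm_iff.1 hsymm)
  have hpos : ∀ i, 0 < g.form (v i : V) (v i : V) := fun i =>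
    hW _ (v i).2 fun h => v.ne_zero i (Subtype.ext h)
  have hv' : ∀ i j, i ≠ j → g.form (v i : V) (v j : V) = 0 := fun i j hij => hv hij
  refine ⟨fun i => (√(g.form (v i : V) (v i : V)))⁻¹ • (v i : V),
    fun i => W.smul_mem _ (v i).2, fun i j => ?_, fun x hx => ?_⟩
  · simp only [map_smul, LinearMap.smul_apply, smul_eq_mul]
    split_ifs with h
    · subst h
      have := (Real.sqrt_pos.2 (hpos i)).ne'
      field_simp
      exact (Real.sq_sqrt (hpos i).le).symm
    · rw [hv' i j h]; simp
  · have h1 := v.sum_repr ⟨x, hx⟩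
    have h2 : x = ∑ i, v.repr ⟨x, hx⟩ i • (v i : V) := by
      have := congrArg W.subtype h1
      simp only [map_sum, map_smul, Submodule.subtype_apply] at this
      exact this.symm
    have h3 : ∀ j, g.form x (v j : V) = v.repr ⟨x, hx⟩ j * g.form (v j : V) (v j : V) := by
      intro j
      conv_lhs => rw [h2]
      simp only [map_sum, LinearMap.sum_apply, map_smul, LinearMap.smul_apply, smul_eq_mul]
      rw [Finset.sum_eq_single j]
      · intro i _ hij
        rw [hv' i j hij, mul_zero]
      · simp
    conv_lhs => rw [h2]
    refine Finset.sum_congr rfl fun i _ => ?_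
    rw [map_smul, smul_smul, h3]
    congr 1
    have := (Real.sqrt_pos.2 (hpos i)).ne'
    have h4 := Real.sq_sqrt (hpos i).le
    rw [smul_eq_mul]
    field_simp
    rw [h4]

variable (e : ι → V)

/-- The parametrisation of the span of `e` by `ℝ^ι`. -/
def frameMap : EuclideanSpace ℝ ι →ₗ[ℝ] V where
  toFun x := ∑ i, x i • e i
  map_add' x y := by simp [add_smul, Finset.sum_add_distrib]
  map_smul' t x := by simp [Finset.smul_sum, smul_smul]

variable (g) in
/-- The coordinates with respect to an orthonormal family `e`. -/
def frameCoord : V →ₗ[ℝ] EuclideanSpace ℝ ι where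
  toFun v := WithLp.toLp 2 fun i => g.form v (e i)
  map_add' x y := by ext i; simp
  map_smul' t x := by ext i; simp

variable {e}

-- Coordinates are adjoint to the parametrisation. This makes a compression of an endomorphism to
-- the subspace symmetric or skew on `EuclideanSpace` when it is so for g.
omit [DecidableEq ι] in
theorem inner_frameCoord (v : V) (x : EuclideanSpace ℝ ι) :
    inner ℝ (frameCoord g e v) x = g.form v (frameMap e x) := by
  simp [frameCoord, frameMap, PiLp.inner_apply]

namespace IsOrthoFrame

variable (he : IsOrthoFrame g W e)

include he

theorem frameMap_mem (x : EuclideanSpace ℝ ι) : frameMap e x ∈ W :=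
  W.sum_mem fun i _ => W.smul_mem _ (he.mem i)

theorem frameMap_frameCoord {v : V} (hv : v ∈ W) : frameMap e (frameCoord g e v) = v :=
  (he.expand v hv).symm

theorem frameCoord_frameMap (x : EuclideanSpace ℝ ι) : frameCoord g e (frameMap e x) = x := by
  ext i
  simp [frameCoord, frameMap, he.orthonormal]

theorem inner_eq (x y : EuclideanSpace ℝ ι) :
    inner ℝ x y = g.form (frameMap e x) (frameMap e y) := by
  rw [← inner_frameCoord, he.frameCoord_frameMap]

/-- The parametrisation is isometric, so eigenbases found in `EuclideanSpace` can be carried back to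
the subspace. -/
theorem of_orthonormalBasis {κ : Type*} [Fintype κ] [DecidableEq κ]
    (b : OrthonormalBasis κ ℝ (EuclideanSpace ℝ ι)) :
    IsOrthoFrame g W (fun i => frameMap e (b i)) where
  mem i := he.frameMap_mem _
  orthonormal i j := by
    rw [← he.inner_eq]; exact orthonormal_iff_ite.1 b.orthonormal i j
  expand v hv := by
    conv_lhs => rw [← he.frameMap_frameCoord hv, ← b.sum_repr' (frameCoord g e v)]
    simp only [map_sum, map_smul]
    refine Finset.sum_congr rfl fun i _ => ?_
    rw [real_inner_comm, inner_frameCoord]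

end IsOrthoFrame

end Euclidean

/-! ### Normal form of skew endomorphisms of Euclidean spaces. -/

section SkewNormalForm

/-- Normal form of a skew-symmetric endomorphism of a Euclidean vector space, as an orthonormal
family of the right cardinality. -/
theorem exists_skew_normalForm_aux (n : ℕ) : ∀ (E : Type) [NormedAddCommGroup E]
    [InnerProductSpace ℝ E] [FiniteDimensional ℝ E] (A : E →ₗ[ℝ] E), finrank ℝ E = n →
    (∀ x y, inner ℝ (A x) y = -inner ℝ x (A y)) →
    ∃ (k l : ℕ) (v : (Fin 2 × Fin k) ⊕ Fin l → E) (c : Fin k → ℝ), 2 * k + l = n ∧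
      Orthonormal ℝ v ∧ (∀ i, 0 < c i) ∧
      (∀ i, A (v (Sum.inl (0, i))) = c i • v (Sum.inl (1, i))) ∧
      (∀ i, A (v (Sum.inl (1, i))) = -(c i • v (Sum.inl (0, i)))) ∧
      ∀ i, A (v (Sum.inr i)) = 0 := by
  induction n using Nat.strong_induction_on with
  | _ n ih =>
  intro E _ _ _ A hn hA
  -- A² is symmetric and so has an orthonormal eigenbasis. A basis vector x not killed by A spans
  -- with Ax an invariant plane, and induction applies to its orthogonal complement.
  have hAA : (A ∘ₗ A).IsSymmetric := fun x y => by
    simp only [LinearMap.comp_apply]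
    rw [hA, hA, neg_neg]
  by_cases hA0 : ∀ i, A (hAA.eigenvectorBasis hn i) = 0
  · refine ⟨0, n, Sum.elim (fun p => p.2.elim0) (hAA.eigenvectorBasis hn), fun i => i.elim0,
      by simp, ?_, fun i => i.elim0, fun i => i.elim0, fun i => i.elim0, fun i => ?_⟩
    · rw [orthonormal_iff_ite]
      rintro (⟨-, i⟩ | i) (⟨-, j⟩ | j)
      · exact i.elim0
      · exact i.elim0
      · exact j.elim0
      · simpa using orthonormal_iff_ite.1 (hAA.eigenvectorBasis hn).orthonormal i j
    · exact hA0 i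
  · push Not at hA0
    obtain ⟨i, hi⟩ := hA0
    set x := hAA.eigenvectorBasis hn i with hx
    have hxx : inner ℝ x x = (1 : ℝ) := by
      rw [real_inner_self_eq_norm_sq, (hAA.eigenvectorBasis hn).orthonormal.1 i]; norm_num
    set c : ℝ := ‖A x‖ with hc
    have hc0 : 0 < c := norm_pos_iff.2 hi
    -- The eigenvalue of A² is read off by pairing with the unit vector x: ⟨A²x, x⟩ = -‖Ax‖².
    have hAAx : A (A x) = -(c ^ 2) • x := by
      have h1 : A (A x) = hAA.eigenvalues hn i • x := hAA.apply_eigenvectorBasis hn i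
      have h2 : inner ℝ (A (A x)) x = -(c ^ 2) := by
        rw [hA, real_inner_self_eq_norm_sq]
      rw [h1, inner_smul_left, hxx] at h2
      rw [h1, ← h2]; simp
    set y := c⁻¹ • A x with hy
    have hAx : A x = c • y := by rw [hy, smul_smul, mul_inv_cancel₀ hc0.ne', one_smul]
    have hAy : A y = -(c • x) := by
      rw [hy, map_smul, hAAx, smul_smul, ← neg_smul]
      congr 1
      field_simp
    have hAxx : inner ℝ (A x) x = (0 : ℝ) := by
      have := hA x x
      rw [real_inner_comm (A x) x] at this
      linarith [real_inner_comm (A x) x]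
    have hyx : inner ℝ y x = (0 : ℝ) := by rw [hy, inner_smul_left, hAxx, mul_zero]
    have hyy : inner ℝ y y = (1 : ℝ) := by
      rw [hy, inner_smul_left, inner_smul_right, real_inner_self_eq_norm_sq, ← hc]
      simp only [conj_trivial]
      field_simp
    set W : Submodule ℝ E := (Submodule.span ℝ {x, y})ᗮ with hW
    have hWx : ∀ z ∈ W, inner ℝ z x = (0 : ℝ) ∧ inner ℝ z y = (0 : ℝ) := fun z hz => by
      rw [hW, Submodule.mem_orthogonal'] at hz
      exact ⟨hz x (Submodule.subset_span (by simp)), hz y (Submodule.subset_span (by simp))⟩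
    have hWm : ∀ z, inner ℝ z x = (0 : ℝ) → inner ℝ z y = (0 : ℝ) → z ∈ W := fun z h1 h2 => by
      rw [hW, Submodule.mem_orthogonal']
      intro u hu
      obtain ⟨a, b, rfl⟩ := Submodule.mem_span_pair.1 hu
      rw [inner_add_right, inner_smul_right, inner_smul_right, h1, h2]; simp
    have hWA : ∀ z ∈ W, A z ∈ W := fun z hz => by
      obtain ⟨h1, h2⟩ := hWx z hz
      apply hWm
      · rw [hA, hAx, inner_smul_right, h2]; simp
      · rw [hA, hAy, inner_neg_right, inner_smul_right, h1]; simp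
    have hxy : Orthonormal ℝ ![x, y] := by
      rw [orthonormal_iff_ite]
      intro i j
      fin_cases i <;> fin_cases j <;> simp [-inner_self_eq_norm_sq_to_K, hxx, hyy, hyx,
        real_inner_comm y x]
    have hspan : finrank ℝ (Submodule.span ℝ {x, y}) = 2 := by
      have := finrank_span_eq_card hxy.linearIndependent
      rwa [Matrix.range_cons, Matrix.range_cons, Matrix.range_empty, Set.union_empty,
        Set.singleton_union, Fintype.card_fin] at this
    have hfin := Submodule.finrank_add_finrank_orthogonal (Submodule.span ℝ {x, y})
    rw [hspan, hn] at hfin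
    obtain ⟨k, l, v, d, hkl, hv, hd, h0, h1, h2⟩ := ih (n - 2) (by omega) W (A.restrict hWA)
      (by rw [← hfin, Nat.add_sub_cancel_left]) (fun z w => hA z w)
    have hv' := orthonormal_iff_ite.1 hv
    have hxy' := orthonormal_iff_ite.1 hxy
    have hvw : ∀ (a : Fin 2) p, inner ℝ (![x, y] a) (v p : E) = (0 : ℝ) := fun a p => by
      obtain ⟨h1, h2⟩ := hWx (v p) (v p).2
      fin_cases a
      · simpa [real_inner_comm] using h1
      · simpa [real_inner_comm] using h2
    refine ⟨k + 1, l, Sum.elim (fun p => Fin.cases (![x, y] p.1)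
      (fun i => (v (Sum.inl (p.1, i)) : E)) p.2) (fun i => (v (Sum.inr i) : E)),
      Fin.cases c d, by omega, ?_, ?_, ?_, ?_, ?_⟩
    · have hvv : ∀ p q, inner ℝ (v p : E) (v q : E) = if p = q then (1 : ℝ) else 0 := hv'
      rw [orthonormal_iff_ite]
      rintro (⟨a, i⟩ | i) (⟨b, j⟩ | j)
      · refine Fin.cases ?_ (fun i => ?_) i <;> refine Fin.cases ?_ (fun j => ?_) j
        · simpa using hxy' a b
        · simpa [(Fin.succ_ne_zero _).symm] using hvw a (Sum.inl (b, j))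
        · rw [real_inner_comm]
          simpa [Fin.succ_ne_zero] using hvw b (Sum.inl (a, i))
        · simpa using hvv (Sum.inl (a, i)) (Sum.inl (b, j))
      · refine Fin.cases ?_ (fun i => ?_) i
        · simpa using hvw a (Sum.inr j)
        · simpa using hvv (Sum.inl (a, i)) (Sum.inr j)
      · refine Fin.cases ?_ (fun j => ?_) j
        · rw [real_inner_comm]
          simpa using hvw b (Sum.inr i)
        · simpa using hvv (Sum.inr i) (Sum.inl (b, j))
      · simpa using hvv (Sum.inr i) (Sum.inr j)
    · exact fun i => Fin.cases hc0 hd i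
    · refine fun i => Fin.cases ?_ (fun i => ?_) i
      · simpa using hAx
      · simpa using congrArg Subtype.val (h0 i)
    · refine fun i => Fin.cases ?_ (fun i => ?_) i
      · simpa using hAy
      · simpa using congrArg Subtype.val (h1 i)
    · exact fun i => by simpa using congrArg Subtype.val (h2 i)

/-- Normal form of a skew-symmetric endomorphism of a Euclidean vector space. -/
theorem exists_skew_normalForm {E : Type} [NormedAddCommGroup E]
    [InnerProductSpace ℝ E] [FiniteDimensional ℝ E] (A : E →ₗ[ℝ] E)
    (hA : ∀ x y, inner ℝ (A x) y = -inner ℝ x (A y)) :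
    ∃ (k l : ℕ) (v : OrthonormalBasis ((Fin 2 × Fin k) ⊕ Fin l) ℝ E) (c : Fin k → ℝ),
      Antitone c ∧ (∀ i, 0 < c i) ∧
      (∀ i, A (v (Sum.inl (0, i))) = c i • v (Sum.inl (1, i))) ∧
      (∀ i, A (v (Sum.inl (1, i))) = -(c i • v (Sum.inl (0, i)))) ∧
      ∀ i, A (v (Sum.inr i)) = 0 := by
  obtain ⟨k, l, v, c, hkl, hv, hc, h0, h1, h2⟩ :=
    exists_skew_normalForm_aux (finrank ℝ E) E A rfl hA
  -- Sorting -c increasingly orders c decreasingly.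
  let σ : Equiv.Perm (Fin k) := Tuple.sort (-c)
  let w : (Fin 2 × Fin k) ⊕ Fin l → E := v ∘ Sum.map (Prod.map id σ) id
  have hw : Orthonormal ℝ w := hv.comp _
    (Function.Injective.sumMap (Function.injective_id.prodMap σ.injective) Function.injective_id)
  -- An orthonormal family of full cardinality is extended from the set of all indices, which turns
  -- it into an orthonormal basis.
  have hw' : Orthonormal ℝ (Set.univ.domRestrict w) :=
    hw.comp Subtype.val Subtype.val_injective
  obtain ⟨b, hb⟩ := hw'.exists_orthonormalBasis_extension_of_card_eq (by simp [hkl.symm])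
  have hb' : ∀ p, b p = w p := fun p => hb p (Set.mem_univ p)
  refine ⟨k, l, b, c ∘ σ, ?_, fun i => hc _, fun i => ?_, fun i => ?_, fun i => ?_⟩
  · intro i j hij
    have := Tuple.monotone_sort (-c) hij
    simpa using this
  · rw [hb', hb']; exact h0 _
  · rw [hb', hb']; exact h1 _
  · rw [hb']; exact h2 _

end SkewNormalForm

/-! ### Invariant lines and planes of a real endomorphism. -/

section Rotation

variable {E : Type*} [AddCommGroup E] [Module ℝ E]

/-- Completing the square: put y = Tx - rx, so that (T - r)y = Dx. For D ≥ 0 the polynomial factors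
and yields an eigenvector; for D < 0 the pair x, y/√(-D) is rotated and scaled. -/
theorem exists_eigenvector_or_rotation_of_quadratic (T : End ℝ E) {x : E} (hx : x ≠ 0) {a b c : ℝ}
    (habc : ¬ (a = 0 ∧ b = 0 ∧ c = 0)) (h : a • T (T x) + b • T x + c • x = 0) :
    (∃ v ≠ 0, ∃ t : ℝ, T v = t • v) ∨
      ∃ (v w : E) (r δ : ℝ), v ≠ 0 ∧ 0 < δ ∧ T v = r • v + δ • w ∧ T w = r • w - δ • v := by
  by_cases ha : a = 0
  · left
    rw [ha, zero_smul, zero_add] at h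
    have hb : b ≠ 0 := fun hb => by
      rw [hb, zero_smul, zero_add] at h
      exact habc ⟨ha, hb, (smul_eq_zero.1 h).resolve_right hx⟩
    refine ⟨x, hx, -(b⁻¹ * c), ?_⟩
    have h1 : b⁻¹ • (b • T x + c • x) = 0 := by rw [h, smul_zero]
    rw [smul_add, smul_smul, smul_smul, inv_mul_cancel₀ hb, one_smul] at h1
    rw [neg_smul]
    exact eq_neg_of_add_eq_zero_left h1
  -- r is the mean of the roots of the quadratic polynomial and D its discriminant divided by 4a².
  · obtain ⟨r, D, h1⟩ : ∃ r D : ℝ, T (T x - r • x) - r • (T x - r • x) = D • x := by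
      refine ⟨-(b / (2 * a)), (b / (2 * a)) ^ 2 - c / a, ?_⟩
      have h2 : T (T x) = -(a⁻¹ * b) • T x - (a⁻¹ * c) • x := by
        have h3 : a⁻¹ • (a • T (T x) + b • T x + c • x) = 0 := by rw [h, smul_zero]
        rw [smul_add, smul_add, smul_smul, smul_smul, smul_smul, inv_mul_cancel₀ ha, one_smul] at h3
        rw [neg_smul, ← sub_eq_zero, ← h3]
        abel
      rw [map_sub, map_smul, h2]
      match_scalars
      · field_simp; ring
      · field_simp; ring
    rcases le_or_gt 0 D with hD | hD
    · left
      by_cases h2 : T x - r • x + √D • x = 0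
      · refine ⟨x, hx, r - √D, ?_⟩
        rw [sub_smul, ← sub_eq_zero, ← h2]; abel
      · refine ⟨_, h2, r + √D, ?_⟩
        have h3 : T (T x - r • x) = r • (T x - r • x) + D • x := by
          rw [← h1]; abel
        have h4 : D = √D * √D := (Real.mul_self_sqrt hD).symm
        rw [map_add, h3, map_smul]
        generalize √D = d at *
        rw [h4]
        module
    · right
      have hδ : 0 < √(-D) := Real.sqrt_pos.2 (by linarith)
      have h4 : D = -(√(-D) * √(-D)) := by rw [Real.mul_self_sqrt (by linarith)]; ring
      refine ⟨x, (√(-D))⁻¹ • (T x - r • x), r, √(-D), hx, hδ, ?_, ?_⟩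
      · rw [smul_smul, mul_inv_cancel₀ hδ.ne', one_smul]; abel
      · have h3 : T (T x - r • x) = r • (T x - r • x) + D • x := by
          rw [← h1]; abel
        have h5 : (√(-D))⁻¹ * D = -√(-D) := by
          rw [inv_mul_eq_div, div_eq_iff hδ.ne', neg_mul]
          exact h4
        rw [map_smul, h3, smul_add, smul_comm r, smul_smul _ D, h5, neg_smul, ← sub_eq_add_neg]

/-- A real endomorphism has an eigenvector or an invariant plane on which it is a similarity. -/
theorem exists_eigenvector_or_rotation [FiniteDimensional ℝ E] [Nontrivial E] (T : End ℝ E) :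
    (∃ v ≠ 0, ∃ t : ℝ, T v = t • v) ∨
      ∃ (v w : E) (r δ : ℝ), v ≠ 0 ∧ 0 < δ ∧ T v = r • v + δ • w ∧ T w = r • w - δ • v := by
  have hT := Algebra.IsIntegral.isIntegral (R := ℝ) T
  have h0 : minpoly ℝ T ≠ 0 := minpoly.ne_zero hT
  -- A real irreducible factor p of the minimal polynomial has degree at most two. By minimality the
  -- cofactor q does not kill everything, and p(T) annihilates the image of q(T).
  obtain ⟨p, hp, q, hpq⟩ := WfDvdMonoid.exists_irreducible_factor (minpoly.not_isUnit ℝ T) h0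
  have hq0 : q ≠ 0 := fun h => h0 (by rw [hpq, h, mul_zero])
  have hq : Polynomial.aeval T q ≠ 0 := fun h => by
    have h1 := Polynomial.natDegree_le_of_dvd (minpoly.dvd ℝ T h) hq0
    rw [hpq, Polynomial.natDegree_mul hp.ne_zero hq0] at h1
    have := hp.natDegree_pos
    omega
  obtain ⟨y, hy⟩ : ∃ y, Polynomial.aeval T q y ≠ 0 := by
    by_contra! h; exact hq (LinearMap.ext h)
  have h1 : Polynomial.aeval T p (Polynomial.aeval T q y) = 0 := by
    rw [← Module.End.mul_apply, ← map_mul, ← hpq, minpoly.aeval]; rfl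
  have h2 := Polynomial.eq_quadratic_of_degree_le_two hp.degree_le_two
  refine exists_eigenvector_or_rotation_of_quadratic T hy (a := p.coeff 2) (b := p.coeff 1)
    (c := p.coeff 0) (fun h => hp.ne_zero ?_) ?_
  · rw [h2, h.1, h.2.1, h.2.2]; simp
  · rw [h2] at h1
    simpa [Algebra.smul_def, pow_two, Module.End.mul_apply] using h1

end Rotation

/-! ### Linear algebra of Lorentzian subspaces. -/

section Lorentz

variable {V : Type*} [AddCommGroup V] [Module ℝ V] {g : PseudoMetric V} {N : Submodule ℝ V}

/-- The restriction of `g` to `N` has signature `(m - 1, 1)`. -/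
structure IsLorentzOn (g : PseudoMetric V) (N : Submodule ℝ V) : Prop where
  timelike : ∃ t ∈ N, g.form t t < 0
  pos : ∀ x ∈ N, g.form x x < 0 → ∀ y ∈ N, g.form x y = 0 → y ≠ 0 → 0 < g.form y y

/-- A timelike vector and an orthogonal non-zero vector of non-positive square would span a plane on
which the form is non-positive, too large for signature (n-1,1). -/
theorem isLorentzOn_top [FiniteDimensional ℝ V] (hg : g.IsLorentzian) : IsLorentzOn g ⊤ where
  timelike := by
    obtain ⟨W, hW, hW'⟩ := exists_finrank_eq_sigNeg_and_negDef
      (LinearMap.BilinMap.toQuadraticMap g.form)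
    rw [hg.2] at hW
    obtain ⟨w, hw⟩ := (finrank_pos_iff_exists_ne_zero (R := ℝ) (M := W)).1 (by omega)
    refine ⟨w, trivial, ?_⟩
    have := hW' w hw
    simpa using this
  pos x _ hx y _ hxy hy := by
    by_contra! hyy
    have h1 := QuadraticForm.sigPos_add_finrank_le_of_nonpos
      (Q := LinearMap.BilinMap.toQuadraticMap g.form) (V := Submodule.span ℝ {x, y})
      (fun v hv => by
        obtain ⟨a, b, rfl⟩ := Submodule.mem_span_pair.1 hv
        have hyx : g.form y x = 0 := by rw [form_comm, hxy]
        simp only [LinearMap.BilinMap.toQuadraticMap_apply, map_add, map_smul,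
          LinearMap.add_apply, LinearMap.smul_apply, smul_eq_mul, hxy, hyx]
        nlinarith [sq_nonneg a, sq_nonneg b, mul_nonneg (sq_nonneg a) (neg_nonneg.2 hx.le),
          mul_nonneg (sq_nonneg b) (neg_nonneg.2 hyy)])
    have h2 : LinearIndependent ℝ ![x, y] := by
      rw [LinearIndependent.pair_iff]
      intro a b hab
      have h3 : a * g.form x x = 0 := by
        have := congrArg (g.form x) hab
        simpa [hxy] using this
      have ha : a = 0 := (mul_eq_zero.1 h3).resolve_right hx.ne
      rw [ha, zero_smul, zero_add] at hab
      exact ⟨ha, (smul_eq_zero.1 hab).resolve_right hy⟩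
    have h3 := finrank_span_eq_card h2
    rw [Matrix.range_cons, Matrix.range_cons, Matrix.range_empty, Set.union_empty,
        Set.singleton_union, Fintype.card_fin] at h3
    have := hg.1
    omega

namespace IsLorentzOn

theorem mono {N' : Submodule ℝ V} (h : IsLorentzOn g N) (hN : N' ≤ N)
    (ht : ∃ t ∈ N', g.form t t < 0) : IsLorentzOn g N' :=
  ⟨ht, fun x hx hxx y hy => h.pos x (hN hx) hxx y (hN hy)⟩

/-- Orthogonal null vectors are proportional. -/
theorem eq_smul_of_null (h : IsLorentzOn g N) {x y : V} (hx : x ∈ N) (hy : y ∈ N) (hx0 : x ≠ 0)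
    (hxx : g.form x x = 0) (hyy : g.form y y = 0) (hxy : g.form x y = 0) : ∃ c : ℝ, y = c • x := by
  obtain ⟨t, ht, htt⟩ := h.timelike
  have htx : g.form t x ≠ 0 := fun h0 => (h.pos t ht htt x hx h0 hx0).ne' hxx
  -- This factor makes the difference y - cx orthogonal to the timelike t. The difference is also
  -- null, so positivity on t^⊥ forces it to vanish.
  refine ⟨g.form t y / g.form t x, ?_⟩
  by_contra hne
  have hyx : g.form y x = 0 := by rw [form_comm, hxy]
  have := h.pos t ht htt (y - (g.form t y / g.form t x) • x)
    (N.sub_mem hy (N.smul_mem _ hx)) (by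
      simp only [map_sub, map_smul, smul_eq_mul]; field_simp; ring) (sub_ne_zero.2 hne)
  simp [hxx, hyy, hxy, hyx] at this

end IsLorentzOn

/-- Removing the component along a spacelike vector lowers the square by g(t,x)²/g(x,x). -/
theorem timelike_sub_proj {t x : V} (ht : g.form t t < 0) (hx : 0 < g.form x x) :
    g.form (t - (g.form t x / g.form x x) • x) (t - (g.form t x / g.form x x) • x) < 0 := by
  have e : g.form (t - (g.form t x / g.form x x) • x) (t - (g.form t x / g.form x x) • x)
      = g.form t t - (g.form t x) ^ 2 / g.form x x := by
    simp only [map_sub, map_smul, smul_eq_mul, LinearMap.sub_apply, LinearMap.smul_apply]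
    rw [form_comm g x t]
    field_simp
    ring
  rw [e]
  have := div_nonneg (sq_nonneg (g.form t x)) hx.le
  linarith

/-- The orthogonal complement of a vector in a subspace. -/
def orthIn (g : PseudoMetric V) (N : Submodule ℝ V) (x : V) : Submodule ℝ V :=
  N ⊓ LinearMap.ker (g.form x)

theorem mem_orthIn {x y : V} : y ∈ orthIn g N x ↔ y ∈ N ∧ g.form x y = 0 := by
  rw [orthIn, Submodule.mem_inf, LinearMap.mem_ker]

theorem IsLorentzOn.orthIn_of_pos (h : IsLorentzOn g N) {x : V} (hx : x ∈ N) (hxx : 0 < g.form x x) :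
    IsLorentzOn g (orthIn g N x) := by
  obtain ⟨t, ht, htt⟩ := h.timelike
  refine h.mono inf_le_left ⟨t - (g.form t x / g.form x x) • x, ?_, timelike_sub_proj htt hxx⟩
  refine mem_orthIn.2 ⟨N.sub_mem ht (N.smul_mem _ hx), ?_⟩
  simp only [map_sub, map_smul, smul_eq_mul]
  rw [form_comm g x t]
  field_simp
  ring

theorem IsLorentzOn.exists_hyperbolic (h : IsLorentzOn g N) {l : V} (hl : l ∈ N) (hl0 : l ≠ 0)
    (hll : g.form l l = 0) : ∃ l' ∈ N, g.form l' l' = 0 ∧ g.form l l' = 1 := by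
  obtain ⟨t, ht, htt⟩ := h.timelike
  have htl : g.form t l ≠ 0 := fun h0 => (h.pos t ht htt l hl h0 hl0).ne' hll
  have hlt : g.form l t = g.form t l := form_comm g l t
  -- The multiple of t has product 1 with l; adding a multiple of l keeps this product and adjusts
  -- the square to zero.
  refine ⟨(g.form t l)⁻¹ • t - (g.form t t / (2 * (g.form t l) ^ 2)) • l,
    N.sub_mem (N.smul_mem _ ht) (N.smul_mem _ hl), ?_, ?_⟩
  · simp only [map_sub, map_smul, smul_eq_mul, LinearMap.sub_apply, LinearMap.smul_apply, hll, hlt]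
    field_simp
    ring
  · simp only [map_sub, map_smul, smul_eq_mul, hll, hlt]
    field_simp
    ring

variable {ι : Type*} [Fintype ι] [DecidableEq ι]

/-- The vector l - l' is timelike, of square -2, and orthogonal to everything orthogonal to both l
and l'. -/
theorem IsLorentzOn.pos_orth (h : IsLorentzOn g N) {l l' : V} (hl : l ∈ N) (hl' : l' ∈ N)
    (hll : g.form l l = 0) (hll' : g.form l' l' = 0) (hp : g.form l l' = 1) :
    ∀ x ∈ orthIn g (orthIn g N l) l', x ≠ 0 → 0 < g.form x x := by
  intro x hx
  obtain ⟨hx, hx2⟩ := mem_orthIn.1 hx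
  obtain ⟨hx, hx1⟩ := mem_orthIn.1 hx
  have hp' : g.form l' l = 1 := by rw [form_comm, hp]
  refine h.pos (l - l') (N.sub_mem hl hl') ?_ x hx ?_
  · simp [hll, hll', hp, hp']
  · simp [hx1, hx2]

/-- A hyperbolic pair and an orthonormal basis of its orthogonal complement form a null frame. -/
theorem IsOrthoFrame.isNullFrame {l l' : V} {e : ι → V}
    (he : IsOrthoFrame g (orthIn g (orthIn g N l) l') e) (hl : l ∈ N) (hl' : l' ∈ N)
    (hll : g.form l l = 0) (hll' : g.form l' l' = 0) (hp : g.form l l' = 1) :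
    IsNullFrame g N l l' e := by
  have hp' : g.form l' l = 1 := by rw [form_comm, hp]
  have hm : ∀ i, (e i ∈ N ∧ g.form l (e i) = 0) ∧ g.form l' (e i) = 0 := fun i => by
    have := he.mem i
    rwa [mem_orthIn, mem_orthIn] at this
  refine ⟨hl, hl', fun i => (hm i).1.1, hll, hll', hp, fun i => (hm i).1.2, fun i => (hm i).2,
    he.orthonormal, fun v hv => ?_⟩
  have h1 := he.expand (v - g.form v l' • l - g.form v l • l') (by
    refine mem_orthIn.2 ⟨mem_orthIn.2
      ⟨N.sub_mem (N.sub_mem hv (N.smul_mem _ hl)) (N.smul_mem _ hl'), ?_⟩, ?_⟩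
    · simp [hll, hp, form_comm g l v]
    · simp [hll', hp', form_comm g l' v])
  have h2 : ∀ i, g.form (v - g.form v l' • l - g.form v l • l') (e i) = g.form v (e i) := fun i => by
    simp [(hm i).1.2, (hm i).2]
  simp only [h2] at h1
  rw [← h1]
  abel

theorem IsLorentzOn.exists_isNullFrame [FiniteDimensional ℝ V] (h : IsLorentzOn g N) {l : V}
    (hl : l ∈ N) (hl0 : l ≠ 0) (hll : g.form l l = 0) :
    ∃ (d : ℕ) (l' : V) (e : Fin d → V), IsNullFrame g N l l' e := by
  obtain ⟨l', hl', hll', hp⟩ := h.exists_hyperbolic hl hl0 hll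
  obtain ⟨e, he⟩ := exists_isOrthoFrame (h.pos_orth hl hl' hll hll' hp)
  exact ⟨_, l', e, he.isNullFrame hl hl' hll hll' hp⟩

/-- Adding a unit vector to a null frame of its orthogonal complement. -/
theorem IsNullFrame.option {l l' s : V} {e : ι → V} (F : IsNullFrame g (orthIn g N s) l l' e)
    (hs : s ∈ N) (hss : g.form s s = 1) :
    IsNullFrame g N l l' (fun o : Option ι => o.elim s e) := by
  have hm : ∀ i, e i ∈ N ∧ g.form s (e i) = 0 := fun i => mem_orthIn.1 (F.mem_e i)
  obtain ⟨hl, hsl⟩ := mem_orthIn.1 F.mem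
  obtain ⟨hl', hsl'⟩ := mem_orthIn.1 F.mem'
  refine ⟨hl, hl', ?_, F.null, F.null', F.pair, ?_, ?_, ?_, fun v hv => ?_⟩
  · rintro (_ | i)
    exacts [hs, (hm i).1]
  · rintro (_ | i)
    · simpa [form_comm] using hsl
    · exact F.orth i
  · rintro (_ | i)
    · simpa [form_comm] using hsl'
    · exact F.orth' i
  · rintro (_ | i) (_ | j)
    · simpa using hss
    · simpa using (hm j).2
    · simpa [form_comm] using (hm i).2
    · simpa using F.orthonormal i j
  · have h1 := F.expand (v - g.form v s • s) (mem_orthIn.2 ⟨N.sub_mem hv (N.smul_mem _ hs), by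
      simp [hss, form_comm g s v]⟩)
    have h2 : ∀ w, g.form s w = 0 → g.form (v - g.form v s • s) w = g.form v w := fun w hw => by
      simp [hw]
    simp only [h2 _ hsl, h2 _ hsl', h2 _ (hm _).2] at h1
    rw [Fintype.sum_option]
    simp only [Option.elim]
    rw [sub_eq_iff_eq_add] at h1
    nth_rewrite 1 [h1]
    abel

end Lorentz

/-! ### Second type and causal eigenvectors. -/

section SecondType

variable {V : Type*} [AddCommGroup V] [Module ℝ V] {g : PseudoMetric V}

theorem exists_basis_of_isLorentzFrame {κ : Type*} [Fintype κ] [DecidableEq κ] {i₀ : κ}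
    {b : κ → V} (hb : g.IsLorentzFrame i₀ b) (hspan : ∀ v, ∃ c : κ → ℝ, v = ∑ i, c i • b i) :
    ∃ B : Basis κ ℝ V, ⇑B = b := by
  have hli : LinearIndependent ℝ b := by
    rw [Fintype.linearIndependent_iff]
    intro c hc j
    have h1 := congrArg (fun v => g.form v (b j)) hc
    simp only [map_sum, map_smul, LinearMap.sum_apply, LinearMap.smul_apply, hb _ j, map_zero,
      LinearMap.zero_apply, smul_eq_mul, mul_ite, mul_zero, Finset.sum_ite_eq', Finset.mem_univ,
      if_true] at h1
    split_ifs at h1 <;> linarith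
  refine ⟨Basis.mk hli fun v _ => ?_, Basis.coe_mk _ _⟩
  obtain ⟨c, hc⟩ := hspan v
  rw [hc]
  exact Submodule.sum_mem _ fun i _ => Submodule.smul_mem _ _ (Submodule.subset_span ⟨i, rfl⟩)

theorem toMatrix_eq_of_apply {κ : Type*} [Fintype κ] [DecidableEq κ] (B : Basis κ ℝ V)
    (T : End ℝ V) (M : Matrix κ κ ℝ) (h : ∀ j, T (B j) = ∑ i, M i j • B i) :
    LinearMap.toMatrix B B T = M := by
  ext i j
  rw [LinearMap.toMatrix_apply, h j, B.repr_sum_self]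

/-- A symmetric endomorphism of a Lorentzian vector space is of second type if it acts as a
similarity with a non-trivial rotational part on a plane. -/
theorem isSecondType_of_rotation [FiniteDimensional ℝ V] (hg : IsLorentzOn g ⊤) (S : End ℝ V)
    (hS : ∀ x y, g.form (S x) y = g.form x (S y)) {v w : V} {r δ : ℝ} (hv : v ≠ 0) (hδ : 0 < δ)
    (hSv : S v = r • v + δ • w) (hSw : S w = r • w - δ • v) : IsSecondType g S := by
  -- The plane cannot be totally null: y = cx would give δ(c² + 1)x = 0.
  have hne : ∀ x y : V, S x = r • x + δ • y → S y = r • y - δ • x → x ≠ 0 → g.form x x = 0 →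
      g.form y y = 0 → g.form x y = 0 → False := by
    intro x y h1 h2 hx hxx hyy hxy
    obtain ⟨c, rfl⟩ := hg.eq_smul_of_null (x := x) (y := y) trivial trivial hx hxx hyy hxy
    rw [map_smul, h1] at h2
    have h3 : (δ * (c ^ 2 + 1)) • x = 0 := by
      rw [← sub_eq_zero] at h2
      rw [← h2]
      module
    rcases smul_eq_zero.1 h3 with h4 | h4
    · nlinarith [mul_nonneg hδ.le (sq_nonneg c)]
    · exact hx h4
  -- Comparing g(Sx,y) with g(x,Sy) gives δ(g(x,x) + g(y,y)) = 0.
  have hneg : ∀ x y : V, S x = r • x + δ • y → S y = r • y - δ • x →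
      g.form y y = -g.form x x := fun x y h1 h2 => by
    have h3 := hS x y
    rw [h1, h2] at h3
    simp only [map_add, map_sub, map_smul, LinearMap.add_apply, LinearMap.smul_apply,
      smul_eq_mul] at h3
    have h4 : δ * (g.form y y + g.form x x) = 0 := by linarith
    have := (mul_eq_zero.1 h4).resolve_left hδ.ne'
    linarith
  have hcomb : ∀ p q : ℝ, S (p • v + q • w) = r • (p • v + q • w) + δ • (p • w - q • v) ∧
      S (p • w - q • v) = r • (p • w - q • v) - δ • (p • v + q • w) := fun p q => by
    simp only [map_add, map_sub, map_smul, hSv, hSw]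
    constructor <;> module
  -- an orthogonal pair in the plane
  obtain ⟨x, y, h1, h2, hx, hxy⟩ : ∃ x y : V, S x = r • x + δ • y ∧ S y = r • y - δ • x ∧ x ≠ 0 ∧
      g.form x y = 0 := by
    have hww := hneg v w hSv hSw
    have hwv : g.form w v = g.form v w := form_comm g w v
    set A := g.form v v with hA
    set m := g.form v w with hm
    have horth : ∀ p q : ℝ, g.form (p • v + q • w) (p • w - q • v)
        = (p ^ 2 - q ^ 2) * m - 2 * p * q * A := fun p q => by
      simp only [map_add, map_sub, map_smul, LinearMap.add_apply, LinearMap.smul_apply,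
        smul_eq_mul, hwv, hww, ← hA, ← hm]
      ring
    obtain ⟨p, q, hpq, h0⟩ : ∃ p q : ℝ, p ^ 2 + q ^ 2 ≠ 0 ∧
        (p ^ 2 - q ^ 2) * m - 2 * p * q * A = 0 := by
      by_cases hm0 : m = 0
      · exact ⟨1, 0, by norm_num, by rw [hm0]; ring⟩
      -- For q = m the condition becomes p² - 2pA - m² = 0, and this is its larger root.
      · refine ⟨√(A ^ 2 + m ^ 2) + A, m, ?_, ?_⟩
        · have : 0 < m ^ 2 := by positivity
          positivity
        · have h3 := Real.sq_sqrt (show 0 ≤ A ^ 2 + m ^ 2 by positivity)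
          linear_combination m * h3
    refine ⟨p • v + q • w, p • w - q • v, (hcomb p q).1, (hcomb p q).2, fun h3 => ?_,
      by rw [horth, h0]⟩
    have h4 := (hcomb p q).1
    rw [h3, map_zero, smul_zero, zero_add] at h4
    have h5 := (smul_eq_zero.1 h4.symm).resolve_left hδ.ne'
    have h6 : (p ^ 2 + q ^ 2) • v = 0 := by
      have : (p ^ 2 + q ^ 2) • v = p • (p • v + q • w) - q • (p • w - q • v) := by module
      rw [this, h3, h5, smul_zero, smul_zero, sub_zero]
    exact hv ((smul_eq_zero.1 h6).resolve_left hpq)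
  -- The squares of x and y are opposite and not zero. If x is spacelike, the pair (y, -x) satisfies
  -- the same relations with a timelike first vector.
  obtain ⟨x, y, h1, h2, hxx, hxy⟩ : ∃ x y : V, S x = r • x + δ • y ∧ S y = r • y - δ • x ∧
      g.form x x < 0 ∧ g.form x y = 0 := by
    have hyy := hneg x y h1 h2
    rcases lt_trichotomy (g.form x x) 0 with h | h | h
    · exact ⟨x, y, h1, h2, h, hxy⟩
    · exact (hne x y h1 h2 hx h (by rw [hyy, h, neg_zero]) hxy).elim
    · refine ⟨y, -x, ?_, ?_, by linarith, ?_⟩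
      · rw [h2, smul_neg, sub_eq_add_neg]
      · rw [map_neg, h1]; module
      · rw [map_neg, form_comm, hxy, neg_zero]
  have hyy := hneg x y h1 h2
  set t := (√(-g.form x x))⁻¹ with ht
  have htt : t * t * g.form x x = -1 := by
    have h3 := Real.mul_self_sqrt (show 0 ≤ -g.form x x by linarith)
    have h4 : √(-g.form x x) ≠ 0 := (Real.sqrt_pos.2 (by linarith)).ne'
    rw [ht]
    field_simp
    linarith
  -- the orthogonal complement of the plane
  set W := orthIn g (orthIn g ⊤ x) y with hW
  have hWm : ∀ z, z ∈ W ↔ g.form x z = 0 ∧ g.form y z = 0 := fun z => by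
    rw [hW, mem_orthIn, mem_orthIn]; simp
  have hWpos : ∀ z ∈ W, z ≠ 0 → 0 < g.form z z := fun z hz =>
    hg.pos x trivial hxx z trivial ((hWm z).1 hz).1
  have hWS : ∀ z ∈ W, S z ∈ W := fun z hz => by
    obtain ⟨h3, h4⟩ := (hWm z).1 hz
    rw [hWm, ← hS, ← hS, h1, h2]
    simp [h3, h4]
  obtain ⟨e, he⟩ := exists_isOrthoFrame hWpos
  set T : EuclideanSpace ℝ (Fin (finrank ℝ W)) →ₗ[ℝ] EuclideanSpace ℝ (Fin (finrank ℝ W)) :=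
    frameCoord g e ∘ₗ S ∘ₗ frameMap e with hT
  have hTs : T.IsSymmetric := fun a b => by
    rw [hT, real_inner_comm]
    simp only [LinearMap.comp_apply]
    rw [real_inner_comm, inner_frameCoord, real_inner_comm, inner_frameCoord, hS,
      form_comm]
  set u := hTs.eigenvectorBasis (finrank_euclideanSpace_fin) with hu
  set μ := hTs.eigenvalues (finrank_euclideanSpace_fin) with hμ
  have hu' := he.of_orthonormalBasis u
  have hSu : ∀ i, S (frameMap e (u i)) = μ i • frameMap e (u i) := fun i => by
    have h3 : T (u i) = μ i • u i := hTs.apply_eigenvectorBasis _ i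
    rw [← he.frameMap_frameCoord (hWS _ (hu'.mem i)), ← map_smul, ← h3]
    rfl
  have hu0 : ∀ i, g.form x (frameMap e (u i)) = 0 ∧ g.form y (frameMap e (u i)) = 0 := fun i =>
    (hWm _).1 (hu'.mem i)
  have hyx : g.form y x = 0 := by rw [form_comm, hxy]
  have hF : g.IsLorentzFrame (Sum.inl 0)
      (Sum.elim ![t • x, t • y] (fun i => frameMap e (u i)) : Fin 2 ⊕ Fin (finrank ℝ W) → V) := by
    rintro (i | i) (j | j)
    · fin_cases i <;> fin_cases j <;> simp [hxy, hyx, hyy, ← mul_assoc, htt]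
    · fin_cases i <;> simp [hu0]
    · fin_cases j <;> simp [form_comm g _ x, form_comm g _ y, hu0]
    · simpa using hu'.orthonormal i j
  obtain ⟨B, hB⟩ := exists_basis_of_isLorentzFrame hF (fun z => by
    have h3 := hu'.expand (z + (t * t * g.form x z) • x - (t * t * g.form y z) • y) (by
      rw [hWm]
      simp only [map_add, map_sub, map_smul, smul_eq_mul, hxy, hyx, hyy]
      constructor <;> linear_combination g.form _ z * htt)
    refine ⟨Sum.elim ![-(t * g.form x z), t * g.form y z] (fun i =>
      g.form (z + (t * t * g.form x z) • x - (t * t * g.form y z) • y) (frameMap e (u i))), ?_⟩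
    rw [Fintype.sum_sum_type, Fin.sum_univ_two]
    simp only [Sum.elim_inl, Sum.elim_inr, Matrix.cons_val_zero, Matrix.cons_val_one]
    rw [← h3]
    module)
  refine ⟨_, B, r, δ, μ, by rw [hB]; exact hF, hδ, toMatrix_eq_of_apply B S _ fun j => ?_⟩
  rw [hB, Fintype.sum_sum_type, Fin.sum_univ_two]
  rcases j with j | j
  · fin_cases j
    · simp [L₁, h1]; module
    · simp [L₁, h2]; module
  · simp [hSu, Matrix.diagonal_apply]

/-- A symmetric endomorphism of a Lorentzian vector space which is not of second type has a
causal eigenvector. -/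
theorem exists_causal_eigenvector [FiniteDimensional ℝ V] (hg : IsLorentzOn g ⊤) (S : End ℝ V)
    (hS : ∀ x y, g.form (S x) y = g.form x (S y)) (h2 : ¬ IsSecondType g S) :
    ∃ x ≠ 0, g.form x x ≤ 0 ∧ ∃ r : ℝ, S x = r • x := by
  -- Take a minimal S-invariant subspace containing a timelike vector. It contains an eigenvector or
  -- a rotated plane, and the latter is excluded by the assumption on the type.
  let P : Set (Submodule ℝ V) := {Z | (∀ z ∈ Z, S z ∈ Z) ∧ ∃ t ∈ Z, g.form t t < 0}
  obtain ⟨Z, ⟨hZS, t, htZ, htt⟩, hmin⟩ := (wellFounded_lt (α := Submodule ℝ V)).has_min P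
    ⟨⊤, fun _ _ => trivial, hg.timelike⟩
  have ht0 : t ≠ 0 := fun h => by rw [h] at htt; simp at htt
  have : Nontrivial Z := ⟨⟨t, htZ⟩, 0, fun h => ht0 (congrArg Subtype.val h)⟩
  rcases exists_eigenvector_or_rotation (S.restrict hZS) with ⟨x, hx, r, hr⟩ |
    ⟨v, w, r, δ, hv, hδ, hv1, hw1⟩
  · have hx0 : (x : V) ≠ 0 := fun h => hx (Subtype.ext h)
    have hr' : S x = r • (x : V) := congrArg Subtype.val hr
    refine ⟨x, hx0, ?_, r, hr'⟩
    by_contra! hxx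
    -- For a spacelike eigenvector x, the complement of x in Z is invariant, still contains a
    -- timelike vector and is strictly smaller.
    refine hmin (orthIn g Z x) ⟨fun z hz => ?_, t - (g.form t x / g.form x x) • (x : V), ?_,
      timelike_sub_proj htt hxx⟩ ?_
    · obtain ⟨h3, h4⟩ := mem_orthIn.1 hz
      refine mem_orthIn.2 ⟨hZS z h3, ?_⟩
      rw [← hS, hr', map_smul, LinearMap.smul_apply, h4, smul_zero]
    · refine mem_orthIn.2 ⟨Z.sub_mem htZ (Z.smul_mem _ x.2), ?_⟩
      simp only [map_sub, map_smul, smul_eq_mul]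
      rw [form_comm g x t]
      field_simp
      ring
    · refine lt_of_le_of_ne inf_le_left fun h => ?_
      have h3 : (x : V) ∈ orthIn g Z x := by rw [h]; exact x.2
      exact hxx.ne' (mem_orthIn.1 h3).2
  · exact (h2 (isSecondType_of_rotation hg S hS (v := v) (w := w) (fun h => hv (Subtype.ext h)) hδ
      (congrArg Subtype.val hv1) (congrArg Subtype.val hw1))).elim

end SecondType

/-! ### Existence of a null eigenvector in the ideal. -/

section Setup

variable {𝔤 : Type*} [LieRing 𝔤] [LieAlgebra ℝ 𝔤] {g : PseudoMetric 𝔤}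
  {H : 𝔤 [⋀^Fin 3]→ₗ[ℝ] ℝ} {N : Submodule ℝ 𝔤} {X : 𝔤} {ε : ℝ}

/-- The ideal lies in the kernel of g(X,·), which is a hyperplane because X is not null; equality
follows by dimension. -/
theorem isAlmostAbelian_of_finrank [FiniteDimensional ℝ 𝔤] (𝔫 : LieIdeal ℝ 𝔤)
    (hab : IsLieAbelian 𝔫) (hcodim : finrank ℝ 𝔫 + 1 = finrank ℝ 𝔤)
    (hX : ∀ y ∈ 𝔫, g.form X y = 0) (hXX : g.form X X = ε) (hε : ε * ε = 1) :
    IsAlmostAbelian g 𝔫.toSubmodule X ε where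
  norm := hXX
  sq := hε
  orth := hX
  abel y hy z hz := congrArg Subtype.val
    (hab.trivial (⟨y, hy⟩ : 𝔫) (⟨z, hz⟩ : 𝔫))
  ideal y hy := lie_mem_right ℝ 𝔤 𝔫 X y hy
  split v := by
    have h0 : g.form X ≠ 0 := fun h => by
      rw [h, LinearMap.zero_apply] at hXX
      rw [← hXX, mul_zero] at hε
      exact zero_ne_one hε
    have h1 := Module.Dual.finrank_ker_add_one_of_ne_zero h0
    have h2 : 𝔫.toSubmodule = LinearMap.ker (g.form X) := by
      refine Submodule.eq_of_le_of_finrank_eq (fun y hy => hX y hy) ?_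
      have h3 : finrank ℝ 𝔫.toSubmodule = finrank ℝ 𝔫 := rfl
      omega
    rw [h2, LinearMap.mem_ker, map_sub, map_smul, hXX, form_comm g X v, smul_eq_mul]
    linear_combination -g.form v X * hε

theorem IsDualFrame.apply_eq_zero {κ : Type*} [Fintype κ] {b b' : κ → 𝔤}
    (hb : IsDualFrame g N b b') {u : Dual ℝ 𝔤} (hu : ∀ a, u (b a) = 0) : ∀ y ∈ N, u y = 0 :=
  fun y hy => by
    rw [hb.expand y hy]; simp [hu]

theorem IsDualFrame.apply₂_eq_zero {κ : Type*} [Fintype κ] {b b' : κ → 𝔤}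
    (hb : IsDualFrame g N b b') {u : LinearMap.BilinForm ℝ 𝔤} (hu : ∀ a c, u (b a) (b c) = 0) :
    ∀ y ∈ N, ∀ z ∈ N, u y z = 0 := fun y hy z hz =>
  hb.apply_eq_zero (fun c => hb.apply_eq_zero (u := u.flip (b c)) (fun a => hu a c) y hy) z hz

theorem IsDualFrame.contract_eq_zero {κ : Type*} [Fintype κ] {b b' : κ → 𝔤}
    (hb : IsDualFrame g N b b') (hu : ∀ a c d, contract H (b a) (b c) (b d) = 0) :
    ∀ x ∈ N, ∀ y ∈ N, ∀ z ∈ N, contract H x y z = 0 := fun x hx y hy z hz => by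
  have h1 : ∀ a, contract H (b a) y z = 0 := fun a => hb.apply₂_eq_zero (hu a) y hy z hz
  rw [hb.expand x hx]
  simp only [map_sum, map_smul, LinearMap.sum_apply, LinearMap.smul_apply, h1, smul_zero,
    Finset.sum_const_zero]

namespace IsAlmostAbelian

/-- A three-form vanishes if its restrictions to `N` and to `X ∧ N ∧ N` vanish. -/
theorem threeForm_eq_zero (h : IsAlmostAbelian g N X ε)
    (h1 : ∀ y ∈ N, ∀ z ∈ N, contract H X y z = 0)
    (h2 : ∀ x ∈ N, ∀ y ∈ N, ∀ z ∈ N, contract H x y z = 0) : H = 0 := by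
  have h3 : ∀ x y z, contract H x y z = 0 := fun x y z => by
    obtain ⟨x', hx, a, rfl⟩ : ∃ x' ∈ N, ∃ a : ℝ, x = x' + a • X := ⟨_, h.split x, _, by abel⟩
    obtain ⟨y', hy, b, rfl⟩ : ∃ y' ∈ N, ∃ a : ℝ, y = y' + a • X := ⟨_, h.split y, _, by abel⟩
    obtain ⟨z', hz, c, rfl⟩ : ∃ z' ∈ N, ∃ a : ℝ, z = z' + a • X := ⟨_, h.split z, _, by abel⟩
    have h4 : contract H x' X z' = 0 := by rw [contract_swap₁₂, h1 x' hx z' hz, neg_zero]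
    have h5 : contract H x' y' X = 0 := by
      rw [contract_swap₂₃, contract_swap₁₂, h1 x' hx y' hy]; simp
    simp only [map_add, map_smul, LinearMap.add_apply, LinearMap.smul_apply,
      h2 x' hx y' hy z' hz, h1 y' hy z' hz, h4, h5, contract_self₁₂, contract_self₂₃]
    have h6 : contract H X y' X = 0 := by rw [contract_swap₂₃, contract_self₁₂, neg_zero]
    simp [h6]
  refine AlternatingMap.ext fun v => ?_
  have h4 : v = ![v 0, v 1, v 2] := by
    ext i; fin_cases i <;> rfl
  rw [h4, ← contract_apply, h3, AlternatingMap.zero_apply]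

/-- If the ideal is positive definite, the form `H` vanishes. -/
theorem threeForm_eq_zero_of_euclidean (h : IsAlmostAbelian g N X (-1)) {ι : Type*} [Fintype ι]
    [DecidableEq ι] {e : ι → 𝔤} (he : IsOrthoFrame g N e)
    (E : EinsteinEqs g N X (-1) H e e) : H = 0 := by
  have h1 := E.scalar
  simp only [contr₂] at h1
  have h2 : ∀ u : LinearMap.BilinForm ℝ 𝔤, 0 ≤ ∑ a, ∑ c, u (e a) (e c) * u (e a) (e c) :=
    fun u => Finset.sum_nonneg fun _ _ => Finset.sum_nonneg fun _ _ => mul_self_nonneg _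
  have h3 : ∀ u : LinearMap.BilinForm ℝ 𝔤, ∑ a, ∑ c, u (e a) (e c) * u (e a) (e c) = 0 →
      ∀ a c, u (e a) (e c) = 0 := fun u hu a c => by
    rw [Finset.sum_eq_zero_iff_of_nonneg
      fun _ _ => Finset.sum_nonneg fun _ _ => mul_self_nonneg _] at hu
    have := hu a (Finset.mem_univ a)
    rw [Finset.sum_eq_zero_iff_of_nonneg fun _ _ => mul_self_nonneg _] at this
    exact mul_self_eq_zero.1 (this c (Finset.mem_univ c))
  have hs := h3 _ (by linarith [h2 (symForm g X), h2 (contract H X)] :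
    ∑ a, ∑ c, symForm g X (e a) (e c) * symForm g X (e a) (e c) = 0)
  have hω := h3 _ (by linarith [h2 (symForm g X), h2 (contract H X)] :
    ∑ a, ∑ c, contract H X (e a) (e c) * contract H X (e a) (e c) = 0)
  -- Once S and H(X,·,·) vanish, the (eᵢ,eᵢ) equation is the squared norm of H(eᵢ,·,·).
  have hh : ∀ i a c, contract H (e i) (e a) (e c) = 0 := fun i => h3 _ (by
    have h4 := E.symm (e i) (he.mem i) (e i) (he.mem i)
    simpa [symRicci, contr₁, contr₂, hs, hω] using h4)
  have hD : IsDualFrame g N e e := ⟨he.mem, he.mem, he.expand⟩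
  exact h.threeForm_eq_zero (hD.apply₂_eq_zero hω) (hD.contract_eq_zero hh)

theorem isDualFrame_timelike {ι : Type*} [Fintype ι] [DecidableEq ι] {e : ι → 𝔤} {t : 𝔤}
    (ht : t ∈ N) (htt : g.form t t = -1) (he : IsOrthoFrame g (orthIn g N t) e) :
    IsDualFrame g N (fun o : Option ι => o.elim t e) (fun o : Option ι => o.elim (-t) e) where
  mem := by
    rintro (_ | i)
    exacts [ht, (mem_orthIn.1 (he.mem i)).1]
  mem' := by
    rintro (_ | i)
    exacts [N.neg_mem ht, (mem_orthIn.1 (he.mem i)).1]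
  expand v hv := by
    have h1 := he.expand (v + g.form v t • t) (mem_orthIn.2
      ⟨N.add_mem hv (N.smul_mem _ ht), by simp [htt, form_comm g t v]⟩)
    have h2 : ∀ i, g.form (v + g.form v t • t) (e i) = g.form v (e i) := fun i => by
      simp [(mem_orthIn.1 (he.mem i)).2]
    simp only [h2] at h1
    simp only [Fintype.sum_option, Option.elim, ← h1]
    simp

/-- If the symmetric part has a timelike eigenvector, the form `H` vanishes. -/
theorem threeForm_eq_zero_of_timelike (h : IsAlmostAbelian g N X 1) {ι : Type*} [Fintype ι]
    [DecidableEq ι] {e : ι → 𝔤} {t : 𝔤} (ht : t ∈ N) (htt : g.form t t = -1)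
    (he : IsOrthoFrame g (orthIn g N t) e) {L : ℝ} (hL : ∀ z ∈ N, symForm g X t z = L * g.form t z)
    (E : EinsteinEqs g N X 1 H (fun o : Option ι => o.elim t e)
      (fun o : Option ι => o.elim (-t) e)) : H = 0 := by
  have hm : ∀ i, e i ∈ N := fun i => (mem_orthIn.1 (he.mem i)).1
  have hD := isDualFrame_timelike ht htt he
  have h2 : ∀ u : LinearMap.BilinForm ℝ 𝔤, 0 ≤ ∑ a, ∑ c, u (e a) (e c) * u (e a) (e c) :=
    fun u => Finset.sum_nonneg fun _ _ => Finset.sum_nonneg fun _ _ => mul_self_nonneg _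
  have h1' : ∀ u : Dual ℝ 𝔤, ∑ a, u (e a) * u (e a) = 0 → ∀ a, u (e a) = 0 := fun u hu a => by
    rw [Finset.sum_eq_zero_iff_of_nonneg fun _ _ => mul_self_nonneg _] at hu
    exact mul_self_eq_zero.1 (hu a (Finset.mem_univ a))
  have h3 : ∀ u : LinearMap.BilinForm ℝ 𝔤, ∑ a, ∑ c, u (e a) (e c) * u (e a) (e c) = 0 →
      ∀ a c, u (e a) (e c) = 0 := fun u hu a => by
    rw [Finset.sum_eq_zero_iff_of_nonneg
      fun _ _ => Finset.sum_nonneg fun _ _ => mul_self_nonneg _] at hu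
    exact h1' _ (hu a (Finset.mem_univ a))
  have hst : ∀ i, symForm g X t (e i) = 0 := fun i => by
    rw [hL _ (hm i), (mem_orthIn.1 (he.mem i)).2, mul_zero]
  have hst' : ∀ i, symForm g X (e i) t = 0 := fun i => by rw [symForm_comm, hst]
  have hωtt : contract H X t t = 0 := contract_self₂₃ _ _
  -- The eigenvector condition removes the products of S and A, and skewness of H removes the
  -- entries with repeated t, so the (t,t) equation is positive definite in H. After that the scalar
  -- equation is definite as well.
  have e1 := E.symm t ht t ht
  have e2 : ∀ a, contract H t a t = 0 := fun a => by
    rw [contract_swap₂₃, contract_self₁₂, neg_zero]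
  simp only [symRicci, contr₁, contr₂, Fintype.sum_option, Option.elim, hst, hωtt,
    skewForm_self, contract_self₁₂, map_neg, e2] at e1
  have e3 : 2 * ∑ i, contract H X t (e i) * contract H X t (e i)
      + ∑ i, ∑ j, contract H t (e i) (e j) * contract H t (e i) (e j) = 0 := by
    simpa using e1
  have p1 := h2 (contract H t)
  have p2 : 0 ≤ ∑ i, contract H X t (e i) * contract H X t (e i) :=
    Finset.sum_nonneg fun _ _ => mul_self_nonneg _
  have hωt := h1' _ (by linarith : ∑ i, contract H X t (e i) * contract H X t (e i) = 0)
  have hht := h3 (contract H t)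
    (by linarith : ∑ i, ∑ j, contract H t (e i) (e j) * contract H t (e i) (e j) = 0)
  have hωt' : ∀ i, contract H X (e i) t = 0 := fun i => by rw [contract_swap₂₃, hωt, neg_zero]
  have e4 := E.scalar
  simp only [contr₂, Fintype.sum_option, Option.elim, hst, hst', hωtt, hωt, hωt', map_neg,
    LinearMap.neg_apply] at e4
  have e5 : symForm g X t t * symForm g X t t
      + ∑ i, ∑ j, symForm g X (e i) (e j) * symForm g X (e i) (e j)
      + ∑ i, ∑ j, contract H X (e i) (e j) * contract H X (e i) (e j) = 0 := by
    simpa using e4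
  have q1 := h2 (symForm g X)
  have q2 := h2 (contract H X)
  have q3 := mul_self_nonneg (symForm g X t t)
  have hs := h3 (symForm g X) (by linarith)
  have hω := h3 (contract H X) (by linarith)
  have f1 : ∀ i j, contract H (e i) t (e j) = 0 := fun i j => by
    rw [contract_swap₁₂, hht, neg_zero]
  have f2 : ∀ i j, contract H (e i) (e j) t = 0 := fun i j => by
    rw [contract_swap₂₃, f1, neg_zero]
  have hh : ∀ i a c, contract H (e i) (e a) (e c) = 0 := fun i => h3 _ (by
    have h4 := E.symm (e i) (hm i) (e i) (hm i)
    simpa [symRicci, contr₁, contr₂, Fintype.sum_option, hs, hω, hst', hωt', f1, f2,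
      contract_self₂₃] using h4)
  refine h.threeForm_eq_zero (hD.apply₂_eq_zero ?_) (hD.contract_eq_zero ?_)
  · rintro (_ | i) (_ | j)
    exacts [hωtt, hωt j, hωt' i, hω i j]
  · rintro (_ | i) (_ | j) (_ | m)
    exacts [contract_self₁₂ _ _, contract_self₁₂ _ _, e2 _, hht j m, contract_self₂₃ _ _, f1 i m,
      f2 i j, hh i j m]

end IsAlmostAbelian

/-- A vector of the ideal which is an eigenvector of the symmetric part of the adjoint action. -/
theorem exists_causal_symForm_eigenvector [FiniteDimensional ℝ 𝔤] (hN : IsLorentzOn g N)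
    (hnondeg : (g.form.restrict N).Nondegenerate) (f : End ℝ N)
    (hf : ∀ y : N, (f y : 𝔤) = ⁅X, (y : 𝔤)⁆)
    (hS : ¬ IsSecondType (g.restrict N hnondeg) ((g.restrict N hnondeg).symmPart f)) :
    ∃ x ∈ N, x ≠ 0 ∧ g.form x x ≤ 0 ∧ ∃ L : ℝ, ∀ z ∈ N, symForm g X x z = L * g.form x z := by
  set G := g.restrict N hnondeg with hG
  have hGf : ∀ x y : N, G.form x y = g.form (x : 𝔤) (y : 𝔤) := fun _ _ => rfl
  have hGL : IsLorentzOn G ⊤ := by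
    obtain ⟨t, ht, htt⟩ := hN.timelike
    refine ⟨⟨⟨t, ht⟩, trivial, htt⟩, fun x _ hx y _ hxy hy => ?_⟩
    exact hN.pos x x.2 hx y y.2 hxy fun h => hy (Subtype.ext h)
  have hadj : ∀ x y : N, G.form (G.adjoint f x) y = G.form x (f y) := fun x y =>
    LinearMap.BilinForm.isAdjointPairLeftAdjointOfNondegenerate _ G.nondegenerate f x y
  have hsym : ∀ x y : N, 2 * G.form (G.symmPart f x) y = symForm g X x y := fun x y => by
    have h1 : G.symmPart f x = (1 / 2 : ℝ) • (f x + G.adjoint f x) := rfl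
    rw [h1, map_smul, map_add, LinearMap.smul_apply, LinearMap.add_apply, hadj, hGf, hGf,
      symForm_apply, hf, hf, form_comm g x, smul_eq_mul]
    ring
  obtain ⟨x, hx0, hxx, r, hr⟩ := exists_causal_eigenvector hGL (G.symmPart f) (fun x y => by
    have h1 := hsym x y
    have h2 := hsym y x
    rw [symForm_comm] at h2
    rw [form_comm G x]
    linarith) hS
  refine ⟨x, x.2, fun h => hx0 (Subtype.ext h), hxx, 2 * r, fun z hz => ?_⟩
  rw [← hsym x ⟨z, hz⟩, hr, map_smul, LinearMap.smul_apply, hGf, smul_eq_mul]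
  ring

/-- The ideal of a generalised Einstein Lie algebra with `H ≠ 0` is Lorentzian, and the symmetric
part of the adjoint action has a null eigenvector. -/
theorem IsAlmostAbelian.exists_null_eigenvector [FiniteDimensional ℝ 𝔤] (hg : g.IsLorentzian)
    (hX : g.form X X = 1 ∨ g.form X X = -1) (h : IsAlmostAbelian g N X (g.form X X)) (hH0 : H ≠ 0)
    (hE : IsGeneralisedEinstein g H 0)
    (hnondeg : (g.form.restrict N).Nondegenerate) (f : End ℝ N)
    (hf : ∀ y : N, (f y : 𝔤) = ⁅X, (y : 𝔤)⁆)
    (hS : ¬ IsSecondType (g.restrict N hnondeg) ((g.restrict N hnondeg).symmPart f)) :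
    g.form X X = 1 ∧ IsLorentzOn g N ∧ ∃ l ∈ N, l ≠ 0 ∧ g.form l l = 0 ∧
      ∃ L : ℝ, ∀ z ∈ N, symForm g X l z = L * g.form l z := by
  have hL := isLorentzOn_top hg
  -- A timelike X has a positive definite orthogonal complement, and then H would be zero.
  have hX1 : g.form X X = 1 := by
    refine hX.resolve_right fun hX' => ?_
    rw [hX'] at h
    obtain ⟨e, he⟩ := exists_isOrthoFrame (g := g) (W := N) fun y hy hy0 =>
      hL.pos X trivial (by rw [hX']; norm_num) y trivial (h.orth y hy) hy0
    exact hH0 (h.threeForm_eq_zero_of_euclidean he (h.einsteinEqs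
      (b := e) (b' := e) ⟨he.mem, he.mem, he.expand⟩ hE))
  rw [hX1] at h
  have hN : IsLorentzOn g N := by
    have h1 := hL.orthIn_of_pos (x := X) trivial (by rw [hX1]; exact one_pos)
    have h2 : orthIn g ⊤ X = N := by
      ext y
      rw [mem_orthIn]
      refine ⟨fun hy => ?_, fun hy => ⟨trivial, h.orth y hy⟩⟩
      have := h.split y
      rwa [form_comm, hy.2, mul_zero, zero_smul, sub_zero] at this
    rwa [h2] at h1
  refine ⟨hX1, hN, ?_⟩
  obtain ⟨x, hx, hx0, hxx, L, hxL⟩ := exists_causal_symForm_eigenvector hN hnondeg f hf hS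
  rcases hxx.lt_or_eq with hxx | hxx
  swap
  · exact ⟨x, hx, hx0, hxx, L, hxL⟩
  -- A timelike eigenvector, normalised to square -1, would also give H = 0.
  exfalso
  set r := (√(-g.form x x))⁻¹ with hr
  have hrr : g.form (r • x) (r • x) = -1 := by
    have h3 := Real.mul_self_sqrt (show 0 ≤ -g.form x x by linarith)
    have h4 : √(-g.form x x) ≠ 0 := (Real.sqrt_pos.2 (by linarith)).ne'
    simp only [map_smul, LinearMap.smul_apply, smul_eq_mul]
    rw [hr]
    field_simp
    linarith
  have hrx : r • x ∈ N := N.smul_mem _ hx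
  obtain ⟨e, he⟩ := exists_isOrthoFrame (g := g) (W := orthIn g N (r • x)) fun y hy hy0 =>
    hN.pos _ hrx (by rw [hrr]; norm_num) y (mem_orthIn.1 hy).1 (mem_orthIn.1 hy).2 hy0
  refine hH0 (h.threeForm_eq_zero_of_timelike hrx hrr he (L := L) (fun z hz => ?_)
    (h.einsteinEqs (IsAlmostAbelian.isDualFrame_timelike hrx hrr he) hE))
  rw [map_smul, LinearMap.smul_apply, hxL z hz, map_smul, LinearMap.smul_apply, smul_eq_mul,
    smul_eq_mul]
  ring

end Setup

/-- The matrix `diag(L₁(0, c₁), …, L₁(0, c_k), 0, …, 0)`. -/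
def rotationMatrix (k m : ℕ) (c : Fin k → ℝ) :
    Matrix ((Fin 2 × Fin k) ⊕ Fin m) ((Fin 2 × Fin k) ⊕ Fin m) ℝ :=
  Matrix.fromBlocks (Matrix.blockDiagonal fun i => L₁ 0 (c i)) 0 0 0

/-! ### Null frames adapted to the adjoint action. -/

section Adapted

variable {𝔤 : Type*} [LieRing 𝔤] [LieAlgebra ℝ 𝔤] {g : PseudoMetric 𝔤}
  {H : 𝔤 [⋀^Fin 3]→ₗ[ℝ] ℝ} {N : Submodule ℝ 𝔤} {X : 𝔤}

/-- The listed values are all independent components of H in the basis (X, l, l', e), up to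
permutation of the arguments. -/
theorem IsNullFrame.threeForm_eq_zero {ι : Type*} [Fintype ι] [DecidableEq ι] {l l' : 𝔤}
    {e : ι → 𝔤} (F : IsNullFrame g N l l' e) (h : IsAlmostAbelian g N X 1)
    (h1 : ∀ z ∈ N, contract H X l z = 0) (h2 : ∀ y ∈ N, ∀ z ∈ N, contract H l y z = 0)
    (h3 : ∀ i j, contract H X (e i) (e j) = 0) (h4 : ∀ i, contract H X l' (e i) = 0)
    (h5 : ∀ i j, contract H l' (e i) (e j) = 0)
    (h6 : ∀ i j m, contract H (e i) (e j) (e m) = 0) : H = 0 := by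
  have h1' : ∀ y ∈ N, contract H X y l = 0 := fun y hy => by
    rw [contract_swap₂₃, h1 y hy, neg_zero]
  have h4' : ∀ i, contract H X (e i) l' = 0 := fun i => by rw [contract_swap₂₃, h4, neg_zero]
  have hl : ∀ y ∈ N, ∀ z ∈ N, contract H y l z = 0 := fun y hy z hz => by
    rw [contract_swap₁₂, h2 y hy z hz, neg_zero]
  have hl' : ∀ y ∈ N, ∀ z ∈ N, contract H y z l = 0 := fun y hy z hz => by
    rw [contract_swap₂₃, hl y hy z hz, neg_zero]
  have hb : ∀ a, nullFamily l l' e a ∈ N := F.isDualFrame.mem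
  have hl'N : ∀ y ∈ N, ∀ z ∈ N, contract H l' y z = 0 := F.isDualFrame.apply₂_eq_zero (by
    rintro (a | i) (c | j)
    · fin_cases a
      · exact hl _ F.mem' _ (hb _)
      · exact contract_self₁₂ _ _
    · fin_cases a
      · exact hl _ F.mem' _ (hb _)
      · exact contract_self₁₂ _ _
    · fin_cases c
      · exact hl' _ F.mem' _ (hb _)
      · show contract H l' (e i) l' = 0
        rw [contract_swap₂₃, contract_self₁₂, neg_zero]
    · exact h5 i j)
  refine h.threeForm_eq_zero (F.isDualFrame.apply₂_eq_zero ?_) fun x hx y hy z hz => ?_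
  · rintro (a | i) (c | j)
    · fin_cases a
      · exact h1 _ (hb _)
      · fin_cases c
        · exact h1' _ (hb _)
        · exact contract_self₂₃ _ _
    · fin_cases a
      · exact h1 _ (hb _)
      · exact h4 j
    · fin_cases c
      · exact h1' _ (hb _)
      · exact h4' i
    · exact h3 i j
  · have heN : ∀ i, contract H (e i) y z = 0 := fun i => by
      refine F.isDualFrame.apply₂_eq_zero (u := contract H (e i)) ?_ y hy z hz
      rintro (a | i') (c | j)
      · fin_cases a
        · exact hl _ (F.mem_e i) _ (hb _)
        · exact (contract_swap₁₂ _ _ _).trans (neg_eq_zero.2 (hl'N _ (F.mem_e i) _ (hb _)))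
      · fin_cases a
        · exact hl _ (F.mem_e i) _ (hb _)
        · exact (contract_swap₁₂ _ _ _).trans (neg_eq_zero.2 (hl'N _ (F.mem_e i) _ (hb _)))
      · fin_cases c
        · exact hl' _ (F.mem_e i) _ (hb _)
        · show contract H (e i) (e i') l' = 0
          rw [contract_swap₂₃, contract_swap₁₂, hl'N _ (F.mem_e i) _ (F.mem_e i')]
          simp
      · exact h6 i i' j
    rw [F.expand x hx]
    simp only [map_add, map_sum, map_smul, LinearMap.add_apply, LinearMap.sum_apply,
      LinearMap.smul_apply, heN, hl'N y hy z hz, h2 y hy z hz]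
    simp

variable [FiniteDimensional ℝ 𝔤]

/-- The symmetric part of the adjoint action of a generalised Einstein Lie algebra. -/
theorem IsAlmostAbelian.exists_symForm_eq (h : IsAlmostAbelian g N X 1) (hN : IsLorentzOn g N)
    (hH : IsClosedThreeForm H) (hH0 : H ≠ 0) (hE : IsGeneralisedEinstein g H 0) {l : 𝔤}
    (hl : l ∈ N) (hl0 : l ≠ 0) (hll : g.form l l = 0) {L : ℝ}
    (hL : ∀ z ∈ N, symForm g X l z = L * g.form l z) :
    ∃ l₁ ∈ N, ∃ s ∈ N, l₁ ≠ 0 ∧ g.form l₁ l₁ = 0 ∧ g.form l₁ s = 0 ∧ g.form s s = 1 ∧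
      ∀ y ∈ N, ∀ z ∈ N,
        symForm g X y z = 2 * (g.form l₁ y * g.form s z + g.form s y * g.form l₁ z) := by
  obtain ⟨d, l', e, F⟩ := hN.exists_isNullFrame hl hl0 hll
  obtain ⟨-, ⟨h1, h2, -, i₀, hi₀⟩, -⟩ := F.einstein h hH (h.einsteinEqs F.isDualFrame hE) L hL
    fun h0 => hH0 (F.threeForm_eq_zero h h0.1 h0.2.1 h0.2.2.1 h0.2.2.2.1 h0.2.2.2.2.1 h0.2.2.2.2.2)
  have hpair' : g.form l' l = 1 := by rw [form_comm, F.pair]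
  have horth : ∀ i, g.form (e i) l = 0 := fun i => by rw [form_comm, F.orth]
  have horth' : ∀ i, g.form (e i) l' = 0 := fun i => by rw [form_comm, F.orth']
  -- w is chosen so that S is the symmetric product of l♭ and w♭. It is spacelike because its square
  -- is ∑ S(l',eᵢ)², and one term is non-zero.
  set w : 𝔤 := (symForm g X l' l' / 2) • l + ∑ i, symForm g X l' (e i) • e i with hw
  have hwN : w ∈ N := N.add_mem (N.smul_mem _ hl) (N.sum_mem fun i _ => N.smul_mem _ (F.mem_e i))
  have hwl : g.form w l = 0 := by simp [hw, hll, horth]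
  have hwl' : g.form w l' = symForm g X l' l' / 2 := by simp [hw, F.pair, horth']
  have hwe : ∀ i, g.form w (e i) = symForm g X l' (e i) := fun i => by
    simp [hw, F.orth, F.orthonormal]
  have hww : 0 < g.form w w := by
    have h3 : g.form w w = ∑ i, symForm g X l' (e i) ^ 2 := by
      nth_rewrite 2 [hw]
      simp [hwl, hwe, pow_two]
    rw [h3]
    exact Finset.sum_pos' (fun i _ => sq_nonneg _)
      ⟨i₀, Finset.mem_univ _, by positivity⟩
  have hs : ∀ y ∈ N, ∀ z ∈ N,
      symForm g X y z = g.form l y * g.form w z + g.form w y * g.form l z := by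
    let u : LinearMap.BilinForm ℝ 𝔤 := symForm g X - (g.form l).smulRight (g.form w)
      - (g.form w).smulRight (g.form l)
    have hu : ∀ y z, u y z = symForm g X y z - g.form l y * g.form w z
      - g.form w y * g.form l z := fun y z => rfl
    have h3 : ∀ y ∈ N, ∀ z ∈ N, u y z = 0 := by
      refine F.isDualFrame.apply₂_eq_zero ?_
      have hel : ∀ i, symForm g X (e i) l = 0 := fun i => by
        rw [symForm_comm, h1 _ (F.mem_e i)]
      have hel' : ∀ i, symForm g X (e i) l' = symForm g X l' (e i) := fun i => symForm_comm _ _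
      have hl'l : symForm g X l' l = 0 := by rw [symForm_comm, h1 _ F.mem']
      rintro (a | i) (c | j)
      · fin_cases a <;> fin_cases c <;>
          simp [nullFamily, hu, hll, hwl, hwl', h1 l hl, h1 l' F.mem', hl'l, F.pair]
        ring
      · fin_cases a <;> simp [nullFamily, hu, hll, hwl, hwe, h1 _ (F.mem_e j), F.orth, F.pair]
      · fin_cases c <;> simp [nullFamily, hu, hll, hwl, hwe, hel, hel', F.orth, F.pair]
      · simp [nullFamily, hu, h2, F.orth]
    intro y hy z hz
    have := h3 y hy z hz
    rw [hu] at this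
    linarith
  set r := √(g.form w w) with hr
  have hr0 : 0 < r := Real.sqrt_pos.2 hww
  have hrr : r * r = g.form w w := Real.mul_self_sqrt hww.le
  -- Normalising w to unit length and rescaling l inversely, with an extra factor 1/2, produces the
  -- coefficient 2.
  refine ⟨(r / 2) • l, N.smul_mem _ hl, r⁻¹ • w, N.smul_mem _ hwN,
    smul_ne_zero (by positivity) hl0, by simp [hll], by simp [form_comm g l w, hwl], ?_, ?_⟩
  · simp only [map_smul, LinearMap.smul_apply, smul_eq_mul, ← hrr]
    field_simp
  · intro y hy z hz
    rw [hs y hy z hz]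
    simp only [map_smul, LinearMap.smul_apply, smul_eq_mul]
    field_simp

/-- A null frame of the ideal adapted to the adjoint action. -/
theorem IsLorentzOn.exists_adapted_frame (hN : IsLorentzOn g N) {l s : 𝔤} (hl : l ∈ N) (hs : s ∈ N) (hl0 : l ≠ 0)
    (hll : g.form l l = 0) (hls : g.form l s = 0) (hss : g.form s s = 1)
    (hsym : ∀ y ∈ N, ∀ z ∈ N,
      symForm g X y z = 2 * (g.form l y * g.form s z + g.form s y * g.form l z)) :
    ∃ (k m : ℕ) (l' : 𝔤) (e : (Fin 2 × Fin k) ⊕ Fin m → 𝔤) (c : Fin k → ℝ),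
      IsNullFrame g N l l' (fun o : Option _ => o.elim s e) ∧ Antitone c ∧ (∀ i, 0 < c i) ∧
      ∀ i j, adForm g X (e j) (e i) = rotationMatrix k m c i j := by
  -- The partner l' is chosen inside s^⊥, so that s becomes one of the orthonormal vectors of the
  -- null frame.
  have hN' := hN.orthIn_of_pos hs (by rw [hss]; exact one_pos)
  have hl1 : l ∈ orthIn g N s := mem_orthIn.2 ⟨hl, by rw [form_comm, hls]⟩
  obtain ⟨l', hl', hll', hp⟩ := hN'.exists_hyperbolic hl1 hl0 hll
  obtain ⟨d, e₀, he⟩ : ∃ (d : ℕ) (e₀ : Fin d → 𝔤),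
      IsOrthoFrame g (orthIn g (orthIn g (orthIn g N s) l) l') e₀ :=
    ⟨_, exists_isOrthoFrame (hN'.pos_orth hl1 hl' hll hll' hp)⟩
  have hWm : ∀ x ∈ orthIn g (orthIn g (orthIn g N s) l) l', x ∈ N ∧ g.form l x = 0 :=
      fun x hx => by
    rw [mem_orthIn, mem_orthIn, mem_orthIn] at hx
    exact ⟨hx.1.1.1, hx.1.2⟩
  -- The compression of ad_X to the complement of l, l' and s. It is skew, since S vanishes on pairs
  -- of vectors orthogonal to l.
  set T : EuclideanSpace ℝ (Fin d) →ₗ[ℝ] EuclideanSpace ℝ (Fin d) :=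
    frameCoord g e₀ ∘ₗ (LieAlgebra.ad ℝ 𝔤 X : 𝔤 →ₗ[ℝ] 𝔤) ∘ₗ frameMap e₀ with hT
  have hTi : ∀ x y, inner ℝ (T x) y = adForm g X (frameMap e₀ x) (frameMap e₀ y) := fun x y => by
    rw [hT, LinearMap.comp_apply, inner_frameCoord]
    rfl
  obtain ⟨k, m, v, c, hc, hc0, hv0, hv1, hv2⟩ := exists_skew_normalForm T fun x y => by
    rw [hTi, real_inner_comm, hTi]
    have h1 := hWm _ (he.frameMap_mem x)
    have h2 := hWm _ (he.frameMap_mem y)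
    have h3 := hsym _ h1.1 _ h2.1
    rw [h1.2, h2.2, symForm_apply] at h3
    rw [adForm_apply, adForm_apply]
    linarith
  have hv := he.of_orthonormalBasis v
  refine ⟨k, m, l', fun i => frameMap e₀ (v i), c,
    (hv.isNullFrame hl1 hl' hll hll' hp).option hs hss, hc, hc0, fun i j => ?_⟩
  rw [← hTi]
  have hvv := orthonormal_iff_ite.1 v.orthonormal
  rcases j with ⟨a, j⟩ | j
  · fin_cases a
    · simp only [Fin.zero_eta, hv0, inner_smul_left, hvv]
      rcases i with ⟨b, i⟩ | i
      · fin_cases b <;> simp [rotationMatrix, Matrix.blockDiagonal_apply, L₁, eq_comm]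
        split_ifs with h
        · rw [h]
        · rfl
      · simp [rotationMatrix]
    · simp only [Fin.mk_one, hv1, inner_neg_left, inner_smul_left, hvv]
      rcases i with ⟨b, i⟩ | i
      · fin_cases b <;> simp [rotationMatrix, Matrix.blockDiagonal_apply, L₁, eq_comm]
        split_ifs with h
        · rw [h]
        · simp
      · simp [rotationMatrix]
  · rw [hv2, inner_zero_left]
    rcases i with i | i <;> simp [rotationMatrix]

end Adapted

/-! ### Normal frames: derivation from the Einstein equations. -/

section NormalFrame

variable {𝔤 : Type*} [LieRing 𝔤] [LieAlgebra ℝ 𝔤]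

/-- A null frame `(l, l', s, e)` of the ideal in which `H` and the adjoint action of `X` have the
normal form of an Einstein structure. -/
structure IsNormalFrame (g : PseudoMetric 𝔤) (H : 𝔤 [⋀^Fin 3]→ₗ[ℝ] ℝ) (N : Submodule ℝ 𝔤) (X : 𝔤)
    {k m : ℕ} (l l' s : 𝔤) (e : (Fin 2 × Fin k) ⊕ Fin m → 𝔤) (c : Fin k → ℝ)
    (u : (Fin 2 × Fin k) ⊕ Fin m → ℝ) (ρ : ℝ) : Prop where
  nullFrame : IsNullFrame g N l l' (fun o : Option _ => o.elim s e)
  ad_l : ⁅X, l⁆ = 0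
  ad_l' : ⁅X, l'⁆ = (1 - ρ) • s + ∑ j, u j • e j
  ad_s : ⁅X, s⁆ = (1 + ρ) • l
  ad_e : ∀ j, ⁅X, e j⁆ = -(u j) • l + ∑ i, rotationMatrix k m c i j • e i
  null_l : ∀ y z, contract H l y z = 0
  wedge : ∀ x y z, contract H x y z = wedge₁₂ (g.form l) (contract H l') x y z
  omega : ∀ p, contract H l' X (e (Sum.inl p)) = 0
  rho : 4 * ρ = contract H l' X s ^ 2 + ∑ q, contract H l' X (e (Sum.inr q)) ^ 2
    + ∑ j, contract H l' s (e j) ^ 2 + (1 / 2) * ∑ i, ∑ j, contract H l' (e i) (e j) ^ 2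

variable {g : PseudoMetric 𝔤} {H : 𝔤 [⋀^Fin 3]→ₗ[ℝ] ℝ} {N : Submodule ℝ 𝔤} {X : 𝔤}

/-- A three-form which vanishes on the null vector `l` and on `l⊥` is divisible by `g(l, ·)`. -/
theorem IsNullFrame.threeForm_eq_wedge {ι : Type*} [Fintype ι] [DecidableEq ι] {l l' : 𝔤}
    {e : ι → 𝔤} (F : IsNullFrame g N l l' e) (h : IsAlmostAbelian g N X 1)
    (h1 : ∀ z ∈ N, contract H X l z = 0) (h2 : ∀ y ∈ N, ∀ z ∈ N, contract H l y z = 0)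
    (h3 : ∀ i j, contract H X (e i) (e j) = 0)
    (h6 : ∀ i j m, contract H (e i) (e j) (e m) = 0) :
    (∀ y z, contract H l y z = 0) ∧
      ∀ x y z, contract H x y z = wedge₁₂ (g.form l) (contract H l') x y z := by
  have hs : ∀ x, ∃ x' ∈ N, ∃ a : ℝ, x = x' + a • X := fun x => ⟨_, h.split x, _, by abel⟩
  have h1' : ∀ y ∈ N, contract H l X y = 0 := fun y hy => by
    rw [contract_swap₁₂, h1 y hy, neg_zero]
  have h1'' : ∀ y ∈ N, contract H l y X = 0 := fun y hy => by
    rw [contract_swap₂₃, h1' y hy, neg_zero]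
  have hl : ∀ y z, contract H l y z = 0 := fun y z => by
    obtain ⟨y', hy, b, rfl⟩ := hs y
    obtain ⟨z', hz, c, rfl⟩ := hs z
    simp only [map_add, map_smul, LinearMap.add_apply, LinearMap.smul_apply,
      h2 y' hy z' hz, h1' _ hz, h1'' _ hy, contract_self₂₃]
    simp
  refine ⟨hl, ?_⟩
  have hl₂ : ∀ y z, contract H y l z = 0 := fun y z => by rw [contract_swap₁₂, hl, neg_zero]
  have hl₃ : ∀ y z, contract H y z l = 0 := fun y z => by rw [contract_swap₂₃, hl₂, neg_zero]
  -- The hyperplane l^⊥ of 𝔤 is spanned by the eᵢ, l and X, and H vanishes on it by the hypotheses.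
  have hX : ∀ x, g.form l x = 0 → ∃ (v : ι → ℝ) (a b : ℝ), x = ∑ i, v i • e i + a • l + b • X := by
    intro x hx
    obtain ⟨x', hx', b, rfl⟩ := hs x
    have h4 : g.form x' l = 0 := by
      rwa [map_add, map_smul, form_comm g l X, h.orth l F.mem, smul_zero, add_zero, form_comm] at hx
    refine ⟨fun i => g.form x' (e i), g.form x' l', b, ?_⟩
    nth_rewrite 1 [F.expand x' hx']
    rw [h4, zero_smul, add_zero, add_comm (g.form x' l' • l)]
  have h3' : ∀ i j, contract H (e i) X (e j) = 0 := fun i j => by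
    rw [contract_swap₁₂, h3, neg_zero]
  have h3'' : ∀ i j, contract H (e i) (e j) X = 0 := fun i j => by
    rw [contract_swap₂₃, h3', neg_zero]
  have hXX : ∀ y, contract H X y X = 0 := fun y => by
    rw [contract_swap₂₃, contract_self₁₂, neg_zero]
  have h0 : ∀ x y z, g.form l x = 0 → g.form l y = 0 → g.form l z = 0 → contract H x y z = 0 := by
    intro x y z hx hy hz
    obtain ⟨v₁, a₁, b₁, rfl⟩ := hX x hx
    obtain ⟨v₂, a₂, b₂, rfl⟩ := hX y hy
    obtain ⟨v₃, a₃, b₃, rfl⟩ := hX z hz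
    simp only [map_add, map_sum, map_smul, LinearMap.add_apply, LinearMap.smul_apply,
      LinearMap.sum_apply, hl, hl₂, hl₃, h3, h3', h3'', h6, hXX, contract_self₁₂, contract_self₂₃,
      smul_zero, Finset.sum_const_zero, add_zero]
  intro x y z
  -- Subtracting g(l,x)l' moves each argument into l^⊥; expanding the vanishing value of H there is
  -- the claimed formula.
  have hq : ∀ x, g.form l (x - g.form l x • l') = 0 := fun x => by simp [F.pair]
  have h4 := h0 _ _ _ (hq x) (hq y) (hq z)
  have h5 : ∀ y, contract H l' y l' = 0 := fun y => by
    rw [contract_swap₂₃, contract_self₁₂, neg_zero]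
  simp only [map_sub, map_smul, LinearMap.sub_apply, LinearMap.smul_apply, contract_self₁₂,
    contract_self₂₃, h5, smul_eq_mul] at h4
  rw [contract_swap₁₂ l' x z, contract_swap₂₃ x l' y, contract_swap₁₂ l' x y] at h4
  unfold wedge₁₂
  linarith

/-- In the adapted frame S(l',·) on the orthonormal part is supported on s. So the (l',l') equation
determines A(l',s), the (l',eᵢ) equations give A(eᵢ,s) = 0, and the skew equation and dH = 0 say
that the remaining components of H are invariant under the rotations, whose speeds cᵢ are positive.
-/
theorem IsLorentzOn.exists_isNormalFrame [FiniteDimensional ℝ 𝔤] (hN : IsLorentzOn g N)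
    (h : IsAlmostAbelian g N X 1)
    (hH : IsClosedThreeForm H) (hH0 : H ≠ 0) (hE : IsGeneralisedEinstein g H 0) {l : 𝔤}
    (hl : l ∈ N) (hl0 : l ≠ 0) (hll : g.form l l = 0) {L : ℝ}
    (hL : ∀ z ∈ N, symForm g X l z = L * g.form l z) :
    ∃ (k m : ℕ) (l l' s : 𝔤) (e : (Fin 2 × Fin k) ⊕ Fin m → 𝔤) (c : Fin k → ℝ)
      (u : (Fin 2 × Fin k) ⊕ Fin m → ℝ) (ρ : ℝ), IsNormalFrame g H N X l l' s e c u ρ ∧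
      Antitone c ∧ (∀ i, 0 < c i) ∧
      (∀ p, contract H l' s (e (Sum.inl p)) = 0) ∧
      (∀ p q, contract H l' (e (Sum.inl p)) (e (Sum.inr q)) = 0) ∧
      (∀ i j, c i ≠ c j → ∀ a b,
        contract H l' (e (Sum.inl (a, i))) (e (Sum.inl (b, j))) = 0) ∧
      ∀ i j, contract H l' (e (Sum.inl (1, i))) (e (Sum.inl (1, j)))
          = contract H l' (e (Sum.inl (0, i))) (e (Sum.inl (0, j))) ∧
        contract H l' (e (Sum.inl (1, i))) (e (Sum.inl (0, j)))
          = -contract H l' (e (Sum.inl (0, i))) (e (Sum.inl (1, j))) := by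
  obtain ⟨l, hl, s, hs, hl0, hll, hls, hss, hsym⟩ :=
    h.exists_symForm_eq hN hH hH0 hE hl hl0 hll hL
  obtain ⟨k, m, l', e, c, F, hc, hc0, hD⟩ :=
    hN.exists_adapted_frame hl hs hl0 hll hls hss hsym
  have hle : ∀ i, g.form l (e i) = 0 := fun i => F.orth (some i)
  have hse : ∀ i, g.form s (e i) = 0 := fun i => F.orthonormal none (some i)
  have hsl : g.form s l = 0 := by rw [form_comm, hls]
  have hsl' : g.form s l' = 0 := by rw [form_comm]; exact F.orth' none
  have hmem : ∀ i, e i ∈ N := fun i => F.mem_e (some i)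
  obtain ⟨⟨w1, w2, w3, w4⟩, ⟨-, -, s3, -⟩, r1, r2, r3, r4⟩ :=
    -- The eigenvalue is 0: S(l,·) vanishes, as l is null and orthogonal to s.
    F.einstein h hH (h.einsteinEqs F.isDualFrame hE) 0
      (fun z hz => by rw [hsym l hl z hz, hll, hsl]; ring)
      fun h0 => hH0 (F.threeForm_eq_zero h h0.1 h0.2.1 h0.2.2.1 h0.2.2.2.1 h0.2.2.2.2.1 h0.2.2.2.2.2)
  obtain ⟨hnl, hw⟩ := F.threeForm_eq_wedge h w1 w2 w3 w4
  have hsl's : symForm g X l' s = 2 := by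
    rw [hsym l' F.mem' s hs, F.pair, hss, hls]; ring
  have hsl'e : ∀ i, symForm g X l' (e i) = 0 := fun i => by
    rw [hsym l' F.mem' _ (hmem i), hse, hle]; ring
  have hsee : ∀ i j, symForm g X (e i) (e j) = 0 := fun i j => by
    rw [hsym _ (hmem i) _ (hmem j), hle, hle]; ring
  have hsse : ∀ i, symForm g X s (e i) = 0 := fun i => by
    rw [hsym _ hs _ (hmem i), hle, hls]; ring
  have hcee : ∀ i j, skewForm g X (e i) (e j) = 2 * rotationMatrix k m c j i := fun i j => by
    have h1 := adForm_eq (g := g) (X := X) (e i) (e j)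
    rw [hsee, hD] at h1
    linarith
  simp only [Fintype.sum_option, Option.elim, hsl's, hsl'e, mul_zero, zero_mul,
    Finset.sum_const_zero, add_zero] at r1 r2
  have hces : ∀ i, skewForm g X (e i) s = 0 := fun i => by
    have := r2 (some i)
    simp only at this
    linarith
  have hcse : ∀ i, skewForm g X s (e i) = 0 := fun i => by rw [skewForm_comm, hces, neg_zero]
  have e0 : ∀ z ∈ N, adForm g X l z = 0 := fun z hz => by
    rw [adForm_eq, s3 z hz, hsym l hl z hz, hll, hsl]; ring
  have e1 : ∀ z ∈ N, adForm g X z l = 0 := fun z hz => by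
    have h1 := adForm_flip_eq (g := g) (X := X) l z
    rw [s3 z hz, hsym l hl z hz, hll, hsl] at h1
    have h2 : (adForm g X).flip l z = adForm g X z l := rfl
    rw [h2] at h1
    rw [h1]; ring
  have hcc : ∀ y z, adForm g X y z = symForm g X y z - adForm g X z y := fun y z => by
    rw [symForm_apply, adForm_apply, adForm_apply]; ring
  have hsl'l' : symForm g X l' l' = 0 := by rw [hsym l' F.mem' l' F.mem', hsl']; ring
  have a1 : adForm g X l' l' = 0 := by linarith [hcc l' l']
  have a2 : adForm g X s s = 0 := by
    have h1 := hcc s s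
    have h2 : symForm g X s s = 0 := by rw [hsym _ hs _ hs, hls]; ring
    linarith
  have a3 : ∀ j, adForm g X s (e j) = 0 := fun j => by rw [adForm_eq, hsse, hcse]; ring
  have a4 : ∀ j, adForm g X (e j) s = 0 := fun j => by rw [hcc, symForm_comm, hsse, a3]; ring
  have a5 : adForm g X l' s = 1 + skewForm g X l' s / 2 := by rw [adForm_eq, hsl's]; ring
  have a6 : adForm g X s l' = 1 - skewForm g X l' s / 2 := by
    rw [hcc, symForm_comm, hsl's, a5]; ring
  have a7 : ∀ j, adForm g X (e j) l' = -adForm g X l' (e j) := fun j => by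
    rw [hcc, symForm_comm, hsl'e]; ring
  have hexp : ∀ v ∈ N, ⁅X, v⁆ = adForm g X v l' • l + adForm g X v l • l' + (adForm g X v s • s
      + ∑ i, adForm g X v (e i) • e i) := fun v hv => by
    have := F.expand _ (h.ideal v hv)
    rwa [Fintype.sum_option] at this
  -- the components of `H` on the planes of rotation
  have ksum0 : ∀ (i : Fin k) (w : (Fin 2 × Fin k) ⊕ Fin m → ℝ),
      ∑ j, 2 * rotationMatrix k m c j (Sum.inl (0, i)) * w j
        = 2 * c i * w (Sum.inl (1, i)) := fun i w => by
    rw [Finset.sum_eq_single (Sum.inl (1, i))]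
    · simp [rotationMatrix, Matrix.blockDiagonal_apply, L₁]
    · rintro (⟨b, j⟩ | j) - hj
      · fin_cases b
        · by_cases hij : j = i <;> simp [rotationMatrix, Matrix.blockDiagonal_apply, L₁, hij]
        · have hij : j ≠ i := fun h => hj (by rw [h]; rfl)
          simp [rotationMatrix, Matrix.blockDiagonal_apply, hij]
      · simp [rotationMatrix]
    · simp
  have ksum1 : ∀ (i : Fin k) (w : (Fin 2 × Fin k) ⊕ Fin m → ℝ),
      ∑ j, 2 * rotationMatrix k m c j (Sum.inl (1, i)) * w j
        = -(2 * c i * w (Sum.inl (0, i))) := fun i w => by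
    rw [Finset.sum_eq_single (Sum.inl (0, i))]
    · simp [rotationMatrix, Matrix.blockDiagonal_apply, L₁]
    · rintro (⟨b, j⟩ | j) - hj
      · fin_cases b
        · have hij : j ≠ i := fun h => hj (by rw [h]; rfl)
          simp [rotationMatrix, Matrix.blockDiagonal_apply, hij]
        · by_cases hij : j = i <;> simp [rotationMatrix, Matrix.blockDiagonal_apply, L₁, hij]
      · simp [rotationMatrix]
    · simp
  have ksum2 : ∀ (i : Fin m) (w : (Fin 2 × Fin k) ⊕ Fin m → ℝ),
      ∑ j, 2 * rotationMatrix k m c j (Sum.inr i) * w j = 0 := fun i w => by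
    refine Finset.sum_eq_zero ?_
    rintro (j | j) - <;> simp [rotationMatrix]
  have r3' : ∀ i, ∑ j, 2 * rotationMatrix k m c j i * contract H X l' (e j) = 0 := fun i => by
    have h1 := r3 (some i)
    simp only [Fintype.sum_option, Option.elim, hces, hcee, mul_zero, zero_add] at h1
    rw [← h1]
    exact Finset.sum_congr rfl fun j _ => mul_comm _ _
  have hp : ∀ p, contract H X l' (e (Sum.inl p)) = 0 := by
    rintro ⟨a, i⟩
    have hci := (hc0 i).ne'
    fin_cases a
    · have h1 := r3' (Sum.inl (1, i))
      rw [ksum1] at h1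
      simpa [hci] using h1
    · have h1 := r3' (Sum.inl (0, i))
      rw [ksum0] at h1
      simpa [hci] using h1
  have hp' : ∀ x, contract H l' X x = -contract H X l' x := fun x => contract_swap₁₂ _ _ _
  have r4s : ∀ i, ∑ j, 2 * rotationMatrix k m c j i * contract H l' (e j) s = 0 := fun i => by
    have h1 := r4 (some i) none
    simpa only [Fintype.sum_option, Option.elim, hces, hcse, hcee, skewForm_self, mul_zero,
      zero_mul, zero_add, add_zero, Finset.sum_const_zero] using h1
  have r4e : ∀ i i', ∑ j, 2 * rotationMatrix k m c j i * contract H l' (e j) (e i')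
      + ∑ j, 2 * rotationMatrix k m c j i' * contract H l' (e i) (e j) = 0 := fun i i' => by
    have h1 := r4 (some i) (some i')
    simpa only [Fintype.sum_option, Option.elim, hces, hcse, hcee, mul_zero,
      zero_mul, zero_add] using h1
  -- Infinitesimal invariance of H(l',·,·) under the rotations in the planes i and j, written out in
  -- the four components of the corresponding block.
  have hj : ∀ i j, c i * contract H l' (e (Sum.inl (1, i))) (e (Sum.inl (0, j)))
        = -(c j * contract H l' (e (Sum.inl (0, i))) (e (Sum.inl (1, j)))) ∧
      c i * contract H l' (e (Sum.inl (1, i))) (e (Sum.inl (1, j)))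
        = c j * contract H l' (e (Sum.inl (0, i))) (e (Sum.inl (0, j))) ∧
      c i * contract H l' (e (Sum.inl (0, i))) (e (Sum.inl (0, j)))
        = c j * contract H l' (e (Sum.inl (1, i))) (e (Sum.inl (1, j))) ∧
      c i * contract H l' (e (Sum.inl (0, i))) (e (Sum.inl (1, j)))
        = -(c j * contract H l' (e (Sum.inl (1, i))) (e (Sum.inl (0, j)))) := fun i j => by
    have h1 := r4e (Sum.inl (0, i)) (Sum.inl (0, j))
    have h2 := r4e (Sum.inl (0, i)) (Sum.inl (1, j))
    have h3 := r4e (Sum.inl (1, i)) (Sum.inl (0, j))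
    have h4 := r4e (Sum.inl (1, i)) (Sum.inl (1, j))
    rw [ksum0 i fun x => contract H l' (e x) (e (Sum.inl (0, j))),
      ksum0 j fun x => contract H l' (e (Sum.inl (0, i))) (e x)] at h1
    rw [ksum0 i fun x => contract H l' (e x) (e (Sum.inl (1, j))),
      ksum1 j fun x => contract H l' (e (Sum.inl (0, i))) (e x)] at h2
    rw [ksum1 i fun x => contract H l' (e x) (e (Sum.inl (0, j))),
      ksum0 j fun x => contract H l' (e (Sum.inl (1, i))) (e x)] at h3
    rw [ksum1 i fun x => contract H l' (e x) (e (Sum.inl (1, j))),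
      ksum1 j fun x => contract H l' (e (Sum.inl (1, i))) (e x)] at h4
    refine ⟨?_, ?_, ?_, ?_⟩ <;> linarith
  -- Since ad(l',s) = 1 - ρ and ad(s,l') = 1 + ρ, the number ρ is -A(l',s)/2.
  refine ⟨k, m, l, l', s, e, c, fun j => adForm g X l' (e j), -(skewForm g X l' s / 2),
    ⟨F, ?_, ?_, ?_, fun j => ?_, hnl, hw, fun p => ?_, ?_⟩, hc, hc0, ?_, ?_, ?_, fun i j => ?_⟩
  · rw [hexp l hl, e0 _ F.mem', e0 _ hl, e0 _ hs]
    simp [e0 _ (hmem _)]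
  · rw [hexp l' F.mem', a1, e1 _ F.mem', a5, zero_smul, zero_smul, zero_add, zero_add,
      sub_neg_eq_add]
  · rw [hexp s hs, a6, e1 _ hs, a2]
    simp [a3, sub_eq_add_neg]
  · rw [hexp _ (hmem j), a7, e1 _ (hmem j), a4]
    simp [hD]
  · rw [hp', hp, neg_zero]
  · have hl's : ∀ j, contract H l' (e j) s = -contract H l' s (e j) := fun j =>
      contract_swap₂₃ _ _ _
    simp only [Fintype.sum_sum_type, hp, hp', hl's, neg_sq,
      contract_self₂₃, Finset.sum_add_distrib] at r1 ⊢
    ring_nf at r1 ⊢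
    rw [Finset.sum_const_zero] at r1
    linarith
  · rintro ⟨a, i⟩
    have hci := (hc0 i).ne'
    rw [contract_swap₂₃, neg_eq_zero]
    fin_cases a
    · have h1 := r4s (Sum.inl (1, i))
      rw [ksum1 i fun x => contract H l' (e x) s] at h1
      simpa [hci] using h1
    · have h1 := r4s (Sum.inl (0, i))
      rw [ksum0 i fun x => contract H l' (e x) s] at h1
      simpa [hci] using h1
  · rintro ⟨a, i⟩ q
    have hci := (hc0 i).ne'
    fin_cases a
    · have h1 := r4e (Sum.inl (1, i)) (Sum.inr q)
      rw [ksum1 i fun x => contract H l' (e x) (e (Sum.inr q)), ksum2] at h1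
      simpa [hci] using h1
    · have h1 := r4e (Sum.inl (0, i)) (Sum.inr q)
      rw [ksum0 i fun x => contract H l' (e x) (e (Sum.inr q)), ksum2] at h1
      simpa [hci] using h1
  · intro i j hij a b
    obtain ⟨h1, h2, h3, h4⟩ := hj i j
    -- Combining two of the four relations multiplies each component by cᵢ² - cⱼ². For arbitrary i
    -- and j, adding them and dividing by cᵢ + cⱼ gives instead the relations of type (1,1).
    have h5 : c i ^ 2 - c j ^ 2 ≠ 0 := by
      have : 0 < c i + c j := add_pos (hc0 i) (hc0 j)
      rw [sq_sub_sq]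
      exact mul_ne_zero this.ne' (sub_ne_zero.2 hij)
    fin_cases a <;> fin_cases b <;> refine (mul_eq_zero.1 ?_).resolve_left h5
    · simp only [Fin.zero_eta]
      linear_combination c i * h3 + c j * h2
    · simp only [Fin.zero_eta, Fin.mk_one]
      linear_combination c i * h4 - c j * h1
    · simp only [Fin.zero_eta, Fin.mk_one]
      linear_combination c i * h1 - c j * h4
    · simp only [Fin.mk_one]
      linear_combination c i * h2 + c j * h3
  · obtain ⟨h1, h2, h3, h4⟩ := hj i j
    have h5 : c i + c j ≠ 0 := (add_pos (hc0 i) (hc0 j)).ne'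
    constructor
    · refine mul_left_cancel₀ h5 ?_
      linarith
    · refine mul_left_cancel₀ h5 ?_
      linarith

end NormalFrame

/-! ### Normal frames satisfy the Einstein equations. -/

section NormalFrame

variable {𝔤 : Type*} [LieRing 𝔤] [LieAlgebra ℝ 𝔤] {g : PseudoMetric 𝔤}
  {H : 𝔤 [⋀^Fin 3]→ₗ[ℝ] ℝ} {N : Submodule ℝ 𝔤} {X : 𝔤} {k m : ℕ} {l l' s : 𝔤}
  {e : (Fin 2 × Fin k) ⊕ Fin m → 𝔤} {c : Fin k → ℝ} {u : (Fin 2 × Fin k) ⊕ Fin m → ℝ} {ρ : ℝ}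

theorem rotationMatrix_skew (i j : (Fin 2 × Fin k) ⊕ Fin m) :
    rotationMatrix k m c i j = -rotationMatrix k m c j i := by
  rcases i with ⟨a, i⟩ | i <;> rcases j with ⟨b, j⟩ | j
  · by_cases hij : i = j
    · subst hij
      fin_cases a <;> fin_cases b <;> simp [rotationMatrix, Matrix.blockDiagonal_apply, L₁]
    · simp [rotationMatrix, Matrix.blockDiagonal_apply, hij, Ne.symm hij]
  all_goals simp [rotationMatrix]

/-- A normal frame yields a generalised Einstein structure with divergence zero. -/
theorem IsNormalFrame.isGeneralisedEinstein [FiniteDimensional ℝ 𝔤]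
    (h : IsNormalFrame g H N X l l' s e c u ρ) (hA : IsAlmostAbelian g N X 1) :
    IsGeneralisedEinstein g H 0 := by
  have F := h.nullFrame
  have hll := F.null
  have hl'l' := F.null'
  have hll' := F.pair
  have hl'l : g.form l' l = 1 := by rw [form_comm, hll']
  have hle : ∀ i, g.form l (e i) = 0 := fun i => F.orth (some i)
  have hl'e : ∀ i, g.form l' (e i) = 0 := fun i => F.orth' (some i)
  have hls : g.form l s = 0 := F.orth none
  have hl's : g.form l' s = 0 := F.orth' none
  have hss : g.form s s = 1 := by simpa using F.orthonormal none none
  have hse : ∀ i, g.form s (e i) = 0 := fun i => F.orthonormal none (some i)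
  have hes : ∀ i, g.form (e i) s = 0 := fun i => by rw [form_comm, hse]
  have hel : ∀ i, g.form (e i) l = 0 := fun i => by rw [form_comm, hle]
  have hel' : ∀ i, g.form (e i) l' = 0 := fun i => by rw [form_comm, hl'e]
  have hsl : g.form s l = 0 := by rw [form_comm, hls]
  have hsl' : g.form s l' = 0 := by rw [form_comm, hl's]
  have hee : ∀ i j, g.form (e i) (e j) = if i = j then 1 else 0 := fun i j => by
    simpa using F.orthonormal (some i) (some j)
  -- the adjoint action
  have al : ∀ z, adForm g X l z = 0 := fun z => by rw [adForm_apply, h.ad_l]; simp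
  have al'l : adForm g X l' l = 0 := by rw [adForm_apply, h.ad_l']; simp [hsl, hel]
  have al'l' : adForm g X l' l' = 0 := by rw [adForm_apply, h.ad_l']; simp [hsl', hel']
  have al's : adForm g X l' s = 1 - ρ := by rw [adForm_apply, h.ad_l']; simp [hss, hes]
  have al'e : ∀ j, adForm g X l' (e j) = u j := fun j => by
    rw [adForm_apply, h.ad_l']; simp [hse, hee, -Fintype.sum_sum_type]
  have asl : adForm g X s l = 0 := by rw [adForm_apply, h.ad_s]; simp [hll]
  have asl' : adForm g X s l' = 1 + ρ := by rw [adForm_apply, h.ad_s]; simp [hll']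
  have ass : adForm g X s s = 0 := by rw [adForm_apply, h.ad_s]; simp [hls]
  have ase : ∀ j, adForm g X s (e j) = 0 := fun j => by rw [adForm_apply, h.ad_s]; simp [hle]
  have ael : ∀ j, adForm g X (e j) l = 0 := fun j => by
    rw [adForm_apply, h.ad_e]; simp [hll, hel]
  have ael' : ∀ j, adForm g X (e j) l' = -u j := fun j => by
    rw [adForm_apply, h.ad_e]; simp [hll', hel']
  have aes : ∀ j, adForm g X (e j) s = 0 := fun j => by
    rw [adForm_apply, h.ad_e]; simp [hls, hes]
  have aee : ∀ i j, adForm g X (e j) (e i) = rotationMatrix k m c i j := fun i j => by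
    rw [adForm_apply, h.ad_e]; simp [hle, hee, -Fintype.sum_sum_type]
  have sy : ∀ y z, symForm g X y z = adForm g X y z + adForm g X z y := fun _ _ => rfl
  have sk : ∀ y z, skewForm g X y z = adForm g X y z - adForm g X z y := fun _ _ => rfl
  have aee' : ∀ i j, symForm g X (e i) (e j) = 0 := fun i j => by
    rw [sy, aee, aee, rotationMatrix_skew]; ring
  -- the three-form
  have n2 : ∀ y z, contract H y l z = 0 := fun y z => by
    rw [contract_swap₁₂, h.null_l, neg_zero]
  have n3 : ∀ y z, contract H y z l = 0 := fun y z => by rw [contract_swap₂₃, n2, neg_zero]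
  have hlX : g.form l X = 0 := by rw [form_comm, hA.orth l F.mem]
  have hperp : ∀ x y z, g.form l x = 0 → g.form l y = 0 → g.form l z = 0 →
      contract H x y z = 0 := fun x y z hx hy hz => by
    rw [h.wedge]; simp [wedge₁₂, hx, hy, hz]
  have hp' : ∀ x, contract H X l' x = -contract H l' X x := fun x => contract_swap₁₂ _ _ _
  have hpl' : ∀ x, contract H X x l' = contract H l' X x := fun x => by
    rw [contract_swap₂₃, hp', neg_neg]
  have hself : ∀ x, contract H l' x l' = 0 := fun x => by
    rw [contract_swap₂₃, contract_self₁₂, neg_zero]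
  have hω : ∀ a b : Option ((Fin 2 × Fin k) ⊕ Fin m),
      contract H X (a.elim s e) (b.elim s e) = 0 := fun a b => hperp _ _ _ hlX (F.orth a) (F.orth b)
  have hh : ∀ a b d : Option ((Fin 2 × Fin k) ⊕ Fin m),
      contract H (d.elim s e) (a.elim s e) (b.elim s e) = 0 := fun a b d =>
    hperp _ _ _ (F.orth d) (F.orth a) (F.orth b)
  have hs0 : ∀ a b : Option ((Fin 2 × Fin k) ⊕ Fin m),
      symForm g X (a.elim s e) (b.elim s e) = 0 := by
    rintro (_ | i) (_ | j)
    · simp [sy, ass]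
    · simp [sy, ase, aes]
    · simp [sy, ase, aes]
    · exact aee' i j
  have hsl0 : ∀ a : Option ((Fin 2 × Fin k) ⊕ Fin m), symForm g X (a.elim s e) l = 0 := by
    rintro (_ | i) <;> simp [sy, al, asl, ael]
  have hsl1 : ∀ a : Option ((Fin 2 × Fin k) ⊕ Fin m), symForm g X l (a.elim s e) = 0 := by
    rintro (_ | i) <;> simp [sy, al, asl, ael]
  have hcl0 : ∀ a : Option ((Fin 2 × Fin k) ⊕ Fin m), skewForm g X (a.elim s e) l = 0 := by
    rintro (_ | i) <;> simp [sk, al, asl, ael]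
  have hcl1 : ∀ a : Option ((Fin 2 × Fin k) ⊕ Fin m), skewForm g X l (a.elim s e) = 0 := by
    rintro (_ | i) <;> simp [sk, al, asl, ael]
  have hsll : symForm g X l l = 0 := by simp [sy, al]
  have hsll' : symForm g X l l' = 0 := by simp [sy, al, al'l]
  have hsl'l : symForm g X l' l = 0 := by simp [sy, al, al'l]
  have hsl'l' : symForm g X l' l' = 0 := by simp [sy, al'l']
  have hcll' : skewForm g X l l' = 0 := by simp [sk, al, al'l]
  have hcl'l : skewForm g X l' l = 0 := by simp [sk, al, al'l]
  have hskew : ∀ y z, contract H X z y = -contract H X y z := fun y z => contract_swap₂₃ _ _ _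
  have hskew' : ∀ x y z, contract H x z y = -contract H x y z := fun x y z => contract_swap₂₃ _ _ _
  have hrs := symRicci_comm (g := g) (X := X) (ε := 1) (H := H) F.isDualFrame
  -- H(X,l',·) has no component along the rotated planes, so the rotational part of ad_X annihilates
  -- it. This is the substance of the skew equation.
  have hD : ∀ a : Option ((Fin 2 × Fin k) ⊕ Fin m),
      ∑ d : Option ((Fin 2 × Fin k) ⊕ Fin m),
        adForm g X (d.elim s e) (a.elim s e) * contract H X l' (d.elim s e) = 0 := by
    rintro (_ | j)
    · simp [Fintype.sum_option, ass, aes]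
    · rcases j with j | j <;>
        simp [Fintype.sum_option, ase, aee, hp', h.omega, rotationMatrix, Fintype.sum_sum_type]
  refine hA.isGeneralisedEinstein F.isDualFrame ?_ ?_ ?_ ?_
  · rw [contr₂_null, contr₂_null_skew _ _ hskew hskew]
    simp [hsll, hsll', hsl'l, hs0, hsl1, hsl0, hω, n2]
  · intro a
    rw [contr₂_null_skew _ _ hskew (hskew' _)]
    simp [n2, hω]
  · have k1 : ∀ a, symRicci g X 1 H (nullFamily l l' (fun o : Option _ => o.elim s e))
        (nullFamily l' l (fun o : Option _ => o.elim s e)) l (nullFamily l l'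
          (fun o : Option _ => o.elim s e) a) = 0 := fun a => by
      rw [symRicci, contr₁_null, contr₁_null, contr₁_null, contr₂_null_skew _ _ (hskew' _) (hskew' _)]
      simp [n2, h.null_l, skewForm_self, hcll', hsll, hsll', hcl1, hsl1]
    have k2 : ∀ a b : Option ((Fin 2 × Fin k) ⊕ Fin m),
        symRicci g X 1 H (nullFamily l l' (fun o : Option _ => o.elim s e))
        (nullFamily l' l (fun o : Option _ => o.elim s e)) (a.elim s e) (b.elim s e) = 0 :=
      fun a b => by
        rw [symRicci, contr₁_null, contr₁_null, contr₁_null,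
          contr₂_null_skew _ _ (hskew' _) (hskew' _)]
        simp [n2, n3, hω, hcl0, hsl0, hs0, hh]
    have k3 : ∀ a : Option ((Fin 2 × Fin k) ⊕ Fin m),
        symRicci g X 1 H (nullFamily l l' (fun o : Option _ => o.elim s e))
        (nullFamily l' l (fun o : Option _ => o.elim s e)) (a.elim s e) l' = 0 := fun a => by
      rw [symRicci, contr₁_null, contr₁_null, contr₁_null,
        contr₂_null_skew _ _ (hskew' _) (hskew' _)]
      have k4 : ∑ i : Option ((Fin 2 × Fin k) ⊕ Fin m),
          skewForm g X (a.elim s e) (i.elim s e) * symForm g X l' (i.elim s e) = 0 := by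
        rcases a with _ | a <;> simp [Fintype.sum_option, sy, sk, ass, aes, ase, al'e, ael']
      simp [n2, n3, hω, hcl0, hsl0, hs0, hh, k4, hsl'l, hcl'l]
    -- The only symmetric equation with non-zero quadratic terms in H: here the formula for ρ
    -- balances A(l',s)S(l',s) against the norm of H(l',·,·).
    have k5 : symRicci g X 1 H (nullFamily l l' (fun o : Option _ => o.elim s e))
        (nullFamily l' l (fun o : Option _ => o.elim s e)) l' l' = 0 := by
      rw [symRicci, contr₁_null, contr₁_null, contr₁_null,
        contr₂_null_skew _ _ (hskew' _) (hskew' _)]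
      have h1 := h.rho
      have h2 : ∀ j, contract H l' (e j) s = -contract H l' s (e j) := fun j =>
        contract_swap₂₃ _ _ _
      simp [n2, n3, hsl'l, hcl'l, contract_self₁₂, hself, Fintype.sum_option, hp', h.omega,
        sy, sk, al's, asl', al'e, ael', contract_self₂₃, h2, Fintype.sum_sum_type,
        Finset.sum_add_distrib] at h1 ⊢
      ring_nf at h1 ⊢
      linarith
    rintro (a | a) (b | b)
    · fin_cases a
      · exact k1 _
      · fin_cases b
        · exact (hrs _ _).trans (k1 (Sum.inl 1))
        · exact k5
    · fin_cases a
      · exact k1 _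
      · exact (hrs _ _).trans (k3 b)
    · fin_cases b
      · exact (hrs _ _).trans (k1 (Sum.inr a))
      · exact k3 a
    · exact k2 a b
  · have q0 : ∀ y z, (adForm g X).flip y z = adForm g X z y := fun _ _ => rfl
    have q1 : ∀ y, contr₁ (nullFamily l l' (fun o : Option _ => o.elim s e))
        (nullFamily l' l (fun o : Option _ => o.elim s e)) ((adForm g X).flip y)
        (contract H X l) = 0 := fun y => by
      rw [contr₁_null]; simp [n2]
    have q2 : ∀ z, contr₁ (nullFamily l l' (fun o : Option _ => o.elim s e))
        (nullFamily l' l (fun o : Option _ => o.elim s e)) ((adForm g X).flip l)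
        (contract H X z) = 0 := fun z => by
      have q3 : ∀ a : Option ((Fin 2 × Fin k) ⊕ Fin m), adForm g X (a.elim s e) l = 0 := by
        rintro (_ | a)
        exacts [asl, ael a]
      rw [contr₁_null]; simp [q0, al, al'l, q3]
    have q4 : ∀ y (a : Option ((Fin 2 × Fin k) ⊕ Fin m)),
        contr₁ (nullFamily l l' (fun o : Option _ => o.elim s e))
        (nullFamily l' l (fun o : Option _ => o.elim s e)) ((adForm g X).flip y)
        (contract H X (a.elim s e)) = 0 := fun y a => by
      rw [contr₁_null]; simp [q0, n3, al, hω]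
    have q5 : ∀ a : Option ((Fin 2 × Fin k) ⊕ Fin m),
        contr₁ (nullFamily l l' (fun o : Option _ => o.elim s e))
        (nullFamily l' l (fun o : Option _ => o.elim s e)) ((adForm g X).flip (a.elim s e))
        (contract H X l') = 0 := fun a => by
      rw [contr₁_null]; simp only [q0, n3, al, hD, zero_mul, mul_zero, add_zero]
    have q6 : ∀ a c, contr₁ (nullFamily l l' (fun o : Option _ => o.elim s e))
        (nullFamily l' l (fun o : Option _ => o.elim s e))
        ((adForm g X).flip (nullFamily l l' (fun o : Option _ => o.elim s e) a))
        (contract H X (nullFamily l l' (fun o : Option _ => o.elim s e) c))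
        = contr₁ (nullFamily l l' (fun o : Option _ => o.elim s e))
        (nullFamily l' l (fun o : Option _ => o.elim s e))
        ((adForm g X).flip (nullFamily l l' (fun o : Option _ => o.elim s e) c))
        (contract H X (nullFamily l l' (fun o : Option _ => o.elim s e) a)) := by
      rintro (a | a) (b | b)
      · fin_cases a
        · exact (q2 _).trans (q1 _).symm
        · fin_cases b
          · exact (q1 _).trans (q2 _).symm
          · rfl
      · fin_cases a
        · exact (q2 _).trans (q1 _).symm
        · exact (q4 _ b).trans (q5 b).symm
      · fin_cases b
        · exact (q1 _).trans (q2 _).symm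
        · exact (q5 a).trans (q4 _ a).symm
      · exact (q4 _ b).trans (q4 _ a).symm
    exact fun a c => (q6 a c).trans (F.isDualFrame.contr₁_comm _ _)

end NormalFrame

/-! ### From null frames to orthonormal bases and back. -/

section Translation

variable {V : Type*} [AddCommGroup V] [Module ℝ V] {g : PseudoMetric V} {N : Submodule ℝ V}

/-- The orthonormal family determined by a null frame `(l, l', s, e)`. -/
def lorentzFamily {κ : Type*} (l l' s : V) (e : κ → V) : Fin 3 ⊕ κ → V :=
  Sum.elim ![(√2)⁻¹ • (l' - l), s, (√2)⁻¹ • (l + l')] e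

theorem inv_sqrt_two_mul : (√2)⁻¹ * (√2)⁻¹ = (1 / 2 : ℝ) := by
  rw [← mul_inv, Real.mul_self_sqrt (by norm_num)]; norm_num

theorem two_mul_inv_sqrt_two : 2 * (√2)⁻¹ = √2 := by
  have h := Real.mul_self_sqrt (show (0 : ℝ) ≤ 2 by norm_num)
  have h0 : √2 ≠ 0 := by positivity
  field_simp
  linarith

section Lorentz

variable {κ : Type*} [Fintype κ] [DecidableEq κ] {l l' s : V} {e : κ → V}

omit [Fintype κ] [DecidableEq κ] in
theorem lorentzFamily_sub :
    lorentzFamily l l' s e (Sum.inl 2) - lorentzFamily l l' s e (Sum.inl 0) = √2 • l := by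
  rw [← two_mul_inv_sqrt_two]
  simp only [lorentzFamily, Sum.elim_inl, Matrix.cons_val]
  module

omit [Fintype κ] [DecidableEq κ] in
theorem lorentzFamily_add :
    lorentzFamily l l' s e (Sum.inl 2) + lorentzFamily l l' s e (Sum.inl 0) = √2 • l' := by
  rw [← two_mul_inv_sqrt_two]
  simp only [lorentzFamily, Sum.elim_inl, Matrix.cons_val]
  module

namespace IsNullFrame

theorem isLorentzFrame (F : IsNullFrame g N l l' (fun o : Option κ => o.elim s e)) :
    g.IsLorentzFrame (Sum.inl 0) (lorentzFamily l l' s e) := by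
  have hl'l : g.form l' l = 1 := by rw [form_comm, F.pair]
  have hle : ∀ i, g.form l (e i) = 0 := fun i => F.orth (some i)
  have hl'e : ∀ i, g.form l' (e i) = 0 := fun i => F.orth' (some i)
  have hls : g.form l s = 0 := F.orth none
  have hl's : g.form l' s = 0 := F.orth' none
  have hss : g.form s s = 1 := by simpa using F.orthonormal none none
  have hse : ∀ i, g.form s (e i) = 0 := fun i => F.orthonormal none (some i)
  have hes : ∀ i, g.form (e i) s = 0 := fun i => by rw [form_comm, hse]
  have hel : ∀ i, g.form (e i) l = 0 := fun i => by rw [form_comm, hle]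
  have hel' : ∀ i, g.form (e i) l' = 0 := fun i => by rw [form_comm, hl'e]
  have hsl : g.form s l = 0 := by rw [form_comm, hls]
  have hsl' : g.form s l' = 0 := by rw [form_comm, hl's]
  have h2 := inv_sqrt_two_mul
  rintro (a | i) (b | j)
  · fin_cases a <;> fin_cases b <;>
      simp [lorentzFamily, F.null, F.null', F.pair, hl'l, hls, hl's, hsl, hsl', hss] <;> linarith
  · fin_cases a <;> simp [lorentzFamily, hle, hl'e, hse]
  · fin_cases b <;> simp [lorentzFamily, hel, hel', hes]
  · simpa [lorentzFamily] using F.orthonormal (some i) (some j)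

theorem lorentzFamily_mem (F : IsNullFrame g N l l' (fun o : Option κ => o.elim s e)) (i) :
    lorentzFamily l l' s e i ∈ N := by
  rcases i with a | i
  · fin_cases a
    · exact N.smul_mem _ (N.sub_mem F.mem' F.mem)
    · exact F.mem_e none
    · exact N.smul_mem _ (N.add_mem F.mem F.mem')
  · exact F.mem_e (some i)

theorem exists_eq_sum_lorentzFamily (F : IsNullFrame g N l l' (fun o : Option κ => o.elim s e))
    {v : V} (hv : v ∈ N) : ∃ a : Fin 3 ⊕ κ → ℝ, v = ∑ i, a i • lorentzFamily l l' s e i := by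
  refine ⟨Sum.elim ![(√2)⁻¹ * (g.form v l - g.form v l'), g.form v s,
    (√2)⁻¹ * (g.form v l + g.form v l')] fun i => g.form v (e i), ?_⟩
  have h1 := F.expand v hv
  rw [Fintype.sum_option] at h1
  rw [Fintype.sum_sum_type, Fin.sum_univ_three]
  simp only [Sum.elim_inl, Sum.elim_inr, lorentzFamily, Matrix.cons_val, Option.elim] at h1 ⊢
  nth_rewrite 1 [h1]
  simp only [smul_smul, mul_right_comm _ _ (√2)⁻¹, inv_sqrt_two_mul]
  module

/-- An orthonormal family with one timelike vector as a null frame. -/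
theorem of_isLorentzFrame {E : Fin 3 ⊕ κ → V} (hE : g.IsLorentzFrame (Sum.inl 0) E)
    (hm : ∀ i, E i ∈ N) (hspan : ∀ v ∈ N, ∃ a : Fin 3 ⊕ κ → ℝ, v = ∑ i, a i • E i) :
    IsNullFrame g N ((√2)⁻¹ • (E (Sum.inl 2) - E (Sum.inl 0)))
      ((√2)⁻¹ • (E (Sum.inl 2) + E (Sum.inl 0)))
      (fun o : Option κ => o.elim (E (Sum.inl 1)) (fun i => E (Sum.inr i))) := by
  have h2 := inv_sqrt_two_mul
  refine ⟨N.smul_mem _ (N.sub_mem (hm _) (hm _)), N.smul_mem _ (N.add_mem (hm _) (hm _)), ?_,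
    ?_, ?_, ?_, ?_, ?_, ?_, fun v hv => ?_⟩
  · rintro (_ | i) <;> exact hm _
  · simp [hE _ _]
  · simp [hE _ _]
  · simp [hE _ _]; linarith
  · rintro (_ | i) <;> simp [hE _ _]
  · rintro (_ | i) <;> simp [hE _ _]
  · rintro (_ | i) (_ | j) <;> simp [hE _ _]
  · obtain ⟨a, rfl⟩ := hspan v hv
    have h3 : ∀ w, g.form (∑ i, a i • E i) w = ∑ i, a i * g.form (E i) w := fun w => by
      simp [-Fintype.sum_sum_type]
    simp only [h3, Fintype.sum_option, Option.elim, map_smul, map_add, map_sub, hE _ _, smul_eq_mul]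
    simp only [Fintype.sum_sum_type, Fin.sum_univ_three]
    simp
    match_scalars
    all_goals first
      | ring1
      | linear_combination -2 * a (Sum.inl 0) * h2
      | linear_combination -2 * a (Sum.inl 2) * h2

end IsNullFrame

end Lorentz

section Dual

variable {k m : ℕ} {l l' s : V} {e : (Fin 2 × Fin k) ⊕ Fin m → V}
  {B : Basis (Idx k m) ℝ N}

/-- As e₁ is timelike, e¹ = -g(e₁,·), and the sum with e³ is g(e₃ - e₁,·). -/
theorem coframe_dual [FiniteDimensional ℝ V] (F : IsNullFrame g N l l' (fun o : Option _ => o.elim s e))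
    (hB : frame B = lorentzFamily l l' s e) :
    dual₃ g B 0 + dual₃ g B 2 = √2 • g.form l ∧ dual₃ g B 1 = g.form s := by
  have h := F.isLorentzFrame
  have hf : ∀ x v, g.flat x v = g.form x v := fun _ _ => rfl
  constructor
  · rw [← LinearMap.map_smul, ← lorentzFamily_sub (l' := l') (s := s) (e := e)]
    unfold dual₃ PseudoMetric.coframe
    rw [hB, h, h]
    ext v
    simp [hf]
    ring
  · unfold dual₃ PseudoMetric.coframe
    rw [hB, h]
    ext v
    simp [hf, lorentzFamily]

/-- The columns of the normal form in terms of a null frame. -/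
theorem apply_eq_normalForm_iff (T : V →ₗ[ℝ] V) (c : Fin k → ℝ)
    (u : (Fin 2 × Fin k) ⊕ Fin m → ℝ) (ρ : ℝ) :
    (∀ j, T (lorentzFamily l l' s e j)
        = ∑ i, normalForm k m c u ρ i j • lorentzFamily l l' s e i) ↔
      T l = 0 ∧ T l' = (1 - ρ) • s + ∑ j, (√2 * u j) • e j ∧ T s = (1 + ρ) • l ∧
        ∀ j, T (e j) = -(√2 * u j) • l + ∑ i, rotationMatrix k m c i j • e i := by
  have h2 := inv_sqrt_two_mul
  have h3 := two_mul_inv_sqrt_two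
  have h0 : √2 ≠ 0 := by positivity
  have hl := lorentzFamily_sub (l := l) (l' := l') (s := s) (e := e)
  have hl' := lorentzFamily_add (l := l) (l' := l') (s := s) (e := e)
  have c0 : ∑ i, normalForm k m c u ρ i (Sum.inl 0) • lorentzFamily l l' s e i
      = ((1 - ρ) / √2) • s + ∑ j, u j • e j := by
    rw [Fintype.sum_sum_type, Fin.sum_univ_three]
    simp [normalForm, lorentzFamily, -Fintype.sum_sum_type]
  have c1 : ∑ i, normalForm k m c u ρ i (Sum.inl 1) • lorentzFamily l l' s e i
      = (1 + ρ) • l := by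
    have h4 : l = (√2)⁻¹ • (√2 • l) := by rw [smul_smul, inv_mul_cancel₀ h0, one_smul]
    rw [Fintype.sum_sum_type, Fin.sum_univ_three]
    conv_rhs => rw [h4, ← hl]
    simp [normalForm, -Fintype.sum_sum_type, div_eq_mul_inv]
    module
  have c2 : ∑ i, normalForm k m c u ρ i (Sum.inl 2) • lorentzFamily l l' s e i
      = ((1 - ρ) / √2) • s + ∑ j, u j • e j := by
    rw [Fintype.sum_sum_type, Fin.sum_univ_three]
    simp [normalForm, lorentzFamily, -Fintype.sum_sum_type]
  have c3 : ∀ j, ∑ i, normalForm k m c u ρ i (Sum.inr j) • lorentzFamily l l' s e i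
      = -(√2 * u j) • l + ∑ i, rotationMatrix k m c i j • e i := fun j => by
    rw [neg_smul, mul_comm, mul_smul, ← hl, Fintype.sum_sum_type, Fin.sum_univ_three]
    simp [normalForm, rotationMatrix, -Fintype.sum_sum_type]
    simp [lorentzFamily, -Fintype.sum_sum_type]
    module
  -- The first and third columns of the normal form agree, so their difference gives Tl = 0 and
  -- their sum, twice the common column, gives √2 Tl'.
  have hd : (2 : ℝ) • (((1 - ρ) / √2) • s + ∑ j, u j • e j)
      = √2 • ((1 - ρ) • s + ∑ j, (√2 * u j) • e j) := by
    have h4 : √2 * √2 = 2 := Real.mul_self_sqrt (by norm_num)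
    have h5 : 2 * ((1 - ρ) / √2) = √2 * (1 - ρ) := by
      rw [div_eq_mul_inv]; linear_combination (1 - ρ) * h3
    rw [smul_add, smul_add, smul_smul, smul_smul, h5, Finset.smul_sum, Finset.smul_sum]
    congr 1
    refine Finset.sum_congr rfl fun j _ => ?_
    rw [smul_smul, smul_smul, ← mul_assoc, h4]
  constructor
  · intro h
    refine ⟨?_, ?_, (h (Sum.inl 1)).trans c1, fun j => (h (Sum.inr j)).trans (c3 j)⟩
    · have h4 : T (√2 • l) = 0 := by
        rw [← hl, map_sub, h, h, c0, c2, sub_self]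
      rw [map_smul] at h4
      exact (smul_eq_zero.1 h4).resolve_left h0
    · have h4 : T (√2 • l') = √2 • ((1 - ρ) • s + ∑ j, (√2 * u j) • e j) := by
        rw [← hl', map_add, h, h, c0, c2, ← two_smul ℝ, hd]
      rw [map_smul] at h4
      exact smul_right_injective V h0 h4
  · rintro ⟨k1, k2, k3, k4⟩
    have h4 : (√2)⁻¹ • ((1 - ρ) • s + ∑ j, (√2 * u j) • e j)
        = ((1 - ρ) / √2) • s + ∑ j, u j • e j := by
      have h5 : (√2)⁻¹ = 2⁻¹ * √2 := by linear_combination (1 / 2) * h3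
      rw [h5, mul_smul, ← hd, smul_smul]
      norm_num
    rintro (j | j)
    · fin_cases j
      · refine Eq.trans ?_ c0.symm
        simp only [lorentzFamily, Sum.elim_inl, Matrix.cons_val, Fin.zero_eta, map_smul, map_sub,
          k1, k2, sub_zero, h4]
      · exact k3.trans c1.symm
      · refine Eq.trans ?_ c2.symm
        simp only [lorentzFamily, Sum.elim_inl, Matrix.cons_val, Fin.reduceFinMk, map_smul, map_add,
          k1, k2, zero_add, h4]
    · exact (k4 j).trans (c3 j).symm

end Dual

end Translation

/-! ### Forms on the span of a family, and orthogonal projection. -/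

section Span

variable {V : Type*} [AddCommGroup V] [Module ℝ V] {g : PseudoMetric V} {ι : Type*} {v : ι → V}

theorem forall_mem_span_range_form_eq_zero_iff {x : V} :
    (∀ y ∈ Submodule.span ℝ (Set.range v), g.form x y = 0) ↔ ∀ i, g.form x (v i) = 0 := by
  refine ⟨fun h i => h _ (Submodule.subset_span ⟨i, rfl⟩), fun h y hy => ?_⟩
  have h1 : Submodule.span ℝ (Set.range v) ≤ LinearMap.ker (g.form x) :=
    Submodule.span_le.2 (by rintro _ ⟨i, rfl⟩; exact h i)
  exact h1 hy

theorem isOneFormOn_span_iff {β : Dual ℝ V} :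
    IsOneFormOn g (Submodule.span ℝ (Set.range v)) β
      ↔ ∀ x, (∀ i, g.form x (v i) = 0) → β x = 0 := by
  simp only [IsOneFormOn, forall_mem_span_range_form_eq_zero_iff]

theorem isTwoFormOn_span_iff {τ : LinearMap.BilinForm ℝ V} :
    IsTwoFormOn g (Submodule.span ℝ (Set.range v)) τ
      ↔ τ.IsAlt ∧ ∀ x, (∀ i, g.form x (v i) = 0) → ∀ z, τ x z = 0 := by
  simp only [IsTwoFormOn, forall_mem_span_range_form_eq_zero_iff]

theorem bilin_eq_zero_of_span {S T : Set V} {u : LinearMap.BilinForm ℝ V}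
    (h : ∀ y ∈ S, ∀ z ∈ T, u y z = 0) :
    ∀ y ∈ Submodule.span ℝ S, ∀ z ∈ Submodule.span ℝ T, u y z = 0 := by
  intro y hy z hz
  have h1 : ∀ y ∈ S, Submodule.span ℝ T ≤ LinearMap.ker (u y) := fun y hy =>
    Submodule.span_le.2 fun z hz => h y hy z hz
  have h2 : Submodule.span ℝ S ≤ LinearMap.ker (u.flip z) :=
    Submodule.span_le.2 fun y hy => h1 y hy hz
  exact h2 hy

variable [Fintype ι] [DecidableEq ι]

variable (g v) in
/-- The orthogonal projection to the span of an orthonormal family. -/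
def frameProj : V →ₗ[ℝ] V := ∑ i, (g.form (v i)).smulRight (v i)

omit [DecidableEq ι] in
theorem frameProj_eq_zero {x : V} (h : ∀ i, g.form x (v i) = 0) : frameProj g v x = 0 := by
  simp [frameProj, form_comm g _ x, h]

theorem frameProj_apply_self (hv : ∀ i j, g.form (v i) (v j) = if i = j then 1 else 0) (i : ι) :
    frameProj g v (v i) = v i := by
  simp [frameProj, LinearMap.sum_apply, hv]

end Span

/-! ### The complex structure on U₁. -/

section ComplexStructure

variable {V : Type*} [AddCommGroup V] [Module ℝ V] [FiniteDimensional ℝ V] {g : PseudoMetric V}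
  {k : ℕ} {v : Fin 2 × Fin k → V}

theorem complexStructure_apply (hv : ∀ p q, g.form (v p) (v q) = if p = q then 1 else 0)
    (i : Fin k) : complexStructure g v (v (0, i)) = v (1, i) ∧
      complexStructure g v (v (1, i)) = -v (0, i) := by
  have hf : ∀ x y, g.flat x y = g.form x y := fun _ _ => rfl
  have h1 : ∀ r, complexStructure g v (v r)
      = ∑ q, Matrix.blockDiagonal (fun _ : Fin k => L₁ 0 1) q r • v q := fun r => by
    simp only [complexStructure, PseudoMetric.coframe, LinearMap.sum_apply, LinearMap.smul_apply,
      LinearMap.smulRight_apply, hv, hf]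
    rw [Finset.sum_eq_single r]
    · simp
    · intro p _ hp
      simp [hp]
    · simp
  constructor
  · rw [h1, Finset.sum_eq_single (1, i)]
    · simp [Matrix.blockDiagonal_apply, L₁]
    · rintro ⟨b, j⟩ - hj
      fin_cases b
      · by_cases hij : j = i <;> simp [Matrix.blockDiagonal_apply, L₁, hij]
      · have hij : j ≠ i := fun h => hj (by rw [h]; rfl)
        simp [Matrix.blockDiagonal_apply, hij]
    · simp
  · rw [h1, Finset.sum_eq_single (0, i)]
    · simp [Matrix.blockDiagonal_apply, L₁]
    · rintro ⟨b, j⟩ - hj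
      fin_cases b
      · have hij : j ≠ i := fun h => hj (by rw [h]; rfl)
        simp [Matrix.blockDiagonal_apply, hij]
      · by_cases hij : j = i <;> simp [Matrix.blockDiagonal_apply, L₁, hij]
    · simp

end ComplexStructure

/-! ### The two-form dividing H, and its components. -/

section Flux

variable {𝔤 : Type*} [LieRing 𝔤] [LieAlgebra ℝ 𝔤] [FiniteDimensional ℝ 𝔤] {g : PseudoMetric 𝔤}
  {H : 𝔤 [⋀^Fin 3]→ₗ[ℝ] ℝ} {N : Submodule ℝ 𝔤} {X : 𝔤} {k m : ℕ} {l l' s : 𝔤}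
  {e : (Fin 2 × Fin k) ⊕ Fin m → 𝔤}

/-- The two-form `-e² ∧ (ν + b X♭) + β ∧ X♭ + τ₁ + τ₂`. -/
def fluxForm (g : PseudoMetric 𝔤) (X s : 𝔤) (b : ℝ) (β ν : Dual ℝ 𝔤)
    (τ₁ τ₂ : LinearMap.BilinForm ℝ 𝔤) : LinearMap.BilinForm ℝ 𝔤 :=
  -wedge₁₁ (g.form s) (ν + b • g.flat X) + wedge₁₁ β (g.flat X) + τ₁ + τ₂

/-- The forms `β, ν, τ₁, τ₂` are forms on the spans of the two parts of `e`. -/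
structure IsFluxData (g : PseudoMetric 𝔤) (e : (Fin 2 × Fin k) ⊕ Fin m → 𝔤) (β ν : Dual ℝ 𝔤)
    (τ₁ τ₂ : LinearMap.BilinForm ℝ 𝔤) : Prop where
  hβ : ∀ x, (∀ q, g.form x (e (Sum.inr q)) = 0) → β x = 0
  hν : ∀ x, (∀ q, g.form x (e (Sum.inr q)) = 0) → ν x = 0
  alt₁ : τ₁.IsAlt
  hτ₁ : ∀ x, (∀ p, g.form x (e (Sum.inl p)) = 0) → ∀ z, τ₁ x z = 0
  alt₂ : τ₂.IsAlt
  hτ₂ : ∀ x, (∀ q, g.form x (e (Sum.inr q)) = 0) → ∀ z, τ₂ x z = 0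

variable {b : ℝ} {β ν : Dual ℝ 𝔤} {τ₁ τ₂ : LinearMap.BilinForm ℝ 𝔤}

theorem fluxForm_apply (y z : 𝔤) : fluxForm g X s b β ν τ₁ τ₂ y z
    = -(g.form s y * (ν z + b * g.form X z) - (ν y + b * g.form X y) * g.form s z)
      + (β y * g.form X z - g.form X y * β z) + τ₁ y z + τ₂ y z := rfl

theorem IsFluxData.skew (D : IsFluxData g e β ν τ₁ τ₂) (y z : 𝔤) :
    fluxForm g X s b β ν τ₁ τ₂ z y = -fluxForm g X s b β ν τ₁ τ₂ y z := by
  rw [fluxForm_apply, fluxForm_apply, ← D.alt₁.neg_eq y z, ← D.alt₂.neg_eq y z]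
  ring

/-- The values of the flux form in a null frame. -/
structure FluxValues (Ω : LinearMap.BilinForm ℝ 𝔤) (X l l' s : 𝔤)
    (e : (Fin 2 × Fin k) ⊕ Fin m → 𝔤) (b : ℝ) (β ν : Dual ℝ 𝔤)
    (τ₁ τ₂ : LinearMap.BilinForm ℝ 𝔤) : Prop where
  apply_l : ∀ z, Ω l z = 0
  apply_l' : ∀ z, Ω l' z = 0
  X_s : Ω X s = b
  X_inl : ∀ p, Ω X (e (Sum.inl p)) = 0
  X_inr : ∀ q, Ω X (e (Sum.inr q)) = -β (e (Sum.inr q))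
  s_inl : ∀ p, Ω s (e (Sum.inl p)) = 0
  s_inr : ∀ q, Ω s (e (Sum.inr q)) = -ν (e (Sum.inr q))
  inl_inl : ∀ p p', Ω (e (Sum.inl p)) (e (Sum.inl p')) = τ₁ (e (Sum.inl p)) (e (Sum.inl p'))
  inl_inr : ∀ p q, Ω (e (Sum.inl p)) (e (Sum.inr q)) = 0
  inr_inr : ∀ q q', Ω (e (Sum.inr q)) (e (Sum.inr q')) = τ₂ (e (Sum.inr q)) (e (Sum.inr q'))

/-- Each of β, ν, τ₁, τ₂ vanishes on the frame vectors outside its own block, since these are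
orthogonal to that block. -/
theorem IsFluxData.fluxValues (D : IsFluxData g e β ν τ₁ τ₂)
    (F : IsNullFrame g N l l' (fun o : Option _ => o.elim s e)) (hA : IsAlmostAbelian g N X 1)
    (b : ℝ) : FluxValues (fluxForm g X s b β ν τ₁ τ₂) X l l' s e b β ν τ₁ τ₂ := by
  have hle : ∀ i, g.form l (e i) = 0 := fun i => F.orth (some i)
  have hl'e : ∀ i, g.form l' (e i) = 0 := fun i => F.orth' (some i)
  have hsl : g.form s l = 0 := by rw [form_comm]; exact F.orth none
  have hsl' : g.form s l' = 0 := by rw [form_comm]; exact F.orth' none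
  have hss : g.form s s = 1 := by simpa using F.orthonormal none none
  have hse : ∀ i, g.form s (e i) = 0 := fun i => F.orthonormal none (some i)
  have hee : ∀ i j, g.form (e i) (e j) = if i = j then 1 else 0 := fun i j => by
    simpa using F.orthonormal (some i) (some j)
  have hXX := hA.norm
  have hXe : ∀ i, g.form X (e i) = 0 := fun i => hA.orth _ (F.mem_e (some i))
  have hXs : g.form X s = 0 := hA.orth _ (F.mem_e none)
  have hXl : g.form X l = 0 := hA.orth _ F.mem
  have hXl' : g.form X l' = 0 := hA.orth _ F.mem'
  have hsX : g.form s X = 0 := by rw [form_comm, hXs]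
  have hi : ∀ p q, g.form (e (Sum.inl p)) (e (Sum.inr q)) = 0 := fun p q => by simp [hee]
  have hi' : ∀ p q, g.form (e (Sum.inr q)) (e (Sum.inl p)) = 0 := fun p q => by simp [hee]
  have bX : β X = 0 := D.hβ _ fun _ => hXe _
  have bs : β s = 0 := D.hβ _ fun _ => hse _
  have bl : β l = 0 := D.hβ _ fun _ => hle _
  have bl' : β l' = 0 := D.hβ _ fun _ => hl'e _
  have bi : ∀ p, β (e (Sum.inl p)) = 0 := fun p => D.hβ _ fun _ => hi _ _
  have nX : ν X = 0 := D.hν _ fun _ => hXe _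
  have ns : ν s = 0 := D.hν _ fun _ => hse _
  have nl : ν l = 0 := D.hν _ fun _ => hle _
  have nl' : ν l' = 0 := D.hν _ fun _ => hl'e _
  have ni : ∀ p, ν (e (Sum.inl p)) = 0 := fun p => D.hν _ fun _ => hi _ _
  have tX := D.hτ₁ X fun _ => hXe _
  have ts := D.hτ₁ s fun _ => hse _
  have tl := D.hτ₁ l fun _ => hle _
  have tl' := D.hτ₁ l' fun _ => hl'e _
  have ti := fun q => D.hτ₁ (e (Sum.inr q)) fun _ => hi' _ _
  have ti' : ∀ q z, τ₁ z (e (Sum.inr q)) = 0 := fun q z => by rw [← D.alt₁.neg_eq, ti, neg_zero]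
  have t2X := D.hτ₂ X fun _ => hXe _
  have t2s := D.hτ₂ s fun _ => hse _
  have t2l := D.hτ₂ l fun _ => hle _
  have t2l' := D.hτ₂ l' fun _ => hl'e _
  have t2i := fun p => D.hτ₂ (e (Sum.inl p)) fun _ => hi _ _
  constructor <;> intros <;> rw [fluxForm_apply] <;>
    simp [hsl, hsl', hss, hse, hXX, hXe, hXs, hXl, hXl', hsX, bX, bs, bl, bl', bi, nX, ns, nl, nl',
      ni, tX, ts, tl, tl', ti, ti', t2X, t2s, t2l, t2l', t2i]

-- Identifies the number ρ of a normal frame with ρ̃: the factor √2 squares to 2, and the full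
-- double sums count every two-form component twice.
omit [FiniteDimensional ℝ 𝔤] in
theorem FluxValues.sum_sq {Ω : LinearMap.BilinForm ℝ 𝔤} (K : FluxValues Ω X l l' s e b β ν τ₁ τ₂)
    (hΩ : ∀ y z, Ω z y = -Ω y z) :
    (√2 * Ω X s) ^ 2 + ∑ q, (√2 * Ω X (e (Sum.inr q))) ^ 2 + ∑ j, (√2 * Ω s (e j)) ^ 2
      + (1 / 2) * ∑ i, ∑ j, (√2 * Ω (e i) (e j)) ^ 2
    = 4 * ((1 / 2) * (b ^ 2 + normSq₁ (fun q => e (Sum.inr q)) β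
        + normSq₁ (fun q => e (Sum.inr q)) ν + normSq₂ (fun p => e (Sum.inl p)) τ₁
        + normSq₂ (fun q => e (Sum.inr q)) τ₂)) := by
  have h2 : √2 ^ 2 = 2 := Real.sq_sqrt (by norm_num)
  have hji : ∀ p q, Ω (e (Sum.inr q)) (e (Sum.inl p)) = 0 := fun p q => by
    rw [hΩ, K.inl_inr, neg_zero]
  simp only [Fintype.sum_sum_type, mul_pow, h2, K.X_s, K.X_inr, K.s_inl, K.s_inr, K.inl_inl,
    K.inl_inr, K.inr_inr, hji, normSq₁, normSq₂, neg_sq, ← Finset.mul_sum, zero_pow two_ne_zero,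
    Finset.sum_const_zero, Finset.sum_add_distrib]
  ring

omit [FiniteDimensional ℝ 𝔤] in
/-- Two skew forms with the same values in a null frame are equal. -/
theorem FluxValues.eq {Q Ω : LinearMap.BilinForm ℝ 𝔤}
    (F : IsNullFrame g N l l' (fun o : Option _ => o.elim s e)) (hA : IsAlmostAbelian g N X 1)
    (K : FluxValues Q X l l' s e b β ν τ₁ τ₂) (K' : FluxValues Ω X l l' s e b β ν τ₁ τ₂)
    (hQ : ∀ y z, Q z y = -Q y z) (hΩ : ∀ y z, Ω z y = -Ω y z) : Q = Ω := by
  set D := Q - Ω with hD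
  have hDa : ∀ y z, D y z = Q y z - Ω y z := fun _ _ => rfl
  have hsk : ∀ y z, D z y = -D y z := fun y z => by rw [hDa, hDa, hQ, hΩ]; ring
  have hself : ∀ y, D y y = 0 := fun y => by have := hsk y y; linarith
  have d1 : ∀ z, D l z = 0 := fun z => by rw [hDa, K.apply_l, K'.apply_l, sub_zero]
  have d1' : ∀ z, D z l = 0 := fun z => by rw [hsk, d1, neg_zero]
  have d2 : ∀ z, D l' z = 0 := fun z => by rw [hDa, K.apply_l', K'.apply_l', sub_zero]
  have d2' : ∀ z, D z l' = 0 := fun z => by rw [hsk, d2, neg_zero]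
  have d3 : D X s = 0 := by rw [hDa, K.X_s, K'.X_s, sub_self]
  have d4 : ∀ j, D X (e j) = 0 := by
    rintro (j | j)
    · rw [hDa, K.X_inl, K'.X_inl, sub_zero]
    · rw [hDa, K.X_inr, K'.X_inr, sub_self]
  have d5 : ∀ j, D s (e j) = 0 := by
    rintro (j | j)
    · rw [hDa, K.s_inl, K'.s_inl, sub_zero]
    · rw [hDa, K.s_inr, K'.s_inr, sub_self]
  have d6 : ∀ i j, D (e i) (e j) = 0 := by
    rintro (i | i) (j | j)
    · rw [hDa, K.inl_inl, K'.inl_inl, sub_self]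
    · rw [hDa, K.inl_inr, K'.inl_inr, sub_zero]
    · rw [hsk, hDa, K.inl_inr, K'.inl_inr]; simp
    · rw [hDa, K.inr_inr, K'.inr_inr, sub_self]
  have h0 := (hA.isDualFrame_option F.isDualFrame).apply₂_eq_zero (u := D) (by
    rintro (_ | (a | (_ | i))) (_ | (c | (_ | j)))
    · exact hself X
    · fin_cases c
      exacts [d1' _, d2' _]
    · exact d3
    · exact d4 j
    · fin_cases a
      exacts [d1 _, d2 _]
    · fin_cases a
      exacts [d1 _, d2 _]
    · fin_cases a
      exacts [d1 _, d2 _]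
    · fin_cases a
      exacts [d1 _, d2 _]
    · exact (hsk _ _).trans (neg_eq_zero.2 d3)
    · fin_cases c
      exacts [d1' _, d2' _]
    · exact hself s
    · exact d5 j
    · exact (hsk _ _).trans (neg_eq_zero.2 (d4 i))
    · fin_cases c
      exacts [d1' _, d2' _]
    · exact (hsk _ _).trans (neg_eq_zero.2 (d5 i))
    · exact d6 i j)
  refine sub_eq_zero.1 ?_
  ext y z
  exact h0 y trivial z trivial

/-- The three-form of a normal frame in terms of flux data. -/
theorem IsNormalFrame.exists_flux {c : Fin k → ℝ} {u : (Fin 2 × Fin k) ⊕ Fin m → ℝ} {ρ : ℝ}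
    (h : IsNormalFrame g H N X l l' s e c u ρ) (hA : IsAlmostAbelian g N X 1)
    (hs : ∀ p, contract H l' s (e (Sum.inl p)) = 0)
    (he : ∀ p q, contract H l' (e (Sum.inl p)) (e (Sum.inr q)) = 0) :
    ∃ (b : ℝ) (β ν : Dual ℝ 𝔤) (τ₁ τ₂ : LinearMap.BilinForm ℝ 𝔤), IsFluxData g e β ν τ₁ τ₂ ∧
      contract H l' = √2 • fluxForm g X s b β ν τ₁ τ₂ ∧
      ρ = (1 / 2) * (b ^ 2 + normSq₁ (fun q => e (Sum.inr q)) β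
        + normSq₁ (fun q => e (Sum.inr q)) ν + normSq₂ (fun p => e (Sum.inl p)) τ₁
        + normSq₂ (fun q => e (Sum.inr q)) τ₂) := by
  have F := h.nullFrame
  have hee : ∀ i j, g.form (e i) (e j) = if i = j then 1 else 0 := fun i j => by
    simpa using F.orthonormal (some i) (some j)
  have h0 : √2 ≠ 0 := by positivity
  set Q : LinearMap.BilinForm ℝ 𝔤 := (√2)⁻¹ • contract H l' with hQ
  have hQa : ∀ y z, Q y z = (√2)⁻¹ * contract H l' y z := fun _ _ => rfl
  set P₁ := frameProj g (fun p => e (Sum.inl p)) with hP₁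
  set P₂ := frameProj g (fun q => e (Sum.inr q)) with hP₂
  have hP₁e : ∀ p, P₁ (e (Sum.inl p)) = e (Sum.inl p) := fun p =>
    frameProj_apply_self (v := fun p => e (Sum.inl p)) (fun p p' => by simp [hee]) p
  have hP₂e : ∀ q, P₂ (e (Sum.inr q)) = e (Sum.inr q) := fun q =>
    frameProj_apply_self (v := fun q => e (Sum.inr q)) (fun p p' => by simp [hee]) q
  have hQs : ∀ y z, Q z y = -Q y z := fun y z => by
    rw [hQa, hQa, contract_swap₂₃]; ring
  have hQ0 : ∀ y, Q y y = 0 := fun y => by rw [hQa, contract_self₂₃, mul_zero]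
  -- The data are components of Q = H(l',·,·)/√2, extended by zero by means of the orthogonal
  -- projections to the two blocks; the signs match those of the flux form.
  have D : IsFluxData g e (-(Q X ∘ₗ P₂)) (-(Q s ∘ₗ P₂)) (Q.compl₁₂ P₁ P₁) (Q.compl₁₂ P₂ P₂) := by
    refine ⟨fun x hx => ?_, fun x hx => ?_, fun x => hQ0 _, fun x hx z => ?_, fun x => hQ0 _,
      fun x hx z => ?_⟩
    · simp [hP₂, frameProj_eq_zero hx]
    · simp [hP₂, frameProj_eq_zero hx]
    · simp [hP₁, frameProj_eq_zero hx]
    · simp [hP₂, frameProj_eq_zero hx]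
  have K : FluxValues Q X l l' s e (Q X s) (-(Q X ∘ₗ P₂)) (-(Q s ∘ₗ P₂)) (Q.compl₁₂ P₁ P₁)
      (Q.compl₁₂ P₂ P₂) := by
    refine ⟨fun z => ?_, fun z => ?_, rfl, fun p => ?_, fun q => ?_, fun p => ?_, fun q => ?_,
      fun p p' => ?_, fun p q => ?_, fun q q' => ?_⟩
    · rw [hQa, contract_swap₁₂, h.null_l]; simp
    · rw [hQa, contract_self₁₂, mul_zero]
    · rw [hQa, h.omega, mul_zero]
    · simp [hP₂e]
    · rw [hQa, hs, mul_zero]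
    · simp [hP₂e]
    · simp [hP₁e]
    · rw [hQa, he, mul_zero]
    · simp [hP₂e]
  have h1 := FluxValues.eq F hA K (D.fluxValues F hA _) hQs D.skew
  have h2 : contract H l' = √2 • Q := by rw [hQ, smul_smul, mul_inv_cancel₀ h0, one_smul]
  refine ⟨_, _, _, _, _, D, by rw [← h1, h2], ?_⟩
  have h3 := K.sum_sq hQs
  have h4 := h.rho
  rw [h2] at h4
  have h5 : ∀ y z, (√2 • Q) y z = √2 * Q y z := fun _ _ => rfl
  simp only [h5] at h4
  rw [h3] at h4
  linarith

end Flux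

/-! ### Assembly of both directions. -/

section Translation

variable {𝔤 : Type*} [LieRing 𝔤] [LieAlgebra ℝ 𝔤] [FiniteDimensional ℝ 𝔤] {g : PseudoMetric 𝔤}
  {H : 𝔤 [⋀^Fin 3]→ₗ[ℝ] ℝ} {N : Submodule ℝ 𝔤} {X : 𝔤} {k m : ℕ} {l l' s : 𝔤}
  {e : (Fin 2 × Fin k) ⊕ Fin m → 𝔤} {b : ℝ} {β ν : Dual ℝ 𝔤} {τ₁ τ₂ : LinearMap.BilinForm ℝ 𝔤}
  {c : Fin k → ℝ} {u : (Fin 2 × Fin k) ⊕ Fin m → ℝ} {ρ : ℝ} {B : Basis (Idx k m) ℝ N}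

omit [FiniteDimensional ℝ 𝔤] in
theorem IsNullFrame.exists_basis (F : IsNullFrame g N l l' (fun o : Option _ => o.elim s e))
    (hnondeg : (g.form.restrict N).Nondegenerate) :
    ∃ B : Basis (Idx k m) ℝ N, frame B = lorentzFamily l l' s e := by
  obtain ⟨B, hB⟩ := exists_basis_of_isLorentzFrame (g := g.restrict N hnondeg)
    (i₀ := (Sum.inl 0 : Idx k m))
    (b := fun i => ⟨lorentzFamily l l' s e i, F.lorentzFamily_mem i⟩) F.isLorentzFrame
    (fun v => by
      obtain ⟨a, ha⟩ := F.exists_eq_sum_lorentzFamily v.2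
      refine ⟨a, Subtype.ext ?_⟩
      rw [Submodule.coe_sum]
      exact ha)
  exact ⟨B, funext fun i => congrArg Subtype.val (congrFun hB i)⟩

omit [FiniteDimensional ℝ 𝔤] in
/-- Every orthonormal basis of the ideal comes from a null frame. -/
theorem exists_isNullFrame_of_basis (hB : g.IsLorentzFrame (Sum.inl 0) (frame B)) :
    ∃ (l l' s : 𝔤) (e : (Fin 2 × Fin k) ⊕ Fin m → 𝔤),
      IsNullFrame g N l l' (fun o : Option _ => o.elim s e) ∧ frame B = lorentzFamily l l' s e := by
  have h2 := inv_sqrt_two_mul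
  refine ⟨_, _, _, _, IsNullFrame.of_isLorentzFrame hB (fun i => (B i).2) fun v hv =>
    ⟨B.repr ⟨v, hv⟩, ?_⟩, ?_⟩
  · have h1 := congrArg Subtype.val (B.sum_repr ⟨v, hv⟩)
    rw [Submodule.coe_sum] at h1
    exact h1.symm
  · funext i
    rcases i with a | i
    · fin_cases a
      · simp only [lorentzFamily, Fin.zero_eta, Sum.elim_inl, Matrix.cons_val, ← smul_sub,
          smul_smul, h2]
        module
      · rfl
      · simp only [lorentzFamily, Fin.reduceFinMk, Sum.elim_inl, Matrix.cons_val, ← smul_add,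
          smul_smul, h2]
        module
    · rfl

omit [FiniteDimensional ℝ 𝔤] in
theorem toMatrix_eq_normalForm_iff (hB : frame B = lorentzFamily l l' s e) (f : End ℝ N)
    (hf : ∀ y : N, (f y : 𝔤) = ⁅X, (y : 𝔤)⁆) :
    LinearMap.toMatrix B B f = normalForm k m c u ρ ↔
      ⁅X, l⁆ = 0 ∧ ⁅X, l'⁆ = (1 - ρ) • s + ∑ j, (√2 * u j) • e j ∧ ⁅X, s⁆ = (1 + ρ) • l ∧
        ∀ j, ⁅X, e j⁆ = -(√2 * u j) • l + ∑ i, rotationMatrix k m c i j • e i := by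
  have h1 := apply_eq_normalForm_iff (l := l) (l' := l') (s := s) (e := e)
    (LieAlgebra.ad ℝ 𝔤 X : 𝔤 →ₗ[ℝ] 𝔤) c u ρ
  simp only [LieAlgebra.ad_apply] at h1
  rw [← h1, ← hB]
  constructor
  · intro h j
    have h2 := congrArg Subtype.val (B.sum_repr (f (B j)))
    rw [Submodule.coe_sum, hf] at h2
    rw [← h]
    simp only [LinearMap.toMatrix_apply]
    exact h2.symm
  · intro h
    refine toMatrix_eq_of_apply B f _ fun j => Subtype.ext ?_
    rw [hf, Submodule.coe_sum]
    exact h j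

omit [FiniteDimensional ℝ 𝔤] in
theorem isFluxData_iff (hB : frame B = lorentzFamily l l' s e) :
    IsFluxData g e β ν τ₁ τ₂ ↔ IsOneFormOn g (U₂ B) β ∧ IsOneFormOn g (U₂ B) ν ∧
      IsTwoFormOn g (U₁ B) τ₁ ∧ IsTwoFormOn g (U₂ B) τ₂ := by
  have h1 : frame₁ B = fun p => e (Sum.inl p) := funext fun p => congrFun hB _
  have h2 : frame₂ B = fun q => e (Sum.inr q) := funext fun q => congrFun hB _
  rw [U₁, U₂, isOneFormOn_span_iff, isOneFormOn_span_iff, isTwoFormOn_span_iff,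
    isTwoFormOn_span_iff, h1, h2]
  exact ⟨fun D => ⟨D.hβ, D.hν, ⟨D.alt₁, D.hτ₁⟩, D.alt₂, D.hτ₂⟩,
    fun h => ⟨h.1, h.2.1, h.2.2.1.1, h.2.2.1.2, h.2.2.2.1, h.2.2.2.2⟩⟩

/-- The three-form of the normal form divides by the null covector `√2 g(l, ·)`. -/
theorem threeForm_eq_iff (F : IsNullFrame g N l l' (fun o : Option _ => o.elim s e))
    (hA : IsAlmostAbelian g N X 1) (hB : frame B = lorentzFamily l l' s e)
    (D : IsFluxData g e β ν τ₁ τ₂) :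
    (∀ x y z, H ![x, y, z] = wedge₁₂ (dual₃ g B 0 + dual₃ g B 2)
      (-wedge₁₁ (dual₃ g B 1) (ν + b • g.flat X) + wedge₁₁ β (g.flat X) + τ₁ + τ₂) x y z) ↔
    contract H l' = √2 • fluxForm g X s b β ν τ₁ τ₂ ∧ (∀ y z, contract H l y z = 0) ∧
      ∀ x y z, contract H x y z = wedge₁₂ (g.form l) (contract H l') x y z := by
  obtain ⟨h1, h2⟩ := coframe_dual F hB
  have K := D.fluxValues F hA b
  rw [h1, h2]
  have hll := F.null
  have hll' := F.pair
  have key : ∀ x y z, wedge₁₂ (√2 • g.form l) (fluxForm g X s b β ν τ₁ τ₂) x y z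
      = √2 * wedge₁₂ (g.form l) (fluxForm g X s b β ν τ₁ τ₂) x y z := fun x y z => by
    simp only [wedge₁₂, LinearMap.smul_apply, smul_eq_mul]
    ring
  have key' : ∀ x y z, wedge₁₂ (g.form l) (√2 • fluxForm g X s b β ν τ₁ τ₂) x y z
      = √2 * wedge₁₂ (g.form l) (fluxForm g X s b β ν τ₁ τ₂) x y z := fun x y z => by
    simp only [wedge₁₂, LinearMap.smul_apply, smul_eq_mul]
    ring
  constructor
  · intro h
    replace h : ∀ x y z, contract H x y z
        = √2 * wedge₁₂ (g.form l) (fluxForm g X s b β ν τ₁ τ₂) x y z := fun x y z =>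
      (h x y z).trans (key x y z)
    have h3 : contract H l' = √2 • fluxForm g X s b β ν τ₁ τ₂ := by
      ext y z
      rw [h, wedge₁₂, hll', K.apply_l', K.apply_l']
      simp
    refine ⟨h3, fun y z => ?_, fun x y z => ?_⟩
    · rw [h, wedge₁₂, hll, K.apply_l, K.apply_l]; simp
    · rw [h3, key', h]
  · rintro ⟨h3, -, h4⟩ x y z
    rw [← contract_apply, h4, h3]
    exact (key' x y z).trans (key x y z).symm

/-- The normal form of a generalised Einstein structure. -/
theorem exists_normalForm (hA : IsAlmostAbelian g N X 1) (hN : IsLorentzOn g N)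
    (hH : IsClosedThreeForm H) (hH0 : H ≠ 0) (hE : IsGeneralisedEinstein g H 0)
    (hnondeg : (g.form.restrict N).Nondegenerate) (f : End ℝ N)
    (hf : ∀ y : N, (f y : 𝔤) = ⁅X, (y : 𝔤)⁆) {l₀ : 𝔤} (hl : l₀ ∈ N) (hl0 : l₀ ≠ 0)
    (hll : g.form l₀ l₀ = 0) {L : ℝ} (hL : ∀ z ∈ N, symForm g X l₀ z = L * g.form l₀ z) :
    ∃ (k l : ℕ) (e : Basis (Idx k l) ℝ N)
        (c : Fin k → ℝ) (u : (Fin 2 × Fin k) ⊕ Fin l → ℝ)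
        (b : ℝ) (β ν : Dual ℝ 𝔤) (τ₁ τ₂ : LinearMap.BilinForm ℝ 𝔤),
        g.IsLorentzFrame (Sum.inl 0) (frame e) ∧
        Antitone c ∧ (∀ i, 0 < c i) ∧
        IsOneFormOn g (U₂ e) β ∧ IsOneFormOn g (U₂ e) ν ∧
        IsTwoFormOn g (U₁ e) τ₁ ∧ IsTwoFormOn g (U₂ e) τ₂ ∧
        (b ≠ 0 ∨ β ≠ 0 ∨ ν ≠ 0 ∨ τ₁ ≠ 0 ∨ τ₂ ≠ 0) ∧
        (∀ Y ∈ U₁ e, ∀ Z ∈ U₁ e,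
          τ₁ (complexStructure g (frame₁ e) Y) (complexStructure g (frame₁ e) Z) = τ₁ Y Z) ∧
        (∀ i j, c i ≠ c j →
          ∀ Y ∈ Submodule.span ℝ {frame₁ e (0, i), frame₁ e (1, i)},
          ∀ Z ∈ Submodule.span ℝ {frame₁ e (0, j), frame₁ e (1, j)}, τ₁ Y Z = 0) ∧
        (∀ x y z, H ![x, y, z] = wedge₁₂ (dual₃ g e 0 + dual₃ g e 2)
            (-wedge₁₁ (dual₃ g e 1) (ν + b • g.flat X)
              + wedge₁₁ β (g.flat X) + τ₁ + τ₂) x y z) ∧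
        LinearMap.toMatrix e e f = normalForm k l c u
          ((1 / 2) * (b ^ 2 + normSq₁ (frame₂ e) β
            + normSq₁ (frame₂ e) ν + normSq₂ (frame₁ e) τ₁
            + normSq₂ (frame₂ e) τ₂)) := by
  have h0 : √2 ≠ 0 := by positivity
  obtain ⟨k, m, l, l', s, e, c, u, ρ, h, hc, hc0, hs, he, hne, hJ⟩ :=
    hN.exists_isNormalFrame hA hH hH0 hE hl hl0 hll hL
  have F := h.nullFrame
  obtain ⟨b, β, ν, τ₁, τ₂, D, hQ, hρ⟩ := h.exists_flux hA hs he
  obtain ⟨B, hB⟩ := F.exists_basis hnondeg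
  have hf1 : frame₁ B = fun p => e (Sum.inl p) := funext fun p => congrFun hB _
  have hf2 : frame₂ B = fun q => e (Sum.inr q) := funext fun q => congrFun hB _
  have hH' := (threeForm_eq_iff (H := H) (b := b) F hA hB D).2 ⟨hQ, h.null_l, h.wedge⟩
  have K := D.fluxValues F hA b
  have hτ : ∀ p p', √2 * τ₁ (e (Sum.inl p)) (e (Sum.inl p'))
      = contract H l' (e (Sum.inl p)) (e (Sum.inl p')) := fun p p' => by
    rw [hQ, ← K.inl_inl]; rfl
  obtain ⟨q1, q2, q3, q4⟩ := (isFluxData_iff hB).1 D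
  -- The coefficients of ad_X on l' are √2 times those in the matrix, hence the rescaling of u.
  refine ⟨k, m, B, c, fun j => (√2)⁻¹ * u j, b, β, ν, τ₁, τ₂, by rw [hB]; exact F.isLorentzFrame,
    hc, hc0, q1, q2, q3, q4, ?_, ?_, fun i j hij => ?_, hH', ?_⟩
  -- If all data were zero, the formula for H would give H = 0.
  · by_contra! hb
    obtain ⟨rfl, rfl, rfl, rfl, rfl⟩ := hb
    refine hH0 (AlternatingMap.ext fun v => ?_)
    have hv : v = ![v 0, v 1, v 2] := by
      ext i; fin_cases i <;> rfl
    rw [hv, hH']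
    simp [wedge₁₂, wedge₁₁]
  · have hee : ∀ p q, g.form (frame₁ B p) (frame₁ B q) = if p = q then 1 else 0 := fun p q => by
      have := F.orthonormal (some (Sum.inl p)) (some (Sum.inl q))
      simpa [hf1] using this
    have hJe := complexStructure_apply hee
    rw [hf1] at hJe
    have key := bilin_eq_zero_of_span (S := Set.range (frame₁ B)) (T := Set.range (frame₁ B))
      (u := τ₁.compl₁₂ (complexStructure g (frame₁ B)) (complexStructure g (frame₁ B)) - τ₁) (by
        rw [hf1]
        rintro _ ⟨⟨a, i⟩, rfl⟩ _ ⟨⟨d, j⟩, rfl⟩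
        obtain ⟨j1, j2⟩ := hJ i j
        rw [← hτ, ← hτ] at j1 j2
        rw [← mul_neg] at j2
        have j1' := mul_left_cancel₀ h0 j1
        have j2' := mul_left_cancel₀ h0 j2
        fin_cases a <;> fin_cases d <;>
          simp [hJe, j1', j2'])
    intro Y hY Z hZ
    have := key Y hY Z hZ
    exact sub_eq_zero.1 this
  · refine bilin_eq_zero_of_span ?_
    have hz : ∀ a d, τ₁ (frame₁ B (a, i)) (frame₁ B (d, j)) = 0 := fun a d => by
      have h1 := hτ (a, i) (d, j)
      rw [hne i j hij a d] at h1
      rw [hf1]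
      exact (mul_eq_zero.1 h1).resolve_left h0
    rintro y (rfl | rfl) z (rfl | rfl) <;> exact hz _ _
  · rw [hf1, hf2, ← hρ, toMatrix_eq_normalForm_iff hB f hf]
    simp only [← mul_assoc, mul_inv_cancel₀ h0, one_mul]
    exact ⟨h.ad_l, h.ad_l', h.ad_s, h.ad_e⟩

/-- A Lie algebra in normal form is generalised Einstein. -/
theorem isGeneralisedEinstein_of_normalForm (hA : IsAlmostAbelian g N X 1) (f : End ℝ N)
    (hf : ∀ y : N, (f y : 𝔤) = ⁅X, (y : 𝔤)⁆) (hB : g.IsLorentzFrame (Sum.inl 0) (frame B))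
    (q1 : IsOneFormOn g (U₂ B) β) (q2 : IsOneFormOn g (U₂ B) ν) (q3 : IsTwoFormOn g (U₁ B) τ₁)
    (q4 : IsTwoFormOn g (U₂ B) τ₂)
    (hH : ∀ x y z, H ![x, y, z] = wedge₁₂ (dual₃ g B 0 + dual₃ g B 2)
      (-wedge₁₁ (dual₃ g B 1) (ν + b • g.flat X) + wedge₁₁ β (g.flat X) + τ₁ + τ₂) x y z)
    (hM : LinearMap.toMatrix B B f = normalForm k m c u
      ((1 / 2) * (b ^ 2 + normSq₁ (frame₂ B) β + normSq₁ (frame₂ B) ν + normSq₂ (frame₁ B) τ₁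
        + normSq₂ (frame₂ B) τ₂))) : IsGeneralisedEinstein g H 0 := by
  obtain ⟨l, l', s, e, F, hB'⟩ := exists_isNullFrame_of_basis hB
  have hf1 : frame₁ B = fun p => e (Sum.inl p) := funext fun p => congrFun hB' _
  have hf2 : frame₂ B = fun q => e (Sum.inr q) := funext fun q => congrFun hB' _
  have D := (isFluxData_iff hB').2 ⟨q1, q2, q3, q4⟩
  have K := D.fluxValues F hA b
  obtain ⟨h1, h2, h3⟩ := (threeForm_eq_iff F hA hB' D).1 hH
  obtain ⟨m1, m2, m3, m4⟩ := (toMatrix_eq_normalForm_iff hB' f hf).1 hM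
  have h4 : ∀ y z, contract H l' y z = √2 * fluxForm g X s b β ν τ₁ τ₂ y z := fun y z => by
    rw [h1]; rfl
  have h5 : IsNormalFrame g H N X l l' s e c (fun j => √2 * u j) _ :=
    ⟨F, m1, m2, m3, m4, h2, h3, fun p => by rw [h4, K.X_inl, mul_zero], by
      simp only [h4]
      rw [K.sum_sq D.skew, hf1, hf2]⟩
  exact h5.isGeneralisedEinstein hA

end Translation

end GenLie

end

/-! ### The classification. -/

theorem mainTheorem7 {𝔤 : Type*} [LieRing 𝔤] [LieAlgebra ℝ 𝔤] [FiniteDimensional ℝ 𝔤]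
    (g : GenLie.PseudoMetric 𝔤) (hg : g.IsLorentzian)
    (H : 𝔤 [⋀^Fin 3]→ₗ[ℝ] ℝ) (hH : GenLie.IsClosedThreeForm H) (hH0 : H ≠ 0)
    (𝔫 : LieIdeal ℝ 𝔤) (hab : IsLieAbelian 𝔫)
    (hcodim : Module.finrank ℝ 𝔫 + 1 = Module.finrank ℝ 𝔤)
    (hnondeg : (g.form.restrict 𝔫.toSubmodule).Nondegenerate)
    (X : 𝔤) (hX : ∀ y ∈ 𝔫, g.form X y = 0) (hXX : g.form X X = 1 ∨ g.form X X = -1)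
    (f : Module.End ℝ 𝔫.toSubmodule) (hf : ∀ y : 𝔫.toSubmodule, (f y : 𝔤) = ⁅X, (y : 𝔤)⁆)
    (hS : ¬ GenLie.IsSecondType (g.restrict 𝔫.toSubmodule hnondeg)
      ((g.restrict 𝔫.toSubmodule hnondeg).symmPart f)) :
    GenLie.IsGeneralisedEinstein g H 0 ↔
      ∃ (k l : ℕ) (e : Module.Basis (GenLie.Idx k l) ℝ 𝔫.toSubmodule)
        (c : Fin k → ℝ) (u : (Fin 2 × Fin k) ⊕ Fin l → ℝ)
        (b : ℝ) (β ν : Module.Dual ℝ 𝔤) (τ₁ τ₂ : LinearMap.BilinForm ℝ 𝔤),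
        g.IsLorentzFrame (Sum.inl 0) (GenLie.frame e) ∧
        Antitone c ∧ (∀ i, 0 < c i) ∧
        GenLie.IsOneFormOn g (GenLie.U₂ e) β ∧ GenLie.IsOneFormOn g (GenLie.U₂ e) ν ∧
        GenLie.IsTwoFormOn g (GenLie.U₁ e) τ₁ ∧ GenLie.IsTwoFormOn g (GenLie.U₂ e) τ₂ ∧
        (b ≠ 0 ∨ β ≠ 0 ∨ ν ≠ 0 ∨ τ₁ ≠ 0 ∨ τ₂ ≠ 0) ∧
        (∀ Y ∈ GenLie.U₁ e, ∀ Z ∈ GenLie.U₁ e,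
          τ₁ (GenLie.complexStructure g (GenLie.frame₁ e) Y)
            (GenLie.complexStructure g (GenLie.frame₁ e) Z) = τ₁ Y Z) ∧
        (∀ i j, c i ≠ c j →
          ∀ Y ∈ Submodule.span ℝ {GenLie.frame₁ e (0, i), GenLie.frame₁ e (1, i)},
          ∀ Z ∈ Submodule.span ℝ {GenLie.frame₁ e (0, j), GenLie.frame₁ e (1, j)},
            τ₁ Y Z = 0) ∧
        (∀ x y z, H ![x, y, z] =
          GenLie.wedge₁₂ (GenLie.dual₃ g e 0 + GenLie.dual₃ g e 2)
            (-GenLie.wedge₁₁ (GenLie.dual₃ g e 1) (ν + b • g.flat X)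
              + GenLie.wedge₁₁ β (g.flat X) + τ₁ + τ₂) x y z) ∧
        LinearMap.toMatrix e e f = GenLie.normalForm k l c u
          ((1 / 2) * (b ^ 2 + GenLie.normSq₁ (GenLie.frame₂ e) β
            + GenLie.normSq₁ (GenLie.frame₂ e) ν + GenLie.normSq₂ (GenLie.frame₁ e) τ₁
            + GenLie.normSq₂ (GenLie.frame₂ e) τ₂)) := by
  have hA0 : ∀ ε, g.form X X = ε → ε * ε = 1 →
      GenLie.IsAlmostAbelian g 𝔫.toSubmodule X ε := fun ε h1 h2 =>
    GenLie.isAlmostAbelian_of_finrank 𝔫 hab hcodim hX h1 h2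
  constructor
  · intro hE
    obtain ⟨hX1, hN, l₀, hl, hl0, hll, L, hL⟩ :=
      (hA0 _ rfl (by rcases hXX with h | h <;> rw [h] <;> norm_num)).exists_null_eigenvector
        hg hXX hH0 hE hnondeg f hf hS
    exact GenLie.exists_normalForm (hA0 1 hX1 (one_mul 1)) hN hH hH0 hE hnondeg f hf hl hl0 hll hL
  · rintro ⟨k, l, e, c, u, b, β, ν, τ₁, τ₂, he, -, -, q1, q2, q3, q4, -, -, -, hH', hM⟩
    have hX0 : X ≠ 0 := fun h => by
      rw [h] at hXX
      simp at hXX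
    have hE0 : g.form (GenLie.frame e (Sum.inl 0)) (GenLie.frame e (Sum.inl 0)) = -1 := by
      rw [he]; simp
    -- The given basis contains a timelike vector of the ideal, and X is orthogonal to it, so X is
    -- spacelike.
    have hX1 : g.form X X = 1 := by
      have h1 := (GenLie.isLorentzOn_top hg).pos _ trivial
        (by rw [hE0]; norm_num : g.form (GenLie.frame e (Sum.inl 0)) _ < 0) X trivial
        (by rw [GenLie.form_comm]; exact hX _ (e _).2) hX0
      exact hXX.resolve_right fun h => by rw [h] at h1; norm_num at h1
    exact GenLie.isGeneralisedEinstein_of_normalForm (hA0 1 hX1 (one_mul 1)) f hf he q1 q2 q3 q4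
      hH' hM
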